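/- Let $d\ge 1$ and $m\ge 0$ be integers. For $i,j\in\mathbb Z^d$ put $|i-j|=\max_{1\le k\le d}|i_k-j_k|$, and for $A,B\subset\mathbb Z^d$ put $\rho(A,B)=\inf\{|i-j|: i\in A,\ j\in B\}$ (with $\inf\emptyset=\infty$). Let $\mathcal J\subset\mathbb Z^d$ be finite, $n=|\mathcal J|$, and let $\{X_i: i\in\mathcal J\}$ be an $m$-dependent random field, that is, real random variables on a common probability space such that $\{X_i: i\in A\}$ and $\{X_j: j\in B\}$ are independent whenever $A,B\subset\mathcal J$ and $\rho(A,B)>m$. Suppose that $\mathbb E X_i=0$ for all $i\in\mathcal J$ and that $W=\sum_{i\in\mathcal J}X_i$ satisfies $\operatorname{Var}(W)=1$. Put $B_i=\{j\in\mathcal J: |i-j|\le 2m\}$ and suppose that there are real numbers $a_n\ge 1$ and $b\ge 1$ such that $$\mathbb E\exp\Bigl(a_n\sum_{j\in B_i}|X_j|\Bigr)\le b\qquad\text{for all } i\in\mathcal J.$$ Let $\kappa=(8m+1)^d$, $\theta_n=b^{1/2}n^{1/2}a_n^{-1}$ and $\delta_n=\kappa^2a_n^{-1}(1+\theta_n^6)$,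 and let $\Phi$ be the standard normal distribution function. Then $$\Bigl|\frac{\mathbb P(W>z)}{1-\Phi(z)}-1\Bigr|\le C\,\delta_n\,(1+z^3)\qquad\text{for all } 0\le z\le c\,a_n^{1/3}\min\bigl\{1,\ \kappa^{-1/3}(1+\theta_n)^{-2/3}\bigr\},$$ where $C,c>0$ are absolute constants (independent of $d$, $m$, $\mathcal J$, $a_n$, $b$, $z$ and the law of the field). -/

import Mathlib

open MeasureTheory ProbabilityTheory

namespace MDepField

/-- The distance `|i - j| = max_k |i_k - j_k|` on the lattice `ℤ^d`. -/
def latticeDist {d : ℕ} (i j : Fin d → ℤ) : ℕ :=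
  Finset.univ.sup fun k => (i k - j k).natAbs

/-- The distance `ρ(A, B) = inf {|i - j| : i ∈ A, j ∈ B}` between sets of lattice points
(it is `⊤` when one of the sets is empty). -/
noncomputable def setDist {d : ℕ} (A B : Set (Fin d → ℤ)) : ℕ∞ :=
  ⨅ i ∈ A, ⨅ j ∈ B, (latticeDist i j : ℕ∞)

/-- `{X_i : i ∈ J}` is an `m`-dependent random field: the families `{X_i : i ∈ A}` and
`{X_j : j ∈ B}` are independent whenever `A, B ⊆ J` and `ρ(A, B) > m`. -/
def IsMDependent {d : ℕ} {J : Finset (Fin d → ℤ)} {Ω : Type*} [MeasurableSpace Ω]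
    (m : ℕ) (X : J → Ω → ℝ) (μ : Measure Ω) : Prop :=
  ∀ A B : Set J,
    (m : ℕ∞) < setDist ((fun i : J => (i : Fin d → ℤ)) '' A)
      ((fun i : J => (i : Fin d → ℤ)) '' B) →
    IndepFun (fun ω (i : A) => X i ω) (fun ω (j : B) => X j ω) μ

/-- The neighbourhood `B_i = {j ∈ J : |i - j| ≤ 2m}`. -/
def nbhd {d : ℕ} {J : Finset (Fin d → ℤ)} (m : ℕ) (i : J) : Finset J :=
  Finset.univ.filter fun j => latticeDist (i : Fin d → ℤ) (j : Fin d → ℤ) ≤ 2 * m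

/-- `θ = b^{1/2} n^{1/2} a^{-1}`. -/
noncomputable def theta (n : ℕ) (a b : ℝ) : ℝ := √b * √(n : ℝ) / a

/-- `δ = κ² a^{-1} (1 + θ⁶)`. -/
noncomputable def delta (κ : ℝ) (n : ℕ) (a b : ℝ) : ℝ :=
  κ ^ 2 / a * (1 + theta n a b ^ 6)

/-- The distribution function `Φ` of the standard normal law. -/
noncomputable def stdNormalCDF (z : ℝ) : ℝ := cdf (gaussianReal 0 1) z

end MDepField

/-! The argument combines Cramér's change of measure with Stein's method. Truncate the field at
level x = 1/(κ(1+z)) and let Q have density proportional to exp(zW). Then P(W > z) = ψ(z) exp(-z²)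
∫_{v>0} exp(-zv) dν(v), where ψ is the moment generating function of W and ν is the law of W - z
under Q. For a standard normal W the same formula holds with ψ(z) = exp(z²/2) and ν = N(0,1). So two
estimates are needed: log ψ(z) is close to z²/2 (`abs_log_sumMgf_sub_le`), and ν is close to N(0,1)
in Kolmogorov distance (`kolmogorov_tiltLaw_le`). The Gaussian integral is at least a constant over
1+z (`one_div_le_mills`), so an absolute error becomes a relative one at the price of a factor 1+z.

Both estimates come from one approximate Stein identity E W g(W) ≈ E g'(W) (`stein_identity`). The
choice g(w) = exp(sw) gives (log ψ)'(s) ≈ s; the choice g(w) = f(w-z) exp(zw), with f the Stein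
solution for h, gives E_Q h(W-z) ≈ ∫ h dN(0,1). Tilting destroys independence only mildly: because
|s|κx ≤ 1, deleting a neighbourhood from the exponent costs a bounded factor. Hence Q-expectations
of nonnegative local functions are at most a constant times the original ones
(`integral_mul_exp_le`), and the product of two far apart centred local functions has Q-mean of
second order in s (`abs_integral_far_le`). Sums of local functions therefore concentrate under Q
around their untilted means (`integral_abs_sum_sub_le`). This controls the local quadratic form in
the Stein identity. It also separates the sum of local remainders from a bump function of W in the
smoothing argument, after which the Kolmogorov distance reappears with a small coefficient and is
absorbed (`kolmogorov_of_ramp`).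

Truncation perturbs means, covariances and tail probabilities slightly (`meanErr_trunc_le`,
`varErr_trunc_le`, `abs_tail_sub_trunc_le`). Outside the regime where these errors are under
control, the asserted bound is trivial (`abs_tail_ratio_sub_one_le_of_range`). The natural parameter
throughout is B = nb/a² = θ², which is at least 1/2 because the variance is 1. -/

namespace MDepField

open Real Set

/-! ### The Mills ratio and the Gaussian tail -/

/-- The Mills ratio `∫₀^∞ exp (-w v - v²/2) dv` of the standard normal law. -/
noncomputable def mills (w : ℝ) : ℝ := ∫ v in Ioi (0 : ℝ), exp (-w * v - v ^ 2 / 2)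

lemma integrable_exp_neg_sq_div_two : Integrable fun v : ℝ => exp (-v ^ 2 / 2) := by
  have := integrable_exp_neg_mul_sq (b := 1 / 2) (by norm_num)
  refine this.congr (ae_of_all _ fun v => ?_)
  simp only
  congr 1; ring

lemma exp_mills_integrand (w v : ℝ) :
    exp (-w * v - v ^ 2 / 2) = exp (w ^ 2 / 2) * exp (-(v + w) ^ 2 / 2) := by
  rw [← exp_add]; congr 1; ring

lemma integrable_mills (w : ℝ) : Integrable fun v : ℝ => exp (-w * v - v ^ 2 / 2) := by
  simp_rw [exp_mills_integrand]
  exact (integrable_exp_neg_sq_div_two.comp_add_right w).const_mul _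

lemma mills_eq (w : ℝ) :
    mills w = exp (w ^ 2 / 2) * ∫ u in Ioi w, exp (-u ^ 2 / 2) := by
  unfold mills
  simp_rw [exp_mills_integrand]
  rw [integral_const_mul]
  congr 1
  have h := (measurePreserving_add_right volume w).setIntegral_preimage_emb
    (MeasurableEquiv.addRight w).measurableEmbedding (fun u => exp (-u ^ 2 / 2)) (Ioi w)
  rw [← h]
  congr 2
  ext v; simp

lemma mills_neg_eq (w : ℝ) :
    mills (-w) = exp (w ^ 2 / 2) * ∫ u in Iic w, exp (-u ^ 2 / 2) := by
  rw [mills_eq, neg_sq]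
  congr 1
  have h := integral_comp_neg_Iic w (fun u : ℝ => exp (-u ^ 2 / 2))
  rw [← h]; simp

lemma mills_le_two {w : ℝ} (hw : 0 ≤ w) : mills w ≤ 2 := by
  have h1 : mills w ≤ ∫ v in Ioi (0 : ℝ), exp (-(1 / 2) * v ^ 2) := by
    refine setIntegral_mono_on (integrable_mills w).integrableOn
      (integrable_exp_neg_mul_sq (by norm_num)).integrableOn measurableSet_Ioi fun v hv => ?_
    have := mul_nonneg hw (le_of_lt (mem_Ioi.1 hv))
    exact exp_le_exp.2 (by linarith)
  rw [integral_gaussian_Ioi] at h1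
  have h2 : √(π / (1 / 2)) ≤ 4 := by
    rw [show (4 : ℝ) = √16 by rw [show (16 : ℝ) = 4 ^ 2 by norm_num]; simp]
    exact sqrt_le_sqrt (by linarith [pi_le_four])
  linarith

lemma mul_mills_le_one {w : ℝ} (hw : 0 ≤ w) : w * mills w ≤ 1 := by
  rcases hw.eq_or_lt with rfl | hw
  · simp
  have h1 : mills w ≤ ∫ v in Ioi (0 : ℝ), exp (-w * v) := by
    refine setIntegral_mono_on (integrable_mills w).integrableOn ?_ measurableSet_Ioi
      fun v _ => ?_
    · exact integrableOn_exp_mul_Ioi (by linarith) 0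
    · exact exp_le_exp.2 (by nlinarith [sq_nonneg v])
  rw [integral_exp_mul_Ioi (by linarith)] at h1
  calc w * mills w ≤ w * (-exp (-w * 0) / -w) := mul_le_mul_of_nonneg_left h1 hw.le
    _ = 1 := by simp; field_simp

lemma mills_lower {w : ℝ} (hw : 0 ≤ w) : exp (-(3 / 2)) / (1 + w) ≤ mills w := by
  have hp : 0 < 1 + w := by linarith
  -- On this short interval w v ≤ 1 and v²/2 ≤ 1/2, so the integrand is at least exp(-3/2).
  have h1 : ∫ _ in Ioc (0 : ℝ) (1 / (1 + w)), exp (-(3 / 2)) ≤ mills w := by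
    calc _ ≤ ∫ v in Ioc (0 : ℝ) (1 / (1 + w)), exp (-w * v - v ^ 2 / 2) := by
          refine setIntegral_mono_on (by simp) (integrable_mills w).integrableOn
            measurableSet_Ioc fun v hv => ?_
          have h2 : v * (1 + w) ≤ 1 := by
            have := mul_le_mul_of_nonneg_right hv.2 hp.le
            rwa [one_div, inv_mul_cancel₀ hp.ne'] at this
          have h3 : 0 ≤ v := hv.1.le
          have h4 := mul_nonneg h3 hw
          exact exp_le_exp.2 (by nlinarith)
      _ ≤ mills w := setIntegral_mono_set (integrable_mills w).integrableOn
          (ae_of_all _ fun _ => (exp_pos _).le) Ioc_subset_Ioi_self.eventuallyLE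
  refine le_trans (le_of_eq ?_) h1
  rw [setIntegral_const]
  simp [Measure.real, hp.le]
  field_simp

/-- The standard normal law. -/
noncomputable abbrev stdGaussian : Measure ℝ := gaussianReal 0 1

lemma integral_stdGaussian (f : ℝ → ℝ) :
    ∫ x, f x ∂stdGaussian = (√(2 * π))⁻¹ * ∫ x, exp (-x ^ 2 / 2) * f x := by
  rw [integral_gaussianReal_eq_integral_smul one_ne_zero, ← integral_const_mul]
  congr 1; ext x
  simp [gaussianPDFReal]; ring

lemma setIntegral_stdGaussian (f : ℝ → ℝ) {s : Set ℝ} (hs : MeasurableSet s) :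
    ∫ x in s, f x ∂stdGaussian = (√(2 * π))⁻¹ * ∫ x in s, exp (-x ^ 2 / 2) * f x := by
  rw [← integral_indicator hs, integral_stdGaussian, ← integral_indicator hs]
  congr 2; ext x
  by_cases hx : x ∈ s <;> simp [hx]

lemma setIntegral_exp_stdGaussian (t : ℝ) :
    ∫ x in Ioi 0, exp (-t * x) ∂stdGaussian = (√(2 * π))⁻¹ * mills t := by
  rw [setIntegral_stdGaussian _ measurableSet_Ioi, mills]
  congr 2; ext x; rw [← exp_add]; congr 1; ring

lemma stdGaussian_real_Ioi (z : ℝ) :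
    stdGaussian.real (Ioi z) = exp (-z ^ 2 / 2) * ((√(2 * π))⁻¹ * mills z) := by
  have h : stdGaussian.real (Ioi z) = ∫ x in Ioi z, (1 : ℝ) ∂stdGaussian := by simp
  rw [h, setIntegral_stdGaussian _ measurableSet_Ioi, mills_eq]
  simp only [mul_one]
  have : exp (-z ^ 2 / 2) * exp (z ^ 2 / 2) = 1 := by rw [← exp_add]; simp; ring
  linear_combination (-(√(2 * π))⁻¹ * ∫ u in Ioi z, exp (-u ^ 2 / 2)) * this

lemma one_sub_stdNormalCDF (z : ℝ) :
    1 - stdNormalCDF z = exp (-z ^ 2 / 2) * ((√(2 * π))⁻¹ * mills z) := by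
  rw [stdNormalCDF, cdf_eq_real, ← stdGaussian_real_Ioi, ← compl_Iic,
    probReal_compl_eq_one_sub measurableSet_Iic]

lemma sqrt_two_pi_inv_le : (√(2 * π))⁻¹ ≤ 1 := by
  refine inv_le_one_of_one_le₀ ?_
  rw [one_le_sqrt]; linarith [pi_gt_three]

lemma le_sqrt_two_pi_inv : 1 / 3 ≤ (√(2 * π))⁻¹ := by
  rw [one_div]
  refine inv_anti₀ (by positivity) ?_
  rw [sqrt_le_left (by norm_num)]; linarith [pi_le_four]

/-- The constant is 15 = 3 · 5, from √(2π) ≤ 3 and exp(3/2) ≤ 5. This lower bound is what converts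
absolute errors into errors relative to the Gaussian tail. -/
lemma one_div_le_mills {w : ℝ} (hw : 0 ≤ w) : 1 / (15 * (1 + w)) ≤ (√(2 * π))⁻¹ * mills w := by
  have h1 : exp (3 / 2) ≤ 5 := by
    have h := exp_one_lt_d9.le
    have e : exp (3 / 2) ^ 2 = exp 1 ^ 3 := by
      rw [← exp_nat_mul, ← exp_nat_mul]; norm_num
    have h2 : exp (3 / 2) ^ 2 ≤ 5 ^ 2 := by
      rw [e]
      calc exp 1 ^ 3 ≤ 2.7182818286 ^ 3 := by gcongr
        _ ≤ _ := by norm_num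
    exact (abs_le_of_sq_le_sq' h2 (by norm_num)).2
  have h2 : 1 / 5 ≤ exp (-(3 / 2)) := by
    rw [exp_neg, one_div]; exact inv_anti₀ (exp_pos _) h1
  calc 1 / (15 * (1 + w)) = 1 / 3 * (1 / 5 / (1 + w)) := by field_simp; norm_num
    _ ≤ 1 / 3 * (exp (-(3 / 2)) / (1 + w)) := by gcongr
    _ ≤ _ := mul_le_mul le_sqrt_two_pi_inv (mills_lower hw) (by positivity) (by positivity)

lemma stdGaussian_real_Ioc_le {a b : ℝ} (h : a ≤ b) : stdGaussian.real (Ioc a b) ≤ b - a := by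
  have h0 : stdGaussian.real (Ioc a b) = ∫ x in Ioc a b, (1 : ℝ) ∂stdGaussian := by simp
  rw [h0, setIntegral_stdGaussian _ measurableSet_Ioc]
  simp only [mul_one]
  have h1 : ∫ x in Ioc a b, exp (-x ^ 2 / 2) ≤ ∫ _ in Ioc a b, (1 : ℝ) :=
    setIntegral_mono_on integrable_exp_neg_sq_div_two.integrableOn (by simp) measurableSet_Ioc
      fun x _ => exp_le_one_iff.2 (by nlinarith [sq_nonneg x])
  have h2 : ∫ _ in Ioc a b, (1 : ℝ) = b - a := by simp [h]
  rw [h2] at h1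
  have h3 : 0 ≤ ∫ x in Ioc a b, exp (-x ^ 2 / 2) := integral_nonneg fun _ => (exp_pos _).le
  calc _ ≤ 1 * ∫ x in Ioc a b, exp (-x ^ 2 / 2) :=
        mul_le_mul_of_nonneg_right sqrt_two_pi_inv_le h3
    _ ≤ _ := by linarith

/-! ### The Stein equation -/

/-- The solution `f` of the Stein equation `f' w - w f w = h w - ∫ h dγ`. -/
noncomputable def steinSol (h : ℝ → ℝ) (w : ℝ) : ℝ :=
  exp (w ^ 2 / 2) * ∫ u in Iic w, (h u - ∫ x, h x ∂stdGaussian) * exp (-u ^ 2 / 2)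

section Stein

variable {h : ℝ → ℝ} (hc : Continuous h) (h0 : ∀ x, 0 ≤ h x) (h1 : ∀ x, h x ≤ 1)
include hc h0 h1

lemma integrable_stdGaussian : Integrable h stdGaussian :=
  Integrable.of_bound hc.aestronglyMeasurable 1
    (ae_of_all _ fun x => by rw [norm_eq_abs, abs_le]; constructor <;> linarith [h0 x, h1 x])

lemma abs_sub_integral_le_one (u : ℝ) : |h u - ∫ x, h x ∂stdGaussian| ≤ 1 := by
  have a0 : 0 ≤ ∫ x, h x ∂stdGaussian := integral_nonneg h0
  have a1 : ∫ x, h x ∂stdGaussian ≤ ∫ _, (1 : ℝ) ∂stdGaussian :=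
    integral_mono (integrable_stdGaussian hc h0 h1) (by simp) h1
  simp at a1
  rw [abs_le]; constructor <;> linarith [h0 u, h1 u]

lemma integrable_stein (c : ℝ) : Integrable fun u => (h u - c) * exp (-u ^ 2 / 2) := by
  refine integrable_exp_neg_sq_div_two.bdd_mul (c := 1 + |c|)
    (hc.sub continuous_const).aestronglyMeasurable (ae_of_all _ fun u => ?_)
  rw [norm_eq_abs]
  calc |h u - c| ≤ |h u| + |c| := abs_sub _ _
    _ ≤ _ := by gcongr; rw [abs_le]; constructor <;> linarith [h0 u, h1 u]

lemma integral_stein : ∫ u, (h u - ∫ x, h x ∂stdGaussian) * exp (-u ^ 2 / 2) = 0 := by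
  have e : ∫ u, (h u - ∫ x, h x ∂stdGaussian) ∂stdGaussian = 0 := by
    rw [integral_sub (integrable_stdGaussian hc h0 h1) (by simp)]; simp
  rw [integral_stdGaussian] at e
  have hne : (√(2 * π))⁻¹ ≠ 0 := (lt_of_lt_of_le (by norm_num) le_sqrt_two_pi_inv).ne'
  simpa only [mul_comm] using (mul_eq_zero.1 e).resolve_left hne

/-- The centred integrand has total integral zero, so for w ≥ 0 the integral over the lower
half-line may be replaced by minus the one over the upper half-line. In either case a Gaussian tail
beyond |w| remains, since the centred test function is at most 1 in modulus. -/
lemma abs_steinSol_le (w : ℝ) : |steinSol h w| ≤ mills |w| := by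
  set c := ∫ x, h x ∂stdGaussian with hcdef
  have hint := integrable_stein hc h0 h1 c
  have key : ∀ s : Set ℝ, MeasurableSet s →
      |∫ u in s, (h u - c) * exp (-u ^ 2 / 2)| ≤ ∫ u in s, exp (-u ^ 2 / 2) := fun s hs => by
    refine abs_integral_le_integral_abs.trans ?_
    refine setIntegral_mono_on hint.abs.integrableOn
      integrable_exp_neg_sq_div_two.integrableOn hs fun u _ => ?_
    rw [abs_mul, abs_of_pos (exp_pos _)]
    exact mul_le_of_le_one_left (exp_pos _).le (abs_sub_integral_le_one hc h0 h1 u)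
  unfold steinSol
  rw [abs_mul, abs_of_pos (exp_pos _)]
  rcases le_total 0 w with hw | hw
  · rw [abs_of_nonneg hw, mills_eq]
    refine mul_le_mul_of_nonneg_left ?_ (exp_pos _).le
    have hs : ∫ u in Iic w, (h u - c) * exp (-u ^ 2 / 2)
        = -∫ u in Ioi w, (h u - c) * exp (-u ^ 2 / 2) := by
      have := integral_add_compl (measurableSet_Iic (a := w)) hint
      rw [compl_Iic, integral_stein hc h0 h1] at this
      linarith
    rw [← hcdef, hs, abs_neg]
    exact key _ measurableSet_Ioi
  · rw [abs_of_nonpos hw, mills_neg_eq]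
    exact mul_le_mul_of_nonneg_left (key _ measurableSet_Iic) (exp_pos _).le

lemma abs_steinSol_le_two (w : ℝ) : |steinSol h w| ≤ 2 :=
  (abs_steinSol_le hc h0 h1 w).trans (mills_le_two (abs_nonneg w))

lemma abs_mul_steinSol_le_one (w : ℝ) : |w * steinSol h w| ≤ 1 := by
  rw [abs_mul]
  exact (mul_le_mul_of_nonneg_left (abs_steinSol_le hc h0 h1 w) (abs_nonneg w)).trans
    (mul_mills_le_one (abs_nonneg w))

lemma hasDerivAt_steinSol (w : ℝ) :
    HasDerivAt (steinSol h) (w * steinSol h w + (h w - ∫ x, h x ∂stdGaussian)) w := by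
  set c := ∫ x, h x ∂stdGaussian with hcdef
  have hint := integrable_stein hc h0 h1 c
  have hcont : Continuous fun u => (h u - c) * exp (-u ^ 2 / 2) := by fun_prop
  have hI : ∀ v, ∫ u in Iic v, (h u - c) * exp (-u ^ 2 / 2)
      = (∫ u in Iic 0, (h u - c) * exp (-u ^ 2 / 2))
        + ∫ u in (0 : ℝ)..v, (h u - c) * exp (-u ^ 2 / 2) := fun v => by
    rw [← intervalIntegral.integral_Iic_sub_Iic hint.integrableOn hint.integrableOn]; ring
  have hd : HasDerivAt (fun v => ∫ u in Iic v, (h u - c) * exp (-u ^ 2 / 2))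
      ((h w - c) * exp (-w ^ 2 / 2)) w := by
    rw [funext hI]
    exact (hcont.integral_hasStrictDerivAt 0 w).hasDerivAt.const_add _
  have he : HasDerivAt (fun v : ℝ => exp (v ^ 2 / 2)) (exp (w ^ 2 / 2) * w) w := by
    have : HasDerivAt (fun v : ℝ => v ^ 2 / 2) w w := by
      simpa using (hasDerivAt_pow 2 w).div_const 2
    exact this.exp
  have := he.mul hd
  refine this.congr_deriv ?_
  unfold steinSol
  have e1 : exp (w ^ 2 / 2) * exp (-w ^ 2 / 2) = 1 := by
    rw [← exp_add, show w ^ 2 / 2 + -w ^ 2 / 2 = 0 by ring, exp_zero]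
  rw [← hcdef]
  linear_combination (h w - c) * e1

lemma continuous_steinSol : Continuous (steinSol h) :=
  continuous_iff_continuousAt.2 fun w => (hasDerivAt_steinSol hc h0 h1 w).continuousAt

lemma abs_steinSol_deriv_le (w : ℝ) :
    |w * steinSol h w + (h w - ∫ x, h x ∂stdGaussian)| ≤ 2 := by
  refine (abs_add_le _ _).trans ?_
  linarith [abs_mul_steinSol_le_one hc h0 h1 w, abs_sub_integral_le_one hc h0 h1 w]

lemma abs_steinSol_sub_le (v w : ℝ) : |steinSol h v - steinSol h w| ≤ 2 * |v - w| := by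
  exact convex_univ.norm_image_sub_le_of_norm_hasDerivWithin_le
    (fun x _ => (hasDerivAt_steinSol hc h0 h1 x).hasDerivWithinAt)
    (fun x _ => abs_steinSol_deriv_le hc h0 h1 x) (mem_univ w) (mem_univ v)

/-- The derivative is w f + h - c. The increment of h stays explicit: for a ramp it is of order |v -
w|/ε, and it is affordable only because it is localised near the jump. -/
lemma abs_steinSol_deriv_sub_le (v w : ℝ) :
    |(v * steinSol h v + (h v - ∫ x, h x ∂stdGaussian))
      - (w * steinSol h w + (h w - ∫ x, h x ∂stdGaussian))|
      ≤ (2 + 2 * |w|) * |v - w| + |h v - h w| := by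
  have e : (v * steinSol h v + (h v - ∫ x, h x ∂stdGaussian))
      - (w * steinSol h w + (h w - ∫ x, h x ∂stdGaussian))
      = (v - w) * steinSol h v + w * (steinSol h v - steinSol h w) + (h v - h w) := by ring
  rw [e]
  refine (abs_add_le _ _).trans (add_le_add_left ((abs_add_le _ _).trans ?_) _)
  rw [abs_mul, abs_mul]
  have a1 := mul_le_mul_of_nonneg_left (abs_steinSol_le_two hc h0 h1 v) (abs_nonneg (v - w))
  have a2 := mul_le_mul_of_nonneg_left (abs_steinSol_sub_le hc h0 h1 v w) (abs_nonneg w)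
  linarith

end Stein
end MDepField

namespace MDepField

open Real Set

/-! ### Smoothed indicators and Kolmogorov distance -/

/-- The continuous function equal to `1` on `(-∞, y]`, to `0` on `[y + ε, ∞)`, and affine between. -/
noncomputable def ramp (y ε w : ℝ) : ℝ := max 0 (min 1 ((y + ε - w) / ε))

/-- The bump `1 / (1 + ((w - y) / ε)²)`. -/
noncomputable def bump (y ε w : ℝ) : ℝ := (1 + ((w - y) / ε) ^ 2)⁻¹

lemma continuous_ramp (y ε : ℝ) : Continuous (ramp y ε) := by unfold ramp; fun_prop

lemma ramp_nonneg (y ε w : ℝ) : 0 ≤ ramp y ε w := le_max_left _ _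

lemma ramp_le_one (y ε w : ℝ) : ramp y ε w ≤ 1 := max_le zero_le_one (min_le_left _ _)

lemma ramp_eq_one {y ε w : ℝ} (hε : 0 < ε) (h : w ≤ y) : ramp y ε w = 1 := by
  unfold ramp
  have : 1 ≤ (y + ε - w) / ε := by rw [le_div_iff₀ hε]; linarith
  simp [this]

lemma ramp_eq_zero {y ε w : ℝ} (hε : 0 < ε) (h : y + ε ≤ w) : ramp y ε w = 0 := by
  unfold ramp
  have : (y + ε - w) / ε ≤ 0 := div_nonpos_of_nonpos_of_nonneg (by linarith) hε.le
  simp [this]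

lemma abs_ramp_sub_le {y ε : ℝ} (hε : 0 < ε) (v w : ℝ) :
    |ramp y ε v - ramp y ε w| ≤ |v - w| / ε := by
  unfold ramp
  have h1 : |max 0 (min 1 ((y + ε - v) / ε)) - max 0 (min 1 ((y + ε - w) / ε))|
      ≤ |(y + ε - v) / ε - (y + ε - w) / ε| :=
    by
      rw [max_comm 0, max_comm 0]
      refine (abs_max_sub_max_le_abs _ _ _).trans ?_
      simpa using abs_min_sub_min_le_max (1 : ℝ) ((y + ε - v) / ε) 1 ((y + ε - w) / ε)
  refine h1.trans (le_of_eq ?_)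
  rw [← sub_div, abs_div, abs_of_pos hε, abs_sub_comm v w]
  congr 2; ring

lemma continuous_bump (y ε : ℝ) : Continuous (bump y ε) := by
  unfold bump
  exact Continuous.inv₀ (by fun_prop) fun w => by positivity

lemma bump_pos (y ε w : ℝ) : 0 < bump y ε w := by unfold bump; positivity

lemma bump_le_one (y ε w : ℝ) : bump y ε w ≤ 1 :=
  inv_le_one_of_one_le₀ (by linarith [sq_nonneg ((w - y) / ε)])

/-- The increment vanishes unless w lies within ε + |v - w| of y, and there the bump is at least
1/(2(1+r)²) with r = |v - w|/ε. The gain is a product form: the increment enters through a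
polynomial, while the bump depends on w alone. -/
lemma abs_ramp_sub_le_bump {y ε : ℝ} (hε : 0 < ε) (v w : ℝ) :
    |ramp y ε v - ramp y ε w| ≤
      |v - w| / ε * (2 * (1 + |v - w| / ε) ^ 2) * bump y ε w := by
  set r := |v - w| / ε with hr
  have hr0 : 0 ≤ r := by positivity
  by_cases hw : |w - y| ≤ ε + |v - w|
  · have h2 : |(w - y) / ε| ≤ 1 + r := by
      rw [abs_div, abs_of_pos hε, div_le_iff₀ hε, hr, add_mul, div_mul_cancel₀ _ hε.ne']
      linarith
    have h3 : ((w - y) / ε) ^ 2 ≤ (1 + r) ^ 2 :=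
      sq_le_sq' (by linarith [(abs_le.1 h2).1]) (abs_le.1 h2).2
    have h4 : 1 ≤ 2 * (1 + r) ^ 2 * bump y ε w := by
      unfold bump
      rw [← div_eq_mul_inv, le_div_iff₀ (by positivity)]
      nlinarith
    calc _ ≤ r * 1 := by rw [mul_one]; exact abs_ramp_sub_le hε v w
      _ ≤ r * (2 * (1 + r) ^ 2 * bump y ε w) := mul_le_mul_of_nonneg_left h4 hr0
      _ = _ := by ring
  · have hz : ramp y ε v = ramp y ε w := by
      have hvw := abs_le.1 (le_refl |v - w|)
      rcases lt_abs.1 (not_le.1 hw) with h | h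
      · rw [ramp_eq_zero hε (by linarith), ramp_eq_zero hε (by linarith [abs_nonneg (v - w)])]
      · rw [ramp_eq_one hε (by linarith), ramp_eq_one hε (by linarith [abs_nonneg (v - w)])]
    rw [hz, sub_self, abs_zero]
    have := bump_pos y ε w
    positivity

section Kolmogorov

variable {ν : Measure ℝ} [IsProbabilityMeasure ν]

lemma integrable_of_continuous_le_one {f : ℝ → ℝ} (hf : Continuous f) (h0 : ∀ x, 0 ≤ f x)
    (h1 : ∀ x, f x ≤ 1) : Integrable f ν :=
  Integrable.of_bound hf.aestronglyMeasurable 1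
    (ae_of_all _ fun x => by rw [norm_eq_abs, abs_of_nonneg (h0 x)]; exact h1 x)

lemma measureReal_Iic_le_integral_ramp {y ε : ℝ} (hε : 0 < ε) :
    ν.real (Iic y) ≤ ∫ w, ramp y ε w ∂ν := by
  rw [← integral_indicator_one measurableSet_Iic]
  refine integral_mono ((integrable_const (1 : ℝ)).indicator measurableSet_Iic)
    (integrable_of_continuous_le_one (continuous_ramp y ε) (ramp_nonneg y ε) (ramp_le_one y ε))
    fun w => ?_
  by_cases hw : w ≤ y
  · simp [hw, ramp_eq_one hε hw]
  · simp [hw, ramp_nonneg]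

lemma integral_ramp_le_measureReal_Iic {y ε : ℝ} (hε : 0 < ε) :
    ∫ w, ramp y ε w ∂ν ≤ ν.real (Iic (y + ε)) := by
  rw [← integral_indicator_one measurableSet_Iic]
  refine integral_mono (integrable_of_continuous_le_one (continuous_ramp y ε) (ramp_nonneg y ε)
    (ramp_le_one y ε)) ((integrable_const (1 : ℝ)).indicator measurableSet_Iic) fun w => ?_
  by_cases hw : w ≤ y + ε
  · simp [hw, ramp_le_one]
  · simp [hw, ramp_eq_zero hε (not_le.1 hw).le]

lemma measureReal_Ioc {a b : ℝ} (h : a ≤ b) :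
    ν.real (Ioc a b) = ν.real (Iic b) - ν.real (Iic a) := by
  rw [← Iic_sdiff_Iic, measureReal_sdiff (Iic_subset_Iic.2 h) measurableSet_Iic]

lemma measureReal_Ioc_le {K : ℝ} (hK : ∀ y, |ν.real (Iic y) - stdGaussian.real (Iic y)| ≤ K)
    {a b : ℝ} (h : a ≤ b) : ν.real (Ioc a b) ≤ b - a + 2 * K := by
  have h1 := stdGaussian_real_Ioc_le h
  rw [measureReal_Ioc h] at h1 ⊢
  have ha := abs_le.1 (hK a)
  have hb := abs_le.1 (hK b)
  linarith [ha.1, hb.2]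

/-- Layer-cake formula: the set where the bump is at least u sits in an interval of length 2ε
u^(-1/2) + ε, whose mass is at most its length plus 2K. Integrating over u in (0, 1] gives 4ε + ε +
2K. -/
lemma integral_bump_le {K : ℝ} (hK : ∀ y, |ν.real (Iic y) - stdGaussian.real (Iic y)| ≤ K)
    (y : ℝ) {ε : ℝ} (hε : 0 < ε) : ∫ w, bump y ε w ∂ν ≤ 5 * ε + 2 * K := by
  have hK0 : 0 ≤ K := (abs_nonneg _).trans (hK 0)
  rw [Integrable.integral_eq_integral_meas_le (integrable_of_continuous_le_one
    (continuous_bump y ε) (fun w => (bump_pos y ε w).le) (bump_le_one y ε))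
    (ae_of_all _ fun w => (bump_pos y ε w).le)]
  have hle : ∀ u ∈ Ioi (0 : ℝ), ν.real {w | u ≤ bump y ε w} ≤
      (Ioc (0 : ℝ) 1).indicator (fun u => 2 * ε * u ^ (-(1 / 2) : ℝ) + (ε + 2 * K)) u := by
    intro u hu
    have hu0 : 0 < u := hu
    by_cases hu1 : u ≤ 1
    · rw [indicator_of_mem (mem_Ioc.2 ⟨hu0, hu1⟩)]
      have hsq : u ^ (-(1 / 2) : ℝ) = (√u)⁻¹ := by
        rw [rpow_neg hu0.le, sqrt_eq_rpow]
      rw [hsq]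
      have hpos : 0 < √u := sqrt_pos.2 hu0
      -- The left end is moved by a further ε so that a half-open interval contains the closed level
      -- set.
      have hsub : {w | u ≤ bump y ε w} ⊆ Ioc (y - ε * (√u)⁻¹ - ε) (y + ε * (√u)⁻¹) := by
        intro w hw
        have hw' : u ≤ (1 + ((w - y) / ε) ^ 2)⁻¹ := hw
        rw [le_inv_comm₀ hu0 (by positivity)] at hw'
        have h2 : ((w - y) / ε) ^ 2 ≤ ((√u)⁻¹) ^ 2 := by
          rw [inv_pow, sq_sqrt hu0.le]; linarith
        have h3 := abs_le_of_sq_le_sq' h2 (by positivity)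
        rw [div_le_iff₀ hε, le_div_iff₀ hε] at h3
        constructor <;> nlinarith [h3.1, h3.2]
      refine (measureReal_mono hsub).trans ((measureReal_Ioc_le hK ?_).trans (le_of_eq (by ring)))
      have : 0 < ε * (√u)⁻¹ := by positivity
      linarith
    · rw [indicator_of_notMem (fun h => hu1 h.2)]
      have : {w | u ≤ bump y ε w} = ∅ := by
        ext w
        simp only [mem_ofPred_eq, mem_empty_iff_false, iff_false, not_le]
        exact (bump_le_one y ε w).trans_lt (not_le.1 hu1)
      simp [this]
  have hii : IntervalIntegrable (fun u : ℝ => u ^ (-(1 / 2) : ℝ)) volume 0 1 :=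
    intervalIntegral.intervalIntegrable_rpow' (by norm_num)
  have hii2 : IntervalIntegrable (fun u : ℝ => 2 * ε * u ^ (-(1 / 2) : ℝ) + (ε + 2 * K))
      volume 0 1 := (hii.const_mul _).add intervalIntegrable_const
  have hio : IntegrableOn (fun u : ℝ => 2 * ε * u ^ (-(1 / 2) : ℝ) + (ε + 2 * K)) (Ioc 0 1) :=
    (intervalIntegrable_iff_integrableOn_Ioc_of_le zero_le_one).1 hii2
  calc _ ≤ ∫ u in Ioi (0 : ℝ),
        (Ioc (0 : ℝ) 1).indicator (fun u => 2 * ε * u ^ (-(1 / 2) : ℝ) + (ε + 2 * K)) u := by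
        refine integral_mono_of_nonneg (ae_of_all _ fun _ => measureReal_nonneg)
          (hio.integrable_indicator measurableSet_Ioc).integrableOn ?_
        exact (ae_restrict_iff' measurableSet_Ioi).2 (ae_of_all _ hle)
    _ = ∫ u in (0 : ℝ)..1, (2 * ε * u ^ (-(1 / 2) : ℝ) + (ε + 2 * K)) := by
        rw [setIntegral_indicator measurableSet_Ioc,
          inter_eq_self_of_subset_right Ioc_subset_Ioi_self,
          intervalIntegral.integral_of_le zero_le_one]
    _ = 5 * ε + 2 * K := by
        rw [intervalIntegral.integral_add (hii.const_mul _) intervalIntegrable_const,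
          intervalIntegral.integral_const_mul, integral_rpow (Or.inl (by norm_num))]
        norm_num
        ring

/-- A smoothed comparison that is self-improving bounds the Kolmogorov distance. -/
lemma kolmogorov_of_ramp {E ε : ℝ} (hε : 0 < ε)
    (h : ∀ y, |∫ w, ramp y ε w ∂ν - ∫ w, ramp y ε w ∂stdGaussian|
      ≤ E + 1 / 4 * ∫ w, bump y ε w ∂ν) (y : ℝ) :
    |ν.real (Iic y) - stdGaussian.real (Iic y)| ≤ 2 * E + 5 * ε := by
  set D : ℝ → ℝ := fun y => |ν.real (Iic y) - stdGaussian.real (Iic y)| with hD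
  have hbdd : BddAbove (range D) := by
    refine ⟨1, ?_⟩
    rintro _ ⟨y, rfl⟩
    rw [hD, abs_le]
    constructor <;> linarith [measureReal_nonneg (μ := ν) (s := Iic y),
      measureReal_le_one (μ := ν) (s := Iic y),
      measureReal_nonneg (μ := stdGaussian) (s := Iic y),
      measureReal_le_one (μ := stdGaussian) (s := Iic y)]
  set K := ⨆ y, D y with hK
  have hDK : ∀ y, D y ≤ K := fun y => le_ciSup hbdd y
  have hb : ∀ y, ∫ w, bump y ε w ∂ν ≤ 5 * ε + 2 * K := fun y => integral_bump_le hDK y hε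
  have hstep : ∀ y, D y ≤ ε + E + 1 / 4 * (5 * ε + 2 * K) := by
    intro y
    have hg := fun y : ℝ => stdGaussian_real_Ioc_le (show y ≤ y + ε by linarith)
    simp_rw [measureReal_Ioc (ν := stdGaussian) (show ∀ {y}, y ≤ y + ε by intro y; linarith)] at hg
    rw [hD, abs_le]
    constructor
    -- For the lower bound the ramp is shifted left, so that it descends on [y - ε, y].
    · have a1 := integral_ramp_le_measureReal_Iic (ν := ν) (y := y - ε) hε
      have a2 := measureReal_Iic_le_integral_ramp (ν := stdGaussian) (y := y - ε) hε
      have a3 := (abs_le.1 (h (y - ε))).1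
      have a4 := hg (y - ε)
      rw [sub_add_cancel] at a1 a4
      linarith [hb (y - ε)]
    · have a1 := measureReal_Iic_le_integral_ramp (ν := ν) (y := y) hε
      have a2 := integral_ramp_le_measureReal_Iic (ν := stdGaussian) (y := y) hε
      have a3 := (abs_le.1 (h y)).2
      linarith [hb y, hg y]
  -- The right side contains K/2, which is absorbed because K, a supremum of numbers at most 1, is
  -- finite.
  have hKle : K ≤ ε + E + 1 / 4 * (5 * ε + 2 * K) := ciSup_le hstep
  exact (hDK y).trans (by linarith)

/-- Layer cake again: for t > 0 the superlevel sets of exp(-t x) on x > 0 are the intervals (0, -log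
u / t], whose masses under the two laws differ by at most 2K. For t = 0 they are the half-line
itself. -/
lemma setIntegral_exp_sub_le {K t : ℝ} (ht : 0 ≤ t)
    (hK : ∀ y, |ν.real (Iic y) - stdGaussian.real (Iic y)| ≤ K) :
    |∫ x in Ioi 0, exp (-t * x) ∂ν - ∫ x in Ioi 0, exp (-t * x) ∂stdGaussian| ≤ 2 * K := by
  have hK0 : 0 ≤ K := (abs_nonneg _).trans (hK 0)
  set f : ℝ → ℝ := (Ioi (0 : ℝ)).indicator fun x => exp (-t * x) with hf
  have hfm : Measurable f := by
    refine Measurable.indicator ?_ measurableSet_Ioi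
    fun_prop
  have hf0 : ∀ x, 0 ≤ f x := fun x => indicator_nonneg (fun _ _ => (exp_pos _).le) x
  have hf1 : ∀ x, f x ≤ 1 := fun x => by
    by_cases hx : 0 < x
    · rw [hf, indicator_of_mem (mem_Ioi.2 hx), exp_le_one_iff]
      nlinarith
    · rw [hf, indicator_of_notMem (by simpa using hx)]; exact zero_le_one
  have hfi : ∀ (ρ : Measure ℝ) [IsProbabilityMeasure ρ], Integrable f ρ := fun ρ _ =>
    Integrable.of_bound hfm.aestronglyMeasurable 1
      (ae_of_all _ fun x => by rw [norm_eq_abs, abs_of_nonneg (hf0 x)]; exact hf1 x)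
  have hlc : ∀ (ρ : Measure ℝ) [IsProbabilityMeasure ρ],
      ∫ x in Ioi 0, exp (-t * x) ∂ρ = ∫ u in Ioc (0 : ℝ) 1, ρ.real {x | u ≤ f x} := by
    intro ρ _
    rw [← integral_indicator measurableSet_Ioi,
      Integrable.integral_eq_integral_Ioc_meas_le (M := 1) (hfi ρ) (ae_of_all _ hf0)
        (ae_of_all _ hf1)]
  have hanti : ∀ (ρ : Measure ℝ) [IsProbabilityMeasure ρ],
      IntegrableOn (fun u => ρ.real {x | u ≤ f x}) (Ioc (0 : ℝ) 1) := by
    intro ρ _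
    have : Antitone fun u => ρ.real {x | u ≤ f x} := fun u v huv =>
      measureReal_mono fun x hx => le_trans huv hx
    refine Measure.integrableOn_of_bounded (M := 1) (by simp) this.measurable.aestronglyMeasurable
      (ae_of_all _ fun u => ?_)
    rw [norm_eq_abs, abs_of_nonneg measureReal_nonneg]
    exact measureReal_le_one
  rw [hlc ν, hlc stdGaussian, ← integral_sub (hanti ν) (hanti _)]
  have hpt : ∀ u ∈ Ioc (0 : ℝ) 1,
      ‖ν.real {x | u ≤ f x} - stdGaussian.real {x | u ≤ f x}‖ ≤ 2 * K := by
    intro u hu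
    rw [norm_eq_abs]
    rcases ht.eq_or_lt with ht0 | ht0
    · have hs : {x | u ≤ f x} = (Iic 0)ᶜ := by
        ext x
        by_cases hx : 0 < x
        · simp [hf, hx, ← ht0, hu.2]
        · simp [hf, hx, hu.1]
      rw [hs, probReal_compl_eq_one_sub measurableSet_Iic,
        probReal_compl_eq_one_sub measurableSet_Iic]
      have := hK 0
      rw [abs_sub_comm] at this
      calc _ = |stdGaussian.real (Iic 0) - ν.real (Iic 0)| := by congr 1; ring
        _ ≤ _ := by linarith
    · have hs : {x | u ≤ f x} = Ioc 0 (-log u / t) := by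
        ext x
        by_cases hx : 0 < x
        · simp only [hf, mem_ofPred_eq, indicator_of_mem (mem_Ioi.2 hx), mem_Ioc, hx, true_and]
          rw [← log_le_iff_le_exp hu.1, le_div_iff₀ ht0]
          constructor <;> intro h <;> linarith
        · simp [hf, hx, hu.1]
      have hn : 0 ≤ -log u / t :=
        div_nonneg (by linarith [log_nonpos hu.1.le hu.2]) ht
      rw [hs, measureReal_Ioc hn, measureReal_Ioc hn]
      have a1 := abs_le.1 (hK 0)
      have a2 := abs_le.1 (hK (-log u / t))
      rw [abs_le]; constructor <;> linarith [a1.1, a1.2, a2.1, a2.2]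
  have := norm_setIntegral_le_of_norm_le_const (μ := volume) (s := Ioc (0 : ℝ) 1) (by simp) hpt
  simpa using this

end Kolmogorov
end MDepField

namespace MDepField

open Real Finset

set_option linter.unusedSectionVars false

/-! ### Bounded measurable functions -/

variable {ι Ω : Type*} [MeasurableSpace Ω]

/-- Bounded measurable real functions. -/
def BddMeas (f : Ω → ℝ) : Prop := Measurable f ∧ ∃ C, ∀ ω, |f ω| ≤ C

namespace BddMeas

variable {f g : Ω → ℝ}

lemma const (c : ℝ) : BddMeas fun _ : Ω => c := ⟨measurable_const, |c|, fun _ => le_rfl⟩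

lemma add (hf : BddMeas f) (hg : BddMeas g) : BddMeas fun ω => f ω + g ω := by
  obtain ⟨hf, C, hC⟩ := hf
  obtain ⟨hg, D, hD⟩ := hg
  exact ⟨hf.add hg, C + D, fun ω => (abs_add_le _ _).trans (add_le_add (hC ω) (hD ω))⟩

lemma mul (hf : BddMeas f) (hg : BddMeas g) : BddMeas fun ω => f ω * g ω := by
  obtain ⟨hf, C, hC⟩ := hf
  obtain ⟨hg, D, hD⟩ := hg
  refine ⟨hf.mul hg, C * D, fun ω => ?_⟩
  rw [abs_mul]
  exact mul_le_mul (hC ω) (hD ω) (abs_nonneg _) ((abs_nonneg _).trans (hC ω))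

lemma sum {s : Finset ι} {F : ι → Ω → ℝ} (h : ∀ i ∈ s, BddMeas (F i)) :
    BddMeas fun ω => ∑ i ∈ s, F i ω := by
  classical
  induction s using Finset.induction_on with
  | empty => simpa using const 0
  | insert a s ha ih =>
    simp_rw [sum_insert ha]
    exact (h a (mem_insert_self a s)).add (ih fun i hi => h i (mem_insert_of_mem hi))

lemma comp {φ : ℝ → ℝ} (hφ : Continuous φ) (hf : BddMeas f) : BddMeas fun ω => φ (f ω) := by
  obtain ⟨hf, C, hC⟩ := hf
  obtain ⟨D, hD⟩ := (isCompact_Icc (a := -C) (b := C)).exists_bound_of_continuousOn hφ.continuousOn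
  exact ⟨hφ.measurable.comp hf, D, fun ω => hD _ (abs_le.1 (hC ω))⟩

lemma sub (hf : BddMeas f) (hg : BddMeas g) : BddMeas fun ω => f ω - g ω := by
  have := hf.add (hg.comp continuous_neg)
  simpa [sub_eq_add_neg] using this

lemma abs (hf : BddMeas f) : BddMeas fun ω => |f ω| := hf.comp continuous_abs

lemma pow (hf : BddMeas f) (n : ℕ) : BddMeas fun ω => f ω ^ n := hf.comp (continuous_pow n)

lemma const_mul (c : ℝ) (hf : BddMeas f) : BddMeas fun ω => c * f ω := (const c).mul hf

lemma exp_mul (s : ℝ) (hf : BddMeas f) : BddMeas fun ω => exp (s * f ω) :=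
  hf.comp (φ := fun v => exp (s * v)) (by fun_prop)

lemma integrable {μ : Measure Ω} [IsFiniteMeasure μ] (hf : BddMeas f) : Integrable f μ := by
  obtain ⟨hf, C, hC⟩ := hf
  exact Integrable.of_bound hf.aestronglyMeasurable C (ae_of_all _ hC)

end BddMeas

lemma abs_integral_le_integral {μ : Measure Ω} {f g : Ω → ℝ} (hg : Integrable g μ)
    (h : ∀ ω, |f ω| ≤ g ω) : |∫ ω, f ω ∂μ| ≤ ∫ ω, g ω ∂μ :=
  (norm_integral_le_of_norm_le (f := f) hg (ae_of_all _ h) :)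

lemma sq_integral_le {μ : Measure Ω} [IsProbabilityMeasure μ] {f : Ω → ℝ} (hf : BddMeas f) :
    (∫ ω, f ω ∂μ) ^ 2 ≤ ∫ ω, f ω ^ 2 ∂μ := by
  set c := ∫ ω, f ω ∂μ with hc
  have h : 0 ≤ ∫ ω, (f ω - c) ^ 2 ∂μ := integral_nonneg fun ω => sq_nonneg _
  have e : ∫ ω, (f ω - c) ^ 2 ∂μ = ∫ ω, f ω ^ 2 ∂μ - c ^ 2 := by
    have : ∀ ω, (f ω - c) ^ 2 = f ω ^ 2 - (2 * c) * f ω + c ^ 2 := fun ω => by ring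
    simp_rw [this]
    rw [integral_add ((hf.pow 2).sub (hf.const_mul _)).integrable (integrable_const _),
      integral_sub (hf.pow 2).integrable (hf.const_mul _).integrable, integral_const_mul, ← hc]
    simp; ring
  linarith

lemma integral_abs_le_of_sq {μ : Measure Ω} [IsProbabilityMeasure μ] {f : Ω → ℝ}
    (hf : BddMeas f) {B : ℝ} (hB : 0 ≤ B) (h : ∫ ω, f ω ^ 2 ∂μ ≤ B ^ 2) :
    ∫ ω, |f ω| ∂μ ≤ B := by
  have h1 := sq_integral_le (μ := μ) hf.abs
  simp_rw [sq_abs] at h1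
  exact abs_le_of_sq_le_sq (h1.trans h) hB |> fun h => (le_abs_self _).trans h

/-! ### Locally dependent fields -/

/-- The sum of the field over `D`. -/
def psum (X : ι → Ω → ℝ) (D : Finset ι) (ω : Ω) : ℝ := ∑ i ∈ D, X i ω

/-- The sum of the absolute values of the field over `D`. -/
def asum (X : ι → Ω → ℝ) (D : Finset ι) (ω : Ω) : ℝ := ∑ i ∈ D, |X i ω|

/-- The σ-algebra generated by the field on `D`. -/
@[reducible] def fieldSigma (X : ι → Ω → ℝ) (D : Finset ι) : MeasurableSpace Ω :=
  ⨆ i ∈ D, MeasurableSpace.comap (X i) inferInstance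

section Basic

variable {X : ι → Ω → ℝ} {D E : Finset ι}

lemma fieldSigma_le (hX : ∀ i, Measurable (X i)) (D : Finset ι) :
    fieldSigma X D ≤ (inferInstance : MeasurableSpace Ω) :=
  iSup₂_le fun i _ => (hX i).comap_le

lemma fieldSigma_mono (h : D ⊆ E) : fieldSigma X D ≤ fieldSigma X E :=
  biSup_mono fun _ hi => h hi

lemma measurable_fieldSigma {i : ι} (hi : i ∈ D) : Measurable[fieldSigma X D] (X i) :=
  Measurable.mono (comap_measurable (X i))
    (le_iSup₂ (f := fun i (_ : i ∈ D) => MeasurableSpace.comap (X i) inferInstance) i hi) le_rfl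

lemma measurable_psum (h : E ⊆ D) : Measurable[fieldSigma X D] (psum X E) :=
  Finset.measurable_fun_sum (m := fieldSigma X D) E fun _ hi => measurable_fieldSigma (h hi)

lemma measurable_asum (h : E ⊆ D) : Measurable[fieldSigma X D] (asum X E) :=
  Finset.measurable_fun_sum (m := fieldSigma X D) E fun _ hi =>
    continuous_abs.measurable.comp (measurable_fieldSigma (h hi))

lemma asum_nonneg (ω : Ω) : 0 ≤ asum X D ω := sum_nonneg fun _ _ => abs_nonneg _

lemma abs_psum_le (ω : Ω) : |psum X D ω| ≤ asum X D ω := abs_sum_le_sum_abs _ _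

lemma asum_mono (h : D ⊆ E) (ω : Ω) : asum X D ω ≤ asum X E ω :=
  sum_le_sum_of_subset_of_nonneg h fun _ _ _ => abs_nonneg _

lemma abs_le_asum {i : ι} (hi : i ∈ D) (ω : Ω) : |X i ω| ≤ asum X D ω :=
  single_le_sum (f := fun i => |X i ω|) (fun _ _ => abs_nonneg _) hi

end Basic

variable [Fintype ι]

/-- The closed ball of radius `r` about `i` for the distance `ρ`. -/
def ball (ρ : ι → ι → ℕ) (i : ι) (r : ℕ) : Finset ι := univ.filter fun j => ρ i j ≤ r

lemma mem_ball {ρ : ι → ι → ℕ} {i j : ι} {r : ℕ} : j ∈ ball ρ i r ↔ ρ i j ≤ r := by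
  simp [ball]

/-- A field with independence over sets more than `m` apart for the pseudo-distance `ρ`, whose
balls of radius `4m` have at most `κ` points. -/
structure LocalField (ρ : ι → ι → ℕ) (m : ℕ) (κ : ℝ) (X : ι → Ω → ℝ) (μ : Measure Ω) :
    Prop where
  self : ∀ i, ρ i i = 0
  symm : ∀ i j, ρ i j = ρ j i
  tri : ∀ i j k, ρ i k ≤ ρ i j + ρ j k
  card : ∀ i, ((ball ρ i (4 * m)).card : ℝ) ≤ κ
  meas : ∀ i, Measurable (X i)
  indep : ∀ D E : Finset ι, (∀ i ∈ D, ∀ j ∈ E, m < ρ i j) →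
    Indep (fieldSigma X D) (fieldSigma X E) μ

/-- A local field bounded by `x`. -/
structure BddField (ρ : ι → ι → ℕ) (m : ℕ) (κ x : ℝ) (X : ι → Ω → ℝ) (μ : Measure Ω) : Prop
    extends LocalField ρ m κ X μ where
  bdd : ∀ i ω, |X i ω| ≤ x

lemma ball_mono {ρ : ι → ι → ℕ} (i : ι) {r r' : ℕ} (h : r ≤ r') : ball ρ i r ⊆ ball ρ i r' :=
  fun j hj => by rw [mem_ball] at *; omega

namespace LocalField

variable {ρ : ι → ι → ℕ} {m : ℕ} {κ : ℝ} {X : ι → Ω → ℝ} {μ : Measure Ω}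

lemma mem_ball_self (hF : LocalField ρ m κ X μ) (i : ι) (r : ℕ) : i ∈ ball ρ i r := by
  simp [mem_ball, hF.self i]

lemma lt_dist_of_ball (hF : LocalField ρ m κ X μ) {i j k : ι} {r : ℕ} (hj : j ∈ ball ρ i r)
    (hk : k ∉ ball ρ i (r + m)) : m < ρ j k := by
  rw [mem_ball] at *
  have := hF.tri i j k
  omega

lemma integral_mul_indep (hF : LocalField ρ m κ X μ) {D E : Finset ι}
    (h : ∀ i ∈ D, ∀ j ∈ E, m < ρ i j) {Z Z' : Ω → ℝ} (hZ : Measurable[fieldSigma X D] Z)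
    (hZ' : Measurable[fieldSigma X E] Z') :
    ∫ ω, Z ω * Z' ω ∂μ = (∫ ω, Z ω ∂μ) * ∫ ω, Z' ω ∂μ := by
  have hi : IndepFun Z Z' μ := by
    rw [IndepFun_iff_Indep]
    exact indep_of_indep_of_le_left (indep_of_indep_of_le_right (hF.indep D E h) hZ'.comap_le)
      hZ.comap_le
  exact hi.integral_fun_mul_eq_mul_integral
    (hZ.mono (fieldSigma_le hF.meas D) le_rfl).aestronglyMeasurable
    (hZ'.mono (fieldSigma_le hF.meas E) le_rfl).aestronglyMeasurable

end LocalField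

namespace BddField

variable {ρ : ι → ι → ℕ} {m : ℕ} {κ x : ℝ} {X : ι → Ω → ℝ} {μ : Measure Ω}

lemma bddMeas (hF : BddField ρ m κ x X μ) (i : ι) : BddMeas (X i) := ⟨hF.meas i, x, hF.bdd i⟩

lemma bddMeas_psum (hF : BddField ρ m κ x X μ) (D : Finset ι) : BddMeas (psum X D) :=
  BddMeas.sum fun i _ => hF.bddMeas i

lemma bddMeas_asum (hF : BddField ρ m κ x X μ) (D : Finset ι) : BddMeas (asum X D) :=
  BddMeas.sum fun i _ => (hF.bddMeas i).abs

variable [IsProbabilityMeasure μ] [DecidableEq ι]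

lemma psum_add_compl (D : Finset ι) (ω : Ω) : psum X D ω + psum X Dᶜ ω = psum X univ ω :=
  sum_add_sum_compl D _

/-- Removing the field on `N` from the exponent costs a bounded factor. -/
lemma exp_compl_le {N : Finset ι} {s r : ℝ} {ω : Ω} (hs : |s| * asum X N ω ≤ r) :
    exp (s * psum X univ ω) ≤ exp r * exp (s * psum X Nᶜ ω) ∧
      exp (s * psum X Nᶜ ω) ≤ exp r * exp (s * psum X univ ω) := by
  have h : |s * psum X N ω| ≤ r := by
    rw [abs_mul]
    exact (mul_le_mul_of_nonneg_left (abs_psum_le ω) (abs_nonneg s)).trans hs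
  have h' := abs_le.1 h
  rw [← psum_add_compl N, ← exp_add, ← exp_add, exp_le_exp, exp_le_exp, mul_add]
  constructor <;> linarith

/-- Drop the field on N from the exponent at the cost of exp 2. What remains is independent of Z, so
the integral factorises. Restoring the dropped part costs another exp 2. -/
lemma integral_mul_exp_le (hF : BddField ρ m κ x X μ) {D N : Finset ι}
    (hDN : ∀ i ∈ D, ∀ j ∉ N, m < ρ i j) {s : ℝ} (hs : ∀ ω, |s| * asum X N ω ≤ 2) {Z : Ω → ℝ}
    (hZ : BddMeas Z) (hZm : Measurable[fieldSigma X D] Z) (hZ0 : ∀ ω, 0 ≤ Z ω) :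
    ∫ ω, Z ω * exp (s * psum X univ ω) ∂μ
      ≤ exp 4 * (∫ ω, Z ω ∂μ) * ∫ ω, exp (s * psum X univ ω) ∂μ := by
  have hW := (hF.bddMeas_psum univ).exp_mul s
  have hN := (hF.bddMeas_psum Nᶜ).exp_mul s
  have hm : Measurable[fieldSigma X Nᶜ] fun ω => exp (s * psum X Nᶜ ω) :=
    (show Continuous fun v => exp (s * v) by fun_prop).measurable.comp
      (measurable_psum (Subset.refl _))
  have hind : ∫ ω, Z ω * exp (s * psum X Nᶜ ω) ∂μ
      = (∫ ω, Z ω ∂μ) * ∫ ω, exp (s * psum X Nᶜ ω) ∂μ :=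
    hF.integral_mul_indep (fun i hi j hj => hDN i hi j (by simpa using hj)) hZm hm
  have hZi : 0 ≤ ∫ ω, Z ω ∂μ := integral_nonneg hZ0
  have a1 : ∫ ω, Z ω * exp (s * psum X univ ω) ∂μ
      ≤ exp 2 * ∫ ω, Z ω * exp (s * psum X Nᶜ ω) ∂μ := by
    rw [← integral_const_mul]
    refine integral_mono (hZ.mul hW).integrable ((hZ.mul hN).const_mul _).integrable fun ω => ?_
    have := mul_le_mul_of_nonneg_left (exp_compl_le (hs ω)).1 (hZ0 ω)
    simp only; linarith
  have a2 : ∫ ω, exp (s * psum X Nᶜ ω) ∂μ ≤ exp 2 * ∫ ω, exp (s * psum X univ ω) ∂μ := by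
    rw [← integral_const_mul]
    exact integral_mono hN.integrable (hW.const_mul _).integrable
      fun ω => (exp_compl_le (hs ω)).2
  rw [hind] at a1
  have e4 : exp 4 = exp 2 * exp 2 := by rw [← exp_add]; norm_num
  calc _ ≤ exp 2 * ((∫ ω, Z ω ∂μ) * ∫ ω, exp (s * psum X Nᶜ ω) ∂μ) := a1
    _ ≤ exp 2 * ((∫ ω, Z ω ∂μ) * (exp 2 * ∫ ω, exp (s * psum X univ ω) ∂μ)) := by gcongr
    _ = _ := by rw [e4]; ring

lemma asum_le_card (hF : BddField ρ m κ x X μ) (D : Finset ι) (ω : Ω) :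
    asum X D ω ≤ D.card * x := by
  unfold asum
  refine (sum_le_sum fun i _ => hF.bdd i ω).trans ?_
  simp

/-! ### Decoupling and variance bounds under the weight exp(sW) -/

section Tilt

variable {s : ℝ}

lemma mul_asum_ball_le (hF : BddField ρ m κ x X μ) (hs : |s| * (κ * x) ≤ 1) (i : ι) {r : ℕ}
    (hr : r ≤ 4 * m) (ω : Ω) : |s| * asum X (ball ρ i r) ω ≤ 1 := by
  have hx : 0 ≤ x := (abs_nonneg _).trans (hF.bdd i ω)
  refine le_trans (mul_le_mul_of_nonneg_left ?_ (abs_nonneg s)) hs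
  refine (asum_mono (ball_mono i hr) ω).trans ((hF.asum_le_card _ ω).trans ?_)
  exact mul_le_mul_of_nonneg_right (hF.card i) hx

lemma mul_asum_union_le (hF : BddField ρ m κ x X μ) (hs : |s| * (κ * x) ≤ 1) (i j : ι) {r : ℕ}
    (hr : r ≤ 4 * m) (ω : Ω) : |s| * asum X (ball ρ i r ∪ ball ρ j r) ω ≤ 2 := by
  have h : asum X (ball ρ i r ∪ ball ρ j r) ω
      ≤ asum X (ball ρ i r) ω + asum X (ball ρ j r) ω := by
    unfold asum
    rw [← sum_union_inter]
    exact le_add_of_nonneg_right (sum_nonneg fun _ _ => abs_nonneg _)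
  have h1 := mul_le_mul_of_nonneg_left h (abs_nonneg s)
  linarith [hF.mul_asum_ball_le hs i hr ω, hF.mul_asum_ball_le hs j hr ω]

lemma integral_mul_exp_le_union (hF : BddField ρ m κ x X μ) (hs : |s| * (κ * x) ≤ 1) (i j : ι)
    {r : ℕ} (hr : r + m ≤ 4 * m) {Z : Ω → ℝ} (hZ : BddMeas Z)
    (hZm : Measurable[fieldSigma X (ball ρ i r ∪ ball ρ j r)] Z) (hZ0 : ∀ ω, 0 ≤ Z ω) :
    ∫ ω, Z ω * exp (s * psum X univ ω) ∂μ
      ≤ exp 4 * (∫ ω, Z ω ∂μ) * ∫ ω, exp (s * psum X univ ω) ∂μ := by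
  refine hF.integral_mul_exp_le (N := ball ρ i (r + m) ∪ ball ρ j (r + m)) ?_
    (hF.mul_asum_union_le hs i j hr) hZ hZm hZ0
  intro k hk l hl
  rw [mem_union, not_or] at hl
  rcases mem_union.1 hk with hk | hk
  · exact hF.lt_dist_of_ball hk hl.1
  · exact hF.lt_dist_of_ball hk hl.2

lemma integral_mul_exp_le_ball (hF : BddField ρ m κ x X μ) (hs : |s| * (κ * x) ≤ 1) (i : ι)
    {r : ℕ} (hr : r + m ≤ 4 * m) {Z : Ω → ℝ} (hZ : BddMeas Z)
    (hZm : Measurable[fieldSigma X (ball ρ i r)] Z) (hZ0 : ∀ ω, 0 ≤ Z ω) :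
    ∫ ω, Z ω * exp (s * psum X univ ω) ∂μ
      ≤ exp 4 * (∫ ω, Z ω ∂μ) * ∫ ω, exp (s * psum X univ ω) ∂μ :=
  hF.integral_mul_exp_le_union hs i i hr hZ (by rwa [union_self]) hZ0

/-- Second-order cancellation for two far apart centred local functions. -/
lemma abs_integral_far_le (hF : BddField ρ m κ x X μ) (hs : |s| * (κ * x) ≤ 1) {i j : ι}
    (hij : 4 * m < ρ i j) {Z Z' : Ω → ℝ} (hZ : BddMeas Z) (hZ' : BddMeas Z')
    (hZm : Measurable[fieldSigma X (ball ρ i m)] Z)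
    (hZm' : Measurable[fieldSigma X (ball ρ j m)] Z')
    (hZ0 : ∫ ω, Z ω ∂μ = 0) (hZ0' : ∫ ω, Z' ω ∂μ = 0) :
    |∫ ω, Z ω * Z' ω * exp (s * psum X univ ω) ∂μ| ≤ exp 6 * (4 * s ^ 2) *
      (∫ ω, (|Z ω| * asum X (ball ρ i (2 * m)) ω) * (|Z' ω| * asum X (ball ρ j (2 * m)) ω) ∂μ) *
      ∫ ω, exp (s * psum X univ ω) ∂μ := by
  set Bi := ball ρ i (2 * m) with hBi
  set Bj := ball ρ j (2 * m) with hBj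
  set N := Bi ∪ Bj with hN
  have hmi : ball ρ i m ⊆ Bi := ball_mono i (by omega)
  have hmj : ball ρ j m ⊆ Bj := ball_mono j (by omega)
  -- Distance above 4m makes the two balls of radius 2m disjoint, so each centred function is
  -- independent of the other one together with the other ball.
  have hdisj : Disjoint Bi Bj := by
    rw [disjoint_left]
    intro k hk hk'
    rw [mem_ball] at hk hk'
    have := hF.tri i k j
    rw [hF.symm k j] at this
    omega
  have hWsplit : ∀ ω, psum X univ ω = psum X Bi ω + psum X Bj ω + psum X Nᶜ ω := fun ω => by
    rw [← psum_add_compl N]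
    congr 1
    exact sum_union hdisj
  have hce : Continuous fun v => exp (s * v) := by fun_prop
  have hm : ∀ {D E : Finset ι}, E ⊆ D → Measurable[fieldSigma X D] fun ω => exp (s * psum X E ω) :=
    fun h => hce.measurable.comp (measurable_psum h)
  have hb := fun D => (hF.bddMeas_psum D).exp_mul s
  have hNi : Nᶜ ⊆ Biᶜ := compl_subset_compl.2 subset_union_left
  have hNj : Nᶜ ⊆ Bjᶜ := compl_subset_compl.2 subset_union_right
  have hji : Bj ⊆ Biᶜ := by
    intro k hk; rw [mem_compl]; exact fun h => disjoint_left.1 hdisj h hk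
  have hij' : Bi ⊆ Bjᶜ := by
    intro k hk; rw [mem_compl]; exact fun h => disjoint_left.1 hdisj hk h
  have sepi : ∀ k ∈ ball ρ i m, ∀ l ∈ Biᶜ, m < ρ k l := fun k hk l hl =>
    hF.lt_dist_of_ball hk (by rw [mem_compl, hBi, two_mul] at hl; exact hl)
  have sepj : ∀ k ∈ ball ρ j m, ∀ l ∈ Bjᶜ, m < ρ k l := fun k hk l hl =>
    hF.lt_dist_of_ball hk (by rw [mem_compl, hBj, two_mul] at hl; exact hl)
  have hZi : Measurable[fieldSigma X Bjᶜ] Z :=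
    hZm.mono (fieldSigma_mono (hmi.trans hij')) le_rfl
  have hZj : Measurable[fieldSigma X Biᶜ] Z' :=
    hZm'.mono (fieldSigma_mono (hmj.trans hji)) le_rfl
  have t1 : ∫ ω, Z ω * (Z' ω * (exp (s * psum X Nᶜ ω) * exp (s * psum X Bj ω))) ∂μ = 0 := by
    exact (hF.integral_mul_indep sepi hZm (hZj.mul ((hm hNi).mul (hm hji)))).trans
      (by rw [hZ0, zero_mul])
  have t2 : ∫ ω, Z' ω * (Z ω * (exp (s * psum X Nᶜ ω) * exp (s * psum X Bi ω))) ∂μ = 0 := by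
    exact (hF.integral_mul_indep sepj hZm' (hZi.mul ((hm hNj).mul (hm hij')))).trans
      (by rw [hZ0', zero_mul])
  have t3 : ∫ ω, Z ω * (Z' ω * exp (s * psum X Nᶜ ω)) ∂μ = 0 := by
    exact (hF.integral_mul_indep sepi hZm (hZj.mul (hm hNi))).trans (by rw [hZ0, zero_mul])
  have i1 := hZ.mul (hZ'.mul ((hb Nᶜ).mul (hb Bj)))
  have i2 := hZ'.mul (hZ.mul ((hb Nᶜ).mul (hb Bi)))
  have i3 := hZ.mul (hZ'.mul (hb Nᶜ))
  have i4 := (hZ.mul hZ').mul (hb univ)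
  have hYi := hF.bddMeas_asum Bi
  have hYj := hF.bddMeas_asum Bj
  -- With W split into the sums over the two balls and the rest, the product of the two factors exp
  -- - 1 expands into four terms. In the three that lack at least one of the ball exponentials, Z or
  -- Z' is independent of everything else and centred, so they integrate to zero.
  have key : ∫ ω, Z ω * Z' ω * exp (s * psum X univ ω) ∂μ
      = ∫ ω, Z ω * Z' ω * (exp (s * psum X Bi ω) - 1) * (exp (s * psum X Bj ω) - 1) *
          exp (s * psum X Nᶜ ω) ∂μ := by
    have e : ∀ ω, Z ω * Z' ω * (exp (s * psum X Bi ω) - 1) * (exp (s * psum X Bj ω) - 1) *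
          exp (s * psum X Nᶜ ω) = Z ω * Z' ω * exp (s * psum X univ ω)
        - (Z ω * (Z' ω * (exp (s * psum X Nᶜ ω) * exp (s * psum X Bj ω))))
        - (Z' ω * (Z ω * (exp (s * psum X Nᶜ ω) * exp (s * psum X Bi ω))))
        + (Z ω * (Z' ω * exp (s * psum X Nᶜ ω))) := fun ω => by
      rw [hWsplit, mul_add, mul_add, exp_add, exp_add]; ring
    simp_rw [e]
    rw [integral_add ((i4.sub i1).sub i2).integrable i3.integrable,
      integral_sub (i4.sub i1).integrable i2.integrable, integral_sub i4.integrable i1.integrable,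
      t1, t2, t3]
    ring
  have hG : ∀ k ω, |exp (s * psum X (ball ρ k (2 * m)) ω) - 1|
      ≤ 2 * (|s| * asum X (ball ρ k (2 * m)) ω) := fun k ω => by
    have h1 : |s * psum X (ball ρ k (2 * m)) ω| ≤ |s| * asum X (ball ρ k (2 * m)) ω := by
      rw [abs_mul]; exact mul_le_mul_of_nonneg_left (abs_psum_le ω) (abs_nonneg s)
    exact (abs_exp_sub_one_le (h1.trans (hF.mul_asum_ball_le hs k (by omega) ω))).trans
      (by linarith)
  set P : Ω → ℝ := fun ω => (|Z ω| * asum X Bi ω) * (|Z' ω| * asum X Bj ω) with hP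
  have hPb : BddMeas P := (hZ.abs.mul hYi).mul (hZ'.abs.mul hYj)
  have hP0 : ∀ ω, 0 ≤ P ω := fun ω =>
    mul_nonneg (mul_nonneg (abs_nonneg _) (asum_nonneg ω)) (mul_nonneg (abs_nonneg _) (asum_nonneg ω))
  have hca : Measurable fun v : ℝ => |v| := continuous_abs.measurable
  have hPm : Measurable[fieldSigma X N] P := by
    refine Measurable.mul (Measurable.mul ?_ (measurable_asum subset_union_left))
      (Measurable.mul ?_ (measurable_asum subset_union_right))
    · exact hca.comp (hZm.mono (fieldSigma_mono (hmi.trans subset_union_left)) le_rfl)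
    · exact hca.comp (hZm'.mono (fieldSigma_mono (hmj.trans subset_union_right)) le_rfl)
  rw [key]
  have step : |∫ ω, Z ω * Z' ω * (exp (s * psum X Bi ω) - 1) * (exp (s * psum X Bj ω) - 1) *
          exp (s * psum X Nᶜ ω) ∂μ| ≤
      ∫ ω, exp 2 * (4 * s ^ 2) * (P ω * exp (s * psum X univ ω)) ∂μ := by
    refine abs_integral_le_integral ((hPb.mul (hb univ)).const_mul _).integrable fun ω => ?_
    rw [abs_mul, abs_mul, abs_mul, abs_mul, abs_of_pos (exp_pos _)]
    have g1 := hG i ω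
    have g2 := hG j ω
    have g3 := (exp_compl_le (hF.mul_asum_union_le hs i j (r := 2 * m) (by omega) ω)).2
    calc _ ≤ |Z ω| * |Z' ω| * (2 * (|s| * asum X Bi ω)) * (2 * (|s| * asum X Bj ω)) *
          (exp 2 * exp (s * psum X univ ω)) := by
            have := asum_nonneg (X := X) (D := Bi) ω
            have := asum_nonneg (X := X) (D := Bj) ω
            gcongr
      _ = exp 2 * (4 * (|s| * |s|)) * (P ω * exp (s * psum X univ ω)) := by rw [hP]; ring
      _ = _ := by rw [abs_mul_abs_self, sq]
  rw [integral_const_mul] at step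
  have fin := hF.integral_mul_exp_le_union hs i j (r := 2 * m) (by omega) hPb hPm hP0
  have e6 : exp 6 = exp 2 * exp 4 := by rw [← exp_add]; norm_num
  calc _ ≤ _ := step
    _ ≤ exp 2 * (4 * s ^ 2) * (exp 4 * (∫ ω, P ω ∂μ) * ∫ ω, exp (s * psum X univ ω) ∂μ) := by
        gcongr
    _ = _ := by rw [e6]; ring

/-- Variance bound, under the tilt, for a sum of centred local functions. -/
lemma integral_sq_sum_le (hF : BddField ρ m κ x X μ) (hs : |s| * (κ * x) ≤ 1)
    {Z : ι → Ω → ℝ} (hZ : ∀ i, BddMeas (Z i))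
    (hZm : ∀ i, Measurable[fieldSigma X (ball ρ i m)] (Z i)) (hZ0 : ∀ i, ∫ ω, Z i ω ∂μ = 0)
    {α β : ℝ} (hα : ∀ i, ∫ ω, Z i ω ^ 2 ∂μ ≤ α) (hα0 : 0 ≤ α) (hβ0 : 0 ≤ β)
    (hβ : ∀ i, ∫ ω, (|Z i ω| * asum X (ball ρ i (2 * m)) ω) ^ 2 ∂μ ≤ β) :
    ∫ ω, (∑ i, Z i ω) ^ 2 * exp (s * psum X univ ω) ∂μ ≤
      exp 6 * (κ * Fintype.card ι * α + 4 * s ^ 2 * (Fintype.card ι : ℝ) ^ 2 * β) *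
        ∫ ω, exp (s * psum X univ ω) ∂μ := by
  set ψ := ∫ ω, exp (s * psum X univ ω) ∂μ with hψ
  have hψ0 : 0 ≤ ψ := integral_nonneg fun _ => (exp_pos _).le
  have hb := (hF.bddMeas_psum univ).exp_mul s
  have hexp : ∀ ω, (∑ i, Z i ω) ^ 2 * exp (s * psum X univ ω)
      = ∑ i, ∑ j, Z i ω * Z j ω * exp (s * psum X univ ω) := fun ω => by
    rw [sq, sum_mul_sum, sum_mul]; simp_rw [sum_mul]
  simp_rw [hexp]
  rw [integral_finsetSum _ fun i _ => (BddMeas.sum fun j _ =>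
    ((hZ i).mul (hZ j)).mul hb).integrable]
  simp_rw [fun i => integral_finsetSum (μ := μ) (univ : Finset ι)
    (f := fun j ω => Z i ω * Z j ω * exp (s * psum X univ ω))
    fun j _ => (((hZ i).mul (hZ j)).mul hb).integrable]
  have hprod : ∀ {f g : Ω → ℝ} {γ : ℝ}, BddMeas f → BddMeas g → ∫ ω, f ω ^ 2 ∂μ ≤ γ →
      ∫ ω, g ω ^ 2 ∂μ ≤ γ → ∫ ω, f ω * g ω ∂μ ≤ γ := by
    intro f g γ hf hg h1 h2
    have : ∫ ω, f ω * g ω ∂μ ≤ ∫ ω, (1 / 2) * (f ω ^ 2 + g ω ^ 2) ∂μ :=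
      integral_mono (hf.mul hg).integrable (((hf.pow 2).add (hg.pow 2)).const_mul _).integrable
        fun ω => by simp only; nlinarith [sq_nonneg (f ω - g ω)]
    rw [integral_const_mul, integral_add (hf.pow 2).integrable (hg.pow 2).integrable] at this
    linarith
  -- Near pairs, at most κ for each i, are bounded by decoupling and second moments. All other pairs
  -- enter through the second-order cancellation, which supplies the factor s² that compensates for
  -- the n² pairs.
  have hpair : ∀ i j, ∫ ω, Z i ω * Z j ω * exp (s * psum X univ ω) ∂μ
      ≤ (if j ∈ ball ρ i (4 * m) then exp 6 * α * ψ else 0) + exp 6 * (4 * s ^ 2) * β * ψ := by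
    intro i j
    have hpos : 0 ≤ exp 6 * (4 * s ^ 2) * β * ψ := by positivity
    split_ifs with hij
    · have h1 : ∫ ω, Z i ω * Z j ω * exp (s * psum X univ ω) ∂μ
          ≤ ∫ ω, |Z i ω| * |Z j ω| * exp (s * psum X univ ω) ∂μ := by
        refine integral_mono (((hZ i).mul (hZ j)).mul hb).integrable
          (((hZ i).abs.mul (hZ j).abs).mul hb).integrable fun ω => ?_
        simp only
        rw [← abs_mul]
        exact mul_le_mul_of_nonneg_right (le_abs_self _) (exp_pos _).le
      have hca : Measurable fun v : ℝ => |v| := continuous_abs.measurable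
      have h2 := hF.integral_mul_exp_le_union hs i j (r := m) (by omega)
        ((hZ i).abs.mul (hZ j).abs)
        (Measurable.mul
          (hca.comp ((hZm i).mono (fieldSigma_mono subset_union_left) le_rfl))
          (hca.comp ((hZm j).mono (fieldSigma_mono subset_union_right) le_rfl)))
        (fun ω => mul_nonneg (abs_nonneg _) (abs_nonneg _))
      have h3 : ∫ ω, |Z i ω| * |Z j ω| ∂μ ≤ α :=
        hprod (hZ i).abs (hZ j).abs (by simpa using hα i) (by simpa using hα j)
      have h4 : exp 4 * (∫ ω, |Z i ω| * |Z j ω| ∂μ) * ψ ≤ exp 6 * α * ψ := by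
        gcongr
        norm_num
      linarith
    · rw [mem_ball, not_le] at hij
      have h1 := hF.abs_integral_far_le hs hij (hZ i) (hZ j) (hZm i) (hZm j) (hZ0 i) (hZ0 j)
      have h2 := hprod ((hZ i).abs.mul (hF.bddMeas_asum (ball ρ i (2 * m))))
        ((hZ j).abs.mul (hF.bddMeas_asum (ball ρ j (2 * m)))) (hβ i) (hβ j)
      have h3 : exp 6 * (4 * s ^ 2) * (∫ ω, (|Z i ω| * asum X (ball ρ i (2 * m)) ω) *
          (|Z j ω| * asum X (ball ρ j (2 * m)) ω) ∂μ) * ψ ≤ exp 6 * (4 * s ^ 2) * β * ψ := by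
        gcongr
      linarith [le_abs_self (∫ ω, Z i ω * Z j ω * exp (s * psum X univ ω) ∂μ)]
  refine (sum_le_sum fun i _ => sum_le_sum fun j _ => hpair i j).trans ?_
  have hcard : ∀ i, ∑ j, (if j ∈ ball ρ i (4 * m) then exp 6 * α * ψ else 0)
      ≤ κ * (exp 6 * α * ψ) := fun i => by
    rw [sum_ite_mem, univ_inter, sum_const, nsmul_eq_mul]
    exact mul_le_mul_of_nonneg_right (hF.card i) (by positivity)
  calc _ ≤ ∑ _i : ι, (κ * (exp 6 * α * ψ) + Fintype.card ι * (exp 6 * (4 * s ^ 2) * β * ψ)) := by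
        refine sum_le_sum fun i _ => ?_
        rw [sum_add_distrib]
        refine add_le_add (hcard i) (le_of_eq ?_)
        simp
    _ = _ := by simp; ring

end Tilt
end BddField
end MDepField

namespace MDepField

open Real Finset

set_option linter.unusedSectionVars false

variable {ι Ω : Type*} [MeasurableSpace Ω] [Fintype ι]

/-! ### Moderate fields and their exponential tilts -/

/-- The quantity `n b / a²`. -/
noncomputable def bulk (ι : Type*) [Fintype ι] (a b : ℝ) : ℝ := Fintype.card ι * b / a ^ 2

/-- A bounded locally dependent field with local exponential moments, which can be tilted by
any parameter of modulus at most `1 + t`. -/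
structure ModerateField (ρ : ι → ι → ℕ) (m : ℕ) (κ x a b t : ℝ) (X : ι → Ω → ℝ)
    (μ : Measure Ω) : Prop extends BddField ρ m κ x X μ where
  a_pos : 0 < a
  one_le_b : 1 ≤ b
  one_le_κ : 1 ≤ κ
  t_nonneg : 0 ≤ t
  tilt_le : (1 + t) * (κ * x) ≤ 1
  exp_le : ∀ i, ∫ ω, exp (a * asum X (ball ρ i (2 * m)) ω) ∂μ ≤ b
  half_le_bulk : 1 / 2 ≤ bulk ι a b

/-- The total absolute mean of the field. -/
noncomputable def meanErr (X : ι → Ω → ℝ) (μ : Measure Ω) : ℝ := ∑ i, |∫ ω, X i ω ∂μ|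

/-- The deviation from `1` of the sum of local covariances. -/
noncomputable def varErr (ρ : ι → ι → ℕ) (m : ℕ) (X : ι → Ω → ℝ) (μ : Measure Ω) : ℝ :=
  |∑ i, ∫ ω, X i ω * psum X (ball ρ i m) ω ∂μ - 1|

/-- The total error in the Stein identity for the tilted field. -/
noncomputable def steinErr (ρ : ι → ι → ℕ) (m : ℕ) (κ a b t : ℝ) (X : ι → Ω → ℝ)
    (μ : Measure Ω) : ℝ :=
  meanErr X μ + (1 + t) * varErr ρ m X μ + (1 + t) ^ 2 * (κ * bulk ι a b / a)

/-- The law `exp (s W) dμ / E exp (s W)` for the total sum `W` of the field. -/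
noncomputable def tilt (s : ℝ) (X : ι → Ω → ℝ) (μ : Measure Ω) : Measure Ω :=
  μ.tilted fun ω => s * psum X univ ω

/-- Moment generating function of the total sum. -/
noncomputable def sumMgf (X : ι → Ω → ℝ) (μ : Measure Ω) (s : ℝ) : ℝ :=
  ∫ ω, exp (s * psum X univ ω) ∂μ

lemma integral_tilt (s : ℝ) (X : ι → Ω → ℝ) (μ : Measure Ω) (f : Ω → ℝ) :
    ∫ ω, f ω ∂tilt s X μ = (∫ ω, f ω * exp (s * psum X univ ω) ∂μ) / sumMgf X μ s := by
  rw [tilt, integral_tilted, ← integral_div]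
  congr 1; ext ω
  simp only [smul_eq_mul, sumMgf]; ring

namespace ModerateField

variable {ρ : ι → ι → ℕ} {m : ℕ} {κ x a b t : ℝ} {X : ι → Ω → ℝ} {μ : Measure Ω}
  [IsProbabilityMeasure μ] [DecidableEq ι]

lemma bulk_mul (hF : ModerateField ρ m κ x a b t X μ) (c : ℝ) :
    (Fintype.card ι : ℝ) * (c * (b / a ^ 3)) = c * (bulk ι a b / a) := by
  have := hF.a_pos.ne'
  unfold bulk; field_simp

lemma sumMgf_pos (hF : ModerateField ρ m κ x a b t X μ) (s : ℝ) : 0 < sumMgf X μ s :=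
  integral_exp_pos ((hF.bddMeas_psum univ).exp_mul s).integrable

lemma isProbabilityMeasure_tilt (hF : ModerateField ρ m κ x a b t X μ) (s : ℝ) :
    IsProbabilityMeasure (tilt s X μ) :=
  isProbabilityMeasure_tilted ((hF.bddMeas_psum univ).exp_mul s).integrable

lemma integral_mul_exp (hF : ModerateField ρ m κ x a b t X μ) (s : ℝ) (f : Ω → ℝ) :
    ∫ ω, f ω * exp (s * psum X univ ω) ∂μ = sumMgf X μ s * ∫ ω, f ω ∂tilt s X μ := by
  rw [integral_tilt, mul_div_cancel₀ _ (hF.sumMgf_pos s).ne']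

lemma abs_mul_le (hF : ModerateField ρ m κ x a b t X μ) {s : ℝ} (hs : |s| ≤ 1 + t) :
    |s| * (κ * x) ≤ 1 := by
  by_cases h : 0 ≤ κ * x
  · exact (mul_le_mul_of_nonneg_right hs h).trans hF.tilt_le
  · exact (mul_nonpos_of_nonneg_of_nonpos (abs_nonneg s) (not_le.1 h).le).trans zero_le_one

lemma integral_tilt_ball_le (hF : ModerateField ρ m κ x a b t X μ) {s : ℝ} (hs : |s| ≤ 1 + t)
    (i : ι) {r : ℕ} (hr : r + m ≤ 4 * m) {Z : Ω → ℝ} (hZ : BddMeas Z)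
    (hZm : Measurable[fieldSigma X (ball ρ i r)] Z) (hZ0 : ∀ ω, 0 ≤ Z ω) :
    ∫ ω, Z ω ∂tilt s X μ ≤ 55 * ∫ ω, Z ω ∂μ := by
  rw [integral_tilt, div_le_iff₀ (hF.sumMgf_pos s)]
  refine (hF.integral_mul_exp_le_ball (hF.abs_mul_le hs) i hr hZ hZm hZ0).trans ?_
  have h4 : exp 4 ≤ 55 := by
    have h := exp_one_lt_d9.le
    have e : exp 4 = exp 1 ^ 4 := by rw [← exp_nat_mul]; norm_num
    rw [e]
    calc exp 1 ^ 4 ≤ 2.7182818286 ^ 4 := by gcongr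
      _ ≤ 55 := by norm_num
  have h0 : 0 ≤ ∫ ω, Z ω ∂μ := integral_nonneg hZ0
  have h1 := (hF.sumMgf_pos s).le
  unfold sumMgf at *
  gcongr

lemma integral_asum_pow_le (hF : ModerateField ρ m κ x a b t X μ) (i : ι) (k : ℕ) :
    ∫ ω, asum X (ball ρ i (2 * m)) ω ^ k ∂μ ≤ k.factorial * (b / a ^ k) := by
  have ha := hF.a_pos
  have hb := hF.bddMeas_asum (ball ρ i (2 * m))
  calc _ ≤ ∫ ω, k.factorial / a ^ k * exp (a * asum X (ball ρ i (2 * m)) ω) ∂μ := by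
        refine integral_mono (hb.pow k).integrable ((hb.exp_mul a).const_mul _).integrable
          fun ω => ?_
        have h := pow_div_factorial_le_exp (x := a * asum X (ball ρ i (2 * m)) ω)
          (mul_nonneg ha.le (asum_nonneg ω)) k
        rw [div_le_iff₀ (by positivity), mul_pow] at h
        simp only
        rw [div_mul_eq_mul_div, le_div_iff₀ (by positivity)]
        linarith
    _ = k.factorial / a ^ k * ∫ ω, exp (a * asum X (ball ρ i (2 * m)) ω) ∂μ :=
        integral_const_mul _ _
    _ ≤ k.factorial / a ^ k * b := by
        have := hF.exp_le i
        gcongr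
    _ = _ := by ring

/-- Concentration, under the tilt, of a sum of local functions. -/
lemma integral_abs_sum_sub_le (hF : ModerateField ρ m κ x a b t X μ) {s : ℝ}
    (hs : |s| ≤ 1 + t) {F : ι → Ω → ℝ} (hFb : ∀ i, BddMeas (F i))
    (hFm : ∀ i, Measurable[fieldSigma X (ball ρ i m)] (F i)) {M : ℝ} (hM : 0 < M)
    (hFM : ∀ i ω, F i ω ^ 4 ≤ M ^ 4 * exp (a * asum X (ball ρ i (2 * m)) ω)) :
    ∫ ω, |∑ i, F i ω - ∑ i, ∫ ω', F i ω' ∂μ| ∂tilt s X μ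
      ≤ 200 * M * a * (κ * bulk ι a b * (1 + t)) := by
  have ha := hF.a_pos
  have hb1 := hF.one_le_b
  have hκ := hF.one_le_κ
  have ht := hF.t_nonneg
  have hβ := hF.half_le_bulk
  have := hF.isProbabilityMeasure_tilt s
  set Z : ι → Ω → ℝ := fun i ω => F i ω - ∫ ω', F i ω' ∂μ with hZdef
  have hZ : ∀ i, BddMeas (Z i) := fun i => (hFb i).sub (BddMeas.const _)
  have hZm : ∀ i, Measurable[fieldSigma X (ball ρ i m)] (Z i) := fun i =>
    (hFm i).sub measurable_const
  have hZ0 : ∀ i, ∫ ω, Z i ω ∂μ = 0 := fun i => by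
    rw [hZdef]; simp only
    rw [integral_sub (hFb i).integrable (integrable_const _)]; simp
  have hE : ∀ i, BddMeas fun ω => exp (a * asum X (ball ρ i (2 * m)) ω) := fun i =>
    (hF.bddMeas_asum _).exp_mul a
  have hF4 : ∀ i, ∫ ω, F i ω ^ 4 ∂μ ≤ M ^ 4 * b := fun i => by
    calc _ ≤ ∫ ω, M ^ 4 * exp (a * asum X (ball ρ i (2 * m)) ω) ∂μ :=
          integral_mono ((hFb i).pow 4).integrable ((hE i).const_mul _).integrable (hFM i)
      _ ≤ _ := by
          rw [integral_const_mul]; exact mul_le_mul_of_nonneg_left (hF.exp_le i) (by positivity)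
  have hF2 : ∀ i, ∫ ω, F i ω ^ 2 ∂μ ≤ M ^ 2 * b := fun i => by
    calc _ ≤ ∫ ω, M ^ 2 * exp (a * asum X (ball ρ i (2 * m)) ω) ∂μ := by
          refine integral_mono ((hFb i).pow 2).integrable ((hE i).const_mul _).integrable
            fun ω => ?_
          -- The square root of the fourth-power hypothesis would give the square root of the
          -- exponential; since the exponential is at least 1, it bounds its own root.
          have hy : 1 ≤ exp (a * asum X (ball ρ i (2 * m)) ω) :=
            one_le_exp (mul_nonneg ha.le (asum_nonneg ω))
          have h2 : (F i ω ^ 2) ^ 2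
              ≤ (M ^ 2 * exp (a * asum X (ball ρ i (2 * m)) ω)) ^ 2 := by
            rw [← pow_mul, mul_pow, ← pow_mul]
            refine (hFM i ω).trans (mul_le_mul_of_nonneg_left ?_ (by positivity))
            nlinarith
          exact (abs_le_of_sq_le_sq' h2 (by positivity)).2
      _ ≤ _ := by
          rw [integral_const_mul]; exact mul_le_mul_of_nonneg_left (hF.exp_le i) (by positivity)
  have hα : ∀ i, ∫ ω, Z i ω ^ 2 ∂μ ≤ M ^ 2 * b := fun i => by
    refine le_trans ?_ (hF2 i)
    set c := ∫ ω', F i ω' ∂μ with hc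
    have e : ∀ ω, Z i ω ^ 2 = F i ω ^ 2 - ((2 * c) * F i ω - c ^ 2) := fun ω => by
      simp only [hZdef, ← hc]; ring
    simp_rw [e]
    rw [integral_sub ((hFb i).pow 2).integrable
      (((hFb i).const_mul _).sub (BddMeas.const _)).integrable,
      integral_sub ((hFb i).const_mul _).integrable (integrable_const _), integral_const_mul, ← hc]
    simp
    nlinarith [sq_nonneg c]
  have hZ4 : ∀ i, ∫ ω, Z i ω ^ 4 ∂μ ≤ 16 * (M ^ 4 * b) := fun i => by
    set c := ∫ ω', F i ω' ∂μ with hc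
    have hc4 : c ^ 4 ≤ ∫ ω, F i ω ^ 4 ∂μ := by
      have h1 := sq_integral_le (μ := μ) (hFb i)
      have h2 := sq_integral_le (μ := μ) ((hFb i).pow 2)
      simp_rw [← pow_mul] at h2
      calc c ^ 4 = (c ^ 2) ^ 2 := by ring
        _ ≤ (∫ ω, F i ω ^ 2 ∂μ) ^ 2 := by gcongr
        _ ≤ _ := h2
    calc _ ≤ ∫ ω, (8 * F i ω ^ 4 + 8 * c ^ 4) ∂μ := by
          refine integral_mono ((hZ i).pow 4).integrable
            ((((hFb i).pow 4).const_mul 8).add (BddMeas.const _)).integrable fun ω => ?_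
          simp only [hZdef, ← hc]
          nlinarith [sq_nonneg (F i ω + c), sq_nonneg (F i ω - c), sq_nonneg (F i ω ^ 2 - c ^ 2),
            sq_nonneg (F i ω ^ 2 + c ^ 2 + 2 * F i ω * c),
            mul_nonneg (sq_nonneg (F i ω + c)) (sq_nonneg (F i ω)),
            mul_nonneg (sq_nonneg (F i ω + c)) (sq_nonneg c),
            mul_nonneg (sq_nonneg (F i ω + c)) (sq_nonneg (F i ω - c))]
      _ = 8 * (∫ ω, F i ω ^ 4 ∂μ) + 8 * c ^ 4 := by
          rw [integral_add (((hFb i).pow 4).const_mul 8).integrable (integrable_const _),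
            integral_const_mul]
          simp
      _ ≤ _ := by linarith [hF4 i]
  -- AM-GM with weight M²a², which balances the scale M of Z against the scale 1/a of the local
  -- absolute sum: 16/2 + 24/2 = 20.
  have hβ' : ∀ i, ∫ ω, (|Z i ω| * asum X (ball ρ i (2 * m)) ω) ^ 2 ∂μ
      ≤ 20 * (M ^ 2 * b / a ^ 2) := fun i => by
    have hYb := hF.bddMeas_asum (ball ρ i (2 * m))
    calc _ ≤ ∫ ω, ((1 / (2 * M ^ 2 * a ^ 2)) * Z i ω ^ 4
          + (M ^ 2 * a ^ 2 / 2) * asum X (ball ρ i (2 * m)) ω ^ 4) ∂μ := by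
          refine integral_mono ((((hZ i).abs.mul hYb)).pow 2).integrable
            ((((hZ i).pow 4).const_mul _).add ((hYb.pow 4).const_mul _)).integrable fun ω => ?_
          simp only
          rw [mul_pow, sq_abs]
          generalize Z i ω = z
          generalize asum X (ball ρ i (2 * m)) ω = y
          have hMa : 0 < M ^ 2 * a ^ 2 := by positivity
          have e : (1 / (2 * M ^ 2 * a ^ 2)) * z ^ 4 + (M ^ 2 * a ^ 2 / 2) * y ^ 4 - z ^ 2 * y ^ 2
              = (1 / (2 * (M ^ 2 * a ^ 2))) * (z ^ 2 - M ^ 2 * a ^ 2 * y ^ 2) ^ 2 := by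
            field_simp; ring
          have : 0 ≤ (1 / (2 * (M ^ 2 * a ^ 2))) * (z ^ 2 - M ^ 2 * a ^ 2 * y ^ 2) ^ 2 := by
            positivity
          linarith
      _ = (1 / (2 * M ^ 2 * a ^ 2)) * (∫ ω, Z i ω ^ 4 ∂μ)
          + (M ^ 2 * a ^ 2 / 2) * ∫ ω, asum X (ball ρ i (2 * m)) ω ^ 4 ∂μ := by
          rw [integral_add (((hZ i).pow 4).const_mul _).integrable
            ((hYb.pow 4).const_mul _).integrable, integral_const_mul, integral_const_mul]
      _ ≤ (1 / (2 * M ^ 2 * a ^ 2)) * (16 * (M ^ 4 * b))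
          + (M ^ 2 * a ^ 2 / 2) * (Nat.factorial 4 * (b / a ^ 4)) := by
          have := hZ4 i
          have := hF.integral_asum_pow_le i 4
          gcongr
      _ = _ := by
          rw [show Nat.factorial 4 = 24 from rfl]; push_cast; field_simp; ring
  have hsum := hF.integral_sq_sum_le (hF.abs_mul_le hs) hZ hZm hZ0 hα (by positivity)
    (by positivity) hβ'
  refine integral_abs_le_of_sq ((BddMeas.sum fun i _ => hFb i).sub (BddMeas.const _))
    (by positivity) ?_
  rw [integral_tilt, div_le_iff₀ (hF.sumMgf_pos s)]
  have e1 : ∀ ω, ∑ i, F i ω - ∑ i, ∫ ω', F i ω' ∂μ = ∑ i, Z i ω := fun ω => by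
    rw [← sum_sub_distrib]
  simp_rw [e1]
  refine hsum.trans (mul_le_mul_of_nonneg_right ?_ (hF.sumMgf_pos s).le)
  have h6 : exp 6 ≤ 404 := by
    have h := exp_one_lt_d9.le
    have e : exp 6 = exp 1 ^ 6 := by rw [← exp_nat_mul]; norm_num
    rw [e]
    calc exp 1 ^ 6 ≤ 2.7182818286 ^ 6 := by gcongr
      _ ≤ 404 := by norm_num
  set B := bulk ι a b with hB
  have hn : (Fintype.card ι : ℝ) * b = B * a ^ 2 := by rw [hB]; unfold bulk; field_simp
  have hs2 : s ^ 2 ≤ (1 + t) ^ 2 := by rw [← sq_abs]; gcongr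
  have hcn : (0 : ℝ) ≤ Fintype.card ι := Nat.cast_nonneg _
  -- The near-pair term is only linear in κB; it is dominated by the square because κB ≥ 1/2.
  have g1 : κ * Fintype.card ι * (M ^ 2 * b) ≤ 2 * (M * a * (κ * B * (1 + t))) ^ 2 := by
    have e : κ * Fintype.card ι * (M ^ 2 * b) = (M * a) ^ 2 * (κ * B) := by
      linear_combination κ * M ^ 2 * hn
    have h1 : κ * B ≤ 2 * (κ * B * (1 + t)) ^ 2 := by
      have k1 : 1 / 2 ≤ κ * B := by nlinarith
      have k2 : κ * B ≤ κ * B * (1 + t) := by nlinarith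
      nlinarith
    rw [e]
    calc _ ≤ (M * a) ^ 2 * (2 * (κ * B * (1 + t)) ^ 2) := by gcongr
      _ = _ := by ring
  -- Here b ≤ b² is spent to pair each factor n with a factor b. In the end 404 · 82 ≤ 200².
  have g2 : 4 * s ^ 2 * (Fintype.card ι : ℝ) ^ 2 * (20 * (M ^ 2 * b / a ^ 2))
      ≤ 80 * (M * a * (κ * B * (1 + t))) ^ 2 := by
    calc _ ≤ 4 * (1 + t) ^ 2 * (Fintype.card ι : ℝ) ^ 2 * (20 * (M ^ 2 * (b * b) / a ^ 2)) := by
          gcongr; nlinarith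
      _ = 80 * (1 + t) ^ 2 * M ^ 2 * (Fintype.card ι * b) ^ 2 / a ^ 2 := by ring
      _ = 80 * (M * a * (1 * B * (1 + t))) ^ 2 := by rw [hn]; field_simp
      _ ≤ _ := by gcongr
  calc _ ≤ 404 * (2 * (M * a * (κ * B * (1 + t))) ^ 2 + 80 * (M * a * (κ * B * (1 + t))) ^ 2) := by
        gcongr
    _ ≤ _ := by nlinarith [sq_nonneg (M * a * (κ * B * (1 + t)))]

end ModerateField
end MDepField

/-! ### Approximate Stein identity and the moment generating function -/

namespace MDepField

open Real Finset

set_option linter.unusedSectionVars false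

variable {ι Ω : Type*} [MeasurableSpace Ω] [Fintype ι]

namespace ModerateField

variable {ρ : ι → ι → ℕ} {m : ℕ} {κ x a b t : ℝ} {X : ι → Ω → ℝ} {μ : Measure Ω}
  [IsProbabilityMeasure μ] [DecidableEq ι]

lemma ball_subset_double (i : ι) : ball ρ i m ⊆ ball ρ i (2 * m) :=
  ball_mono i (by omega)

lemma abs_mul_psum_le (hF : ModerateField ρ m κ x a b t X μ) (i : ι) (ω : Ω) :
    |X i ω * psum X (ball ρ i m) ω| ≤ asum X (ball ρ i m) ω ^ 2 := by
  rw [abs_mul, sq]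
  exact mul_le_mul (abs_le_asum (hF.mem_ball_self i m) ω) (abs_psum_le ω) (abs_nonneg _)
    (asum_nonneg ω)

/-- Concentration of the local quadratic form under the tilt. -/
lemma integral_abs_quad_le (hF : ModerateField ρ m κ x a b t X μ) {s : ℝ}
    (hs : |s| ≤ 1 + t) :
    ∫ ω, |∑ i, X i ω * psum X (ball ρ i m) ω - 1| ∂tilt s X μ
      ≤ varErr ρ m X μ + 3000 * ((1 + t) * (κ * bulk ι a b / a)) := by
  have ha := hF.a_pos
  have := hF.isProbabilityMeasure_tilt s
  have hFb : ∀ i, BddMeas fun ω => X i ω * psum X (ball ρ i m) ω := fun i =>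
    (hF.bddMeas i).mul (hF.bddMeas_psum _)
  -- The choice of M works because (a y)⁸ ≤ 8! exp(a y) and 8! = 40320 ≤ 15⁴.
  have h := hF.integral_abs_sum_sub_le hs (F := fun i ω => X i ω * psum X (ball ρ i m) ω)
    (M := 15 / a ^ 2) hFb
    (fun i => (measurable_fieldSigma (hF.mem_ball_self i m)).mul (measurable_psum (Subset.refl _)))
    (by positivity) (fun i ω => by
      set y := asum X (ball ρ i (2 * m)) ω with hy
      have hy0 : 0 ≤ y := asum_nonneg ω
      have h1 : |X i ω * psum X (ball ρ i m) ω| ≤ y ^ 2 :=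
        (hF.abs_mul_psum_le i ω).trans
          (pow_le_pow_left₀ (asum_nonneg ω) (asum_mono (ball_subset_double i) ω) 2)
      have h2 : (X i ω * psum X (ball ρ i m) ω) ^ 4 ≤ (y ^ 2) ^ 4 := by
        rw [← Even.pow_abs (by decide : Even 4)]; gcongr
      have h3 := pow_div_factorial_le_exp (x := a * y) (mul_nonneg ha.le hy0) 8
      rw [show Nat.factorial 8 = 40320 from rfl, div_le_iff₀ (by norm_num)] at h3
      push_cast at h3
      calc _ ≤ (y ^ 2) ^ 4 := h2
        _ = (a * y) ^ 8 / a ^ 8 := by field_simp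
        _ ≤ (50625 * exp (a * y)) / a ^ 8 := by
            gcongr
            nlinarith [exp_pos (a * y)]
        _ = _ := by field_simp; norm_num)
  set c := ∑ i, ∫ ω, X i ω * psum X (ball ρ i m) ω ∂μ with hc
  have hb := (BddMeas.sum (s := univ) fun i _ => hFb i)
  calc _ ≤ ∫ ω, (|∑ i, X i ω * psum X (ball ρ i m) ω - c| + |c - 1|) ∂tilt s X μ := by
        refine integral_mono (hb.sub (BddMeas.const 1)).abs.integrable
          ((hb.sub (BddMeas.const c)).abs.add (BddMeas.const _)).integrable fun ω => ?_
        exact abs_sub_le _ _ _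
    _ = (∫ ω, |∑ i, X i ω * psum X (ball ρ i m) ω - c| ∂tilt s X μ) + |c - 1| := by
        rw [integral_add (hb.sub (BddMeas.const c)).abs.integrable (integrable_const _)]
        simp
    _ ≤ 200 * (15 / a ^ 2) * a * (κ * bulk ι a b * (1 + t)) + |c - 1| := by gcongr
    _ = _ := by
        unfold varErr; rw [← hc]; field_simp; ring

/-- The approximate Stein identity under the tilt. -/
lemma stein_identity (hF : ModerateField ρ m κ x a b t X μ) {s : ℝ} (hs : |s| ≤ 1 + t)
    {g g' : ℝ → ℝ} (hg : Continuous g) (hg' : Continuous g') {M M' : ℝ} (hM : 0 ≤ M)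
    (hM' : 0 ≤ M')
    (hgM : ∀ w, |g w| ≤ M * exp (s * w)) (hgM' : ∀ w, |g' w| ≤ M' * exp (s * w))
    {r : ι → Ω → ℝ} (hr : ∀ i, BddMeas (r i))
    (hgr : ∀ i ω, |g (psum X univ ω) - g (psum X univ ω - psum X (ball ρ i m) ω)
        - psum X (ball ρ i m) ω * g' (psum X univ ω)|
        ≤ asum X (ball ρ i m) ω * (r i ω * exp (s * psum X univ ω))) :
    |∫ ω, psum X univ ω * g (psum X univ ω) ∂μ - ∫ ω, g' (psum X univ ω) ∂μ| ≤
      sumMgf X μ s * (3 * M * meanErr X μ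
        + M' * (varErr ρ m X μ + 3000 * ((1 + t) * (κ * bulk ι a b / a)))
        + ∑ i, ∫ ω, asum X (ball ρ i m) ω ^ 2 * r i ω ∂tilt s X μ) := by
  have hψ := hF.sumMgf_pos s
  have hQ := hF.isProbabilityMeasure_tilt s
  have hW := hF.bddMeas_psum univ
  have hT := fun i => hF.bddMeas_psum (ball ρ i m)
  have hY := fun i => hF.bddMeas_asum (ball ρ i m)
  have hX := hF.bddMeas
  have hgW := hW.comp hg
  have hgW' := hW.comp hg'
  have hgT := fun i => (hW.sub (hT i)).comp hg
  have hex := hW.exp_mul s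
  have hcomp : ∀ i ω, psum X univ ω - psum X (ball ρ i m) ω = psum X (ball ρ i m)ᶜ ω :=
    fun i ω => by rw [← BddField.psum_add_compl (ball ρ i m)]; ring
  have hind : ∀ i, |∫ ω, X i ω * g (psum X univ ω - psum X (ball ρ i m) ω) ∂μ|
      ≤ |∫ ω, X i ω ∂μ| * (3 * M * sumMgf X μ s) := fun i => by
    simp_rw [hcomp i]
    have h1 : ∫ ω, X i ω * g (psum X (ball ρ i m)ᶜ ω) ∂μ
        = (∫ ω, X i ω ∂μ) * ∫ ω, g (psum X (ball ρ i m)ᶜ ω) ∂μ := by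
      refine hF.integral_mul_indep (D := {i}) (E := (ball ρ i m)ᶜ) ?_
        (measurable_fieldSigma (mem_singleton_self i))
        (hg.measurable.comp (measurable_psum (Subset.refl _)))
      intro k hk j hj
      rw [mem_singleton] at hk
      rw [mem_compl, mem_ball] at hj
      rw [hk]; omega
    rw [h1, abs_mul]
    refine mul_le_mul_of_nonneg_left ?_ (abs_nonneg _)
    unfold sumMgf
    rw [← integral_const_mul]
    refine abs_integral_le_integral (hex.const_mul _).integrable fun ω => ?_
    refine (hgM _).trans ?_
    have h2 := (BddField.exp_compl_le (hF.mul_asum_ball_le (hF.abs_mul_le hs) i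
      (r := m) (by omega) ω)).2
    have h3 : exp 1 ≤ 3 := by linarith [exp_one_lt_d9]
    calc _ ≤ M * (exp 1 * exp (s * psum X univ ω)) := by gcongr
      _ ≤ M * (3 * exp (s * psum X univ ω)) := by gcongr
      _ = _ := by ring
  set rem : ι → Ω → ℝ := fun i ω => g (psum X univ ω) - g (psum X univ ω - psum X (ball ρ i m) ω)
        - psum X (ball ρ i m) ω * g' (psum X univ ω) with hrem
  have hremb : ∀ i, BddMeas (rem i) := fun i => (hgW.sub (hgT i)).sub ((hT i).mul hgW')
  -- With T_i the sum over the m-ball of i, write g(W) = g(W - T_i) + T_i g'(W) + remainder. The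
  -- first piece is independent of X_i and leaves only its mean, the second produces the local
  -- quadratic form minus 1, and the third is handled by the hypothesis on the remainder.
  have hdec : ∫ ω, psum X univ ω * g (psum X univ ω) ∂μ - ∫ ω, g' (psum X univ ω) ∂μ
      = (∑ i, ∫ ω, X i ω * g (psum X univ ω - psum X (ball ρ i m) ω) ∂μ)
        + (∫ ω, (∑ i, X i ω * psum X (ball ρ i m) ω - 1) * g' (psum X univ ω) ∂μ)
        + ∑ i, ∫ ω, X i ω * rem i ω ∂μ := by
    rw [← integral_finsetSum _ fun i _ => ((hX i).mul (hgT i)).integrable,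
      ← integral_finsetSum _ fun i _ => ((hX i).mul (hremb i)).integrable,
      ← integral_sub (hW.mul hgW).integrable hgW'.integrable]
    have b1 := BddMeas.sum (s := univ) fun i _ => (hX i).mul (hgT i)
    have b2 := ((BddMeas.sum (s := univ) fun i _ => (hX i).mul (hT i)).sub
      (BddMeas.const 1)).mul hgW'
    have b3 := BddMeas.sum (s := univ) fun i _ => (hX i).mul (hremb i)
    rw [← integral_add b1.integrable b2.integrable, ← integral_add (b1.add b2).integrable
      b3.integrable]
    congr 1; ext ω
    have e1 : psum X univ ω * g (psum X univ ω) = ∑ i, X i ω * g (psum X univ ω) := by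
      rw [← sum_mul]; rfl
    rw [e1, sub_mul, sum_mul, one_mul]
    have e2 : ∀ A B C D : ι → ℝ, (∀ i, A i = B i + C i + D i) →
        ∀ c : ℝ, ∑ i, A i - c = ∑ i, B i + (∑ i, C i - c) + ∑ i, D i := fun A B C D h c => by
      simp_rw [h, sum_add_distrib]; ring
    refine e2 _ _ _ _ (fun i => ?_) _
    rw [hrem]; ring
  have hA : |∑ i, ∫ ω, X i ω * g (psum X univ ω - psum X (ball ρ i m) ω) ∂μ|
      ≤ sumMgf X μ s * (3 * M * meanErr X μ) := by
    refine (abs_sum_le_sum_abs _ _).trans ((sum_le_sum fun i _ => hind i).trans (le_of_eq ?_))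
    rw [← sum_mul]; unfold meanErr; ring
  have hB : |∫ ω, (∑ i, X i ω * psum X (ball ρ i m) ω - 1) * g' (psum X univ ω) ∂μ|
      ≤ sumMgf X μ s * (M' * (varErr ρ m X μ + 3000 * ((1 + t) * (κ * bulk ι a b / a)))) := by
    have hVb : BddMeas fun ω => |∑ i, X i ω * psum X (ball ρ i m) ω - 1| :=
      ((BddMeas.sum (s := univ) fun i _ => (hX i).mul (hT i)).sub (BddMeas.const 1)).abs
    calc _ ≤ ∫ ω, M' * (|∑ i, X i ω * psum X (ball ρ i m) ω - 1|
            * exp (s * psum X univ ω)) ∂μ := by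
          refine abs_integral_le_integral ((hVb.mul hex).const_mul _).integrable fun ω => ?_
          rw [abs_mul]
          refine (mul_le_mul_of_nonneg_left (hgM' _) (abs_nonneg _)).trans (le_of_eq (by ring))
      _ = sumMgf X μ s * (M' * ∫ ω, |∑ i, X i ω * psum X (ball ρ i m) ω - 1| ∂tilt s X μ) := by
          rw [integral_const_mul, hF.integral_mul_exp]; ring
      _ ≤ _ := by
          have := hF.integral_abs_quad_le hs
          gcongr
  have hC : |∑ i, ∫ ω, X i ω * rem i ω ∂μ|
      ≤ sumMgf X μ s * ∑ i, ∫ ω, asum X (ball ρ i m) ω ^ 2 * r i ω ∂tilt s X μ := by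
    rw [mul_sum]
    refine (abs_sum_le_sum_abs _ _).trans (sum_le_sum fun i _ => ?_)
    rw [← hF.integral_mul_exp]
    refine abs_integral_le_integral ((((hY i).pow 2).mul (hr i)).mul hex).integrable fun ω => ?_
    rw [abs_mul]
    calc _ ≤ asum X (ball ρ i m) ω *
          (asum X (ball ρ i m) ω * (r i ω * exp (s * psum X univ ω))) :=
          mul_le_mul (abs_le_asum (hF.mem_ball_self i m) ω) (hgr i ω) (abs_nonneg _)
            (asum_nonneg ω)
      _ = _ := by ring
  rw [hdec]
  refine (abs_add_le _ _).trans ((add_le_add ((abs_add_le _ _).trans (add_le_add hA hB)) hC).trans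
    (le_of_eq (by ring)))

lemma integral_tilt_asum_pow_le (hF : ModerateField ρ m κ x a b t X μ) {s : ℝ}
    (hs : |s| ≤ 1 + t) (i : ι) (k : ℕ) :
    ∫ ω, asum X (ball ρ i m) ω ^ k ∂tilt s X μ ≤ 55 * (k.factorial * (b / a ^ k)) := by
  have hY := fun r => hF.bddMeas_asum (ball ρ i r)
  refine (hF.integral_tilt_ball_le hs i (r := m) (by omega) ((hY m).pow k)
    ((measurable_asum (Subset.refl _)).pow_const k) fun ω => pow_nonneg (asum_nonneg ω) k).trans ?_
  refine mul_le_mul_of_nonneg_left (le_trans ?_ (hF.integral_asum_pow_le i k)) (by norm_num)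
  exact integral_mono ((hY m).pow k).integrable ((hY (2 * m)).pow k).integrable fun ω =>
    pow_le_pow_left₀ (asum_nonneg ω) (asum_mono (ball_subset_double i) ω) k

lemma errors_nonneg (hF : ModerateField ρ m κ x a b t X μ) :
    0 ≤ meanErr X μ ∧ 0 ≤ varErr ρ m X μ ∧ 0 ≤ bulk ι a b / a
      ∧ bulk ι a b / a ≤ κ * bulk ι a b / a := by
  have ha := hF.a_pos
  have hB : 0 ≤ bulk ι a b := by linarith [hF.half_le_bulk]
  refine ⟨sum_nonneg fun _ _ => abs_nonneg _, abs_nonneg _, by positivity, ?_⟩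
  gcongr
  nlinarith [hF.one_le_κ]

/-- The Stein identity with g(w) = exp(sw) is a differential inequality for the logarithm of the
moment generating function; its Taylor remainder is (sT)², bounded since |s| times the local sum is
at most 1. -/
lemma abs_mgf_deriv_le (hF : ModerateField ρ m κ x a b t X μ) {s : ℝ} (hs : |s| ≤ 1 + t) :
    |∫ ω, psum X univ ω * exp (s * psum X univ ω) ∂μ - s * sumMgf X μ s|
      ≤ sumMgf X μ s * (3400 * steinErr ρ m κ a b t X μ) := by
  have ht := hF.t_nonneg
  obtain ⟨e1, e2, e3, e4⟩ := hF.errors_nonneg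
  have hY := fun i => hF.bddMeas_asum (ball ρ i m)
  have h := hF.stein_identity hs (g := fun w => exp (s * w)) (g' := fun w => s * exp (s * w))
    (by fun_prop) (by fun_prop) (M := 1) (M' := 1 + t) zero_le_one (by linarith)
    (fun w => by rw [abs_of_pos (exp_pos _), one_mul])
    (fun w => by
      rw [abs_mul, abs_of_pos (exp_pos _)]
      exact mul_le_mul_of_nonneg_right hs (exp_pos _).le)
    (r := fun i ω => (1 + t) ^ 2 * asum X (ball ρ i m) ω) (fun i => (hY i).const_mul _)
    (fun i ω => by
      set w := psum X univ ω
      set T := psum X (ball ρ i m) ω with hT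
      set y := asum X (ball ρ i m) ω with hy
      have hy0 : 0 ≤ y := asum_nonneg ω
      have hTy : |T| ≤ y := abs_psum_le ω
      have hsy : |s| * y ≤ 1 := hF.mul_asum_ball_le (hF.abs_mul_le hs) i (by omega) ω
      have hsT : |-(s * T)| ≤ |s| * y := by
        rw [abs_neg, abs_mul]; exact mul_le_mul_of_nonneg_left hTy (abs_nonneg s)
      have k1 := abs_exp_sub_one_sub_id_le (hsT.trans hsy)
      have e : exp (s * w) - exp (s * (w - T)) - T * (s * exp (s * w))
          = -(exp (s * w) * (exp (-(s * T)) - 1 - -(s * T))) := by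
        rw [show s * (w - T) = s * w + -(s * T) by ring, exp_add]; ring
      rw [e, abs_neg, abs_mul, abs_of_pos (exp_pos _)]
      have k2 : (-(s * T)) ^ 2 ≤ (1 + t) ^ 2 * y ^ 2 := by
        rw [← sq_abs, ← mul_pow]
        exact pow_le_pow_left₀ (abs_nonneg _)
          (hsT.trans (mul_le_mul_of_nonneg_right hs hy0)) 2
      calc _ ≤ exp (s * w) * ((1 + t) ^ 2 * y ^ 2) :=
            mul_le_mul_of_nonneg_left (k1.trans k2) (exp_pos _).le
        _ = _ := by ring)
  rw [integral_const_mul] at h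
  refine h.trans (mul_le_mul_of_nonneg_left ?_ (hF.sumMgf_pos s).le)
  have hsum : ∑ i, ∫ ω, asum X (ball ρ i m) ω ^ 2 * ((1 + t) ^ 2 * asum X (ball ρ i m) ω)
      ∂tilt s X μ ≤ (1 + t) ^ 2 * (330 * (bulk ι a b / a)) := by
    calc _ ≤ ∑ _i : ι, (1 + t) ^ 2 * (330 * (b / a ^ 3)) := by
          refine sum_le_sum fun i _ => ?_
          have e : ∀ ω, asum X (ball ρ i m) ω ^ 2 * ((1 + t) ^ 2 * asum X (ball ρ i m) ω)
              = (1 + t) ^ 2 * asum X (ball ρ i m) ω ^ 3 := fun ω => by ring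
          simp_rw [e]
          rw [integral_const_mul]
          refine mul_le_mul_of_nonneg_left ((hF.integral_tilt_asum_pow_le hs i 3).trans
            (le_of_eq ?_)) (by positivity)
          rw [show Nat.factorial 3 = 6 from rfl]; push_cast; ring
      _ = _ := by
          rw [sum_const, nsmul_eq_mul, card_univ, ← hF.bulk_mul]; ring
  unfold steinErr
  have k1 : (1 + t) ^ 2 * (330 * (bulk ι a b / a)) ≤ (1 + t) ^ 2 * (330 * (κ * bulk ι a b / a)) := by
    gcongr
  have k2 : 0 ≤ (1 + t) * varErr ρ m X μ := by positivity
  have k3 : 0 ≤ (1 + t) ^ 2 * (κ * bulk ι a b / a) := mul_nonneg (by positivity) (e3.trans e4)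
  linarith

lemma hasDerivAt_log_sumMgf (hF : ModerateField ρ m κ x a b t X μ) (s : ℝ) :
    HasDerivAt (fun s => log (sumMgf X μ s))
      ((∫ ω, psum X univ ω * exp (s * psum X univ ω) ∂μ) / sumMgf X μ s) s := by
  have hset : s ∈ interior (integrableExpSet (psum X univ) μ) := by
    have : integrableExpSet (psum X univ) μ = Set.univ :=
      Set.eq_univ_of_forall fun s => ((hF.bddMeas_psum univ).exp_mul s).integrable
    rw [this, interior_univ]; trivial
  exact (hasDerivAt_mgf hset).log (hF.sumMgf_pos s).ne'

/-- The moment generating function of the sum is close to the Gaussian one. -/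
lemma abs_log_sumMgf_sub_le (hF : ModerateField ρ m κ x a b t X μ) {s : ℝ} (hs : |s| ≤ 1 + t) :
    |log (sumMgf X μ s) - s ^ 2 / 2| ≤ 3400 * steinErr ρ m κ a b t X μ * |s| := by
  have hd : ∀ u : ℝ, HasDerivAt (fun s => log (sumMgf X μ s) - s ^ 2 / 2)
      ((∫ ω, psum X univ ω * exp (u * psum X univ ω) ∂μ) / sumMgf X μ u - u) u := fun u => by
    have h2 : HasDerivAt (fun v : ℝ => v ^ 2 / 2) u u := by
      simpa using (hasDerivAt_pow 2 u).div_const 2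
    exact (hF.hasDerivAt_log_sumMgf u).sub h2
  have hbound : ∀ u ∈ Set.Icc (-(1 + t)) (1 + t),
      ‖(∫ ω, psum X univ ω * exp (u * psum X univ ω) ∂μ) / sumMgf X μ u - u‖
        ≤ 3400 * steinErr ρ m κ a b t X μ := fun u hu => by
    have hp := hF.sumMgf_pos u
    have h := hF.abs_mgf_deriv_le (abs_le.2 hu)
    rw [norm_eq_abs]
    have e : (∫ ω, psum X univ ω * exp (u * psum X univ ω) ∂μ) / sumMgf X μ u - u
        = (∫ ω, psum X univ ω * exp (u * psum X univ ω) ∂μ - u * sumMgf X μ u) / sumMgf X μ u := by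
      rw [sub_div, mul_div_cancel_right₀ _ hp.ne']
    rw [e, abs_div, abs_of_pos hp, div_le_iff₀ hp]
    linarith
  have h0 : (0 : ℝ) ∈ Set.Icc (-(1 + t)) (1 + t) := by
    have := hF.t_nonneg
    constructor <;> linarith
  have := (convex_Icc (-(1 + t)) (1 + t)).norm_image_sub_le_of_norm_hasDerivWithin_le
    (fun u _ => (hd u).hasDerivWithinAt) hbound h0 (abs_le.1 hs)
  simpa [sumMgf] using this

end ModerateField
end MDepField

/-! ### Taylor remainder of the tilted Stein solution, and the tilted second moment -/

namespace MDepField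

open Real Finset

set_option linter.unusedSectionVars false

variable {ι Ω : Type*} [MeasurableSpace Ω] [Fintype ι]

/-- Taylor remainder for `w ↦ f (w - t) exp (t w)` with `f` a Stein solution for a ramp. -/
lemma abs_tilted_steinSol_taylor_le {y ε t : ℝ} (hε : 0 < ε) (ht : 0 ≤ t) {w T Y : ℝ}
    (hTY : |T| ≤ Y) (htY : t * Y ≤ 1) :
    |steinSol (ramp y ε) (w - t) * exp (t * w)
        - steinSol (ramp y ε) (w - T - t) * exp (t * (w - T))
        - T * (((w - t) * steinSol (ramp y ε) (w - t)
            + (ramp y ε (w - t) - ∫ v, ramp y ε v ∂stdGaussian)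
            + t * steinSol (ramp y ε) (w - t)) * exp (t * w))|
      ≤ Y * ((Y * (4 * (1 + t) ^ 2 + 2 * |w - t|)
          + Y / ε * (2 * (1 + Y / ε) ^ 2) * bump y ε (w - t)) * exp (t * w)) := by
  set h := ramp y ε with hh
  have hc : Continuous h := continuous_ramp y ε
  have h0 : ∀ v, 0 ≤ h v := ramp_nonneg y ε
  have h1 : ∀ v, h v ≤ 1 := ramp_le_one y ε
  set c := ∫ v, h v ∂stdGaussian with hcdef
  set f := steinSol h with hf
  set f' : ℝ → ℝ := fun v => v * f v + (h v - c) with hf'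
  set D : ℝ → ℝ := fun v => f' (v - t) + t * f (v - t) with hD
  have hY : 0 ≤ Y := (abs_nonneg T).trans hTY
  have hg : ∀ v, HasDerivAt (fun v => f (v - t) * exp (t * v)) (D v * exp (t * v)) v := fun v => by
    have a1 : HasDerivAt (fun v => f (v - t)) (f' (v - t)) v :=
      (hasDerivAt_steinSol hc h0 h1 (v - t)).comp_sub_const v t
    have a2 : HasDerivAt (fun v => exp (t * v)) (exp (t * v) * t) v := by
      simpa using ((hasDerivAt_id v).const_mul t).exp
    exact (a1.mul a2).congr_deriv (by rw [hD]; ring)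
  set R := Y * (4 * (1 + t) ^ 2 + 2 * |w - t|)
          + Y / ε * (2 * (1 + Y / ε) ^ 2) * bump y ε (w - t) with hR
  have hDb : ∀ v, |D v| ≤ 2 * (1 + t) := fun v => by
    have a1 : |f' (v - t)| ≤ 2 := abs_steinSol_deriv_le hc h0 h1 (v - t)
    have a2 : |t * f (v - t)| ≤ t * 2 := by
      rw [abs_mul, abs_of_nonneg ht]
      exact mul_le_mul_of_nonneg_left (abs_steinSol_le_two hc h0 h1 _) ht
    exact (abs_add_le _ _).trans (by linarith)
  have hDd : ∀ v, |v - w| ≤ Y → |D v * exp (t * v) - D w * exp (t * w)| ≤ R * exp (t * w) := by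
    intro v hv
    have a1 : |f' (v - t) - f' (w - t)| ≤ (2 + 2 * |w - t|) * |v - w| + |h (v - t) - h (w - t)| := by
      have := abs_steinSol_deriv_sub_le hc h0 h1 (v - t) (w - t)
      rwa [sub_sub_sub_cancel_right] at this
    have a2 : |f (v - t) - f (w - t)| ≤ 2 * |v - w| := by
      have := abs_steinSol_sub_le hc h0 h1 (v - t) (w - t)
      rwa [sub_sub_sub_cancel_right] at this
    have a3 : |h (v - t) - h (w - t)| ≤ Y / ε * (2 * (1 + Y / ε) ^ 2) * bump y ε (w - t) := by
      have := abs_ramp_sub_le_bump (y := y) hε (v - t) (w - t)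
      rw [sub_sub_sub_cancel_right] at this
      refine this.trans ?_
      have := (bump_pos y ε (w - t)).le
      gcongr
    have htv : |t * (v - w)| ≤ t * Y := by
      rw [abs_mul, abs_of_nonneg ht]; exact mul_le_mul_of_nonneg_left hv ht
    have a4 : |exp (t * (v - w)) - 1| ≤ 2 * (t * Y) :=
      (abs_exp_sub_one_le (htv.trans htY)).trans (by linarith)
    -- Three sources of variation are separated: the exponential weight, the derivative of the Stein
    -- solution, and the Stein solution itself.
    have e : D v * exp (t * v) - D w * exp (t * w)
        = ((exp (t * (v - w)) - 1) * D v + ((f' (v - t) - f' (w - t))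
          + t * (f (v - t) - f (w - t)))) * exp (t * w) := by
      have : exp (t * v) = exp (t * (v - w)) * exp (t * w) := by
        rw [← exp_add]; congr 1; ring
      rw [this, hD]; ring
    rw [e, abs_mul, abs_of_pos (exp_pos _)]
    refine mul_le_mul_of_nonneg_right ?_ (exp_pos _).le
    have b1 : |(exp (t * (v - w)) - 1) * D v| ≤ 2 * (t * Y) * (2 * (1 + t)) := by
      rw [abs_mul]
      exact mul_le_mul a4 (hDb v) (abs_nonneg _) (by positivity)
    have b2 : |t * (f (v - t) - f (w - t))| ≤ t * (2 * Y) := by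
      rw [abs_mul, abs_of_nonneg ht]
      exact mul_le_mul_of_nonneg_left (a2.trans (by linarith)) ht
    have b3 : (2 + 2 * |w - t|) * |v - w| ≤ (2 + 2 * |w - t|) * Y :=
      mul_le_mul_of_nonneg_left hv (by positivity)
    calc _ ≤ _ := (abs_add_le _ _).trans (add_le_add b1 ((abs_add_le _ _).trans
          (add_le_add (a1.trans (add_le_add b3 a3)) b2)))
      _ ≤ R := by
          rw [hR]
          have : 0 ≤ Y * t := mul_nonneg hY ht
          nlinarith
  -- The mean value inequality is applied after subtracting the linear part at w, so only the
  -- oscillation of the derivative on the interval enters.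
  have hmv := (convex_Icc (w - Y) (w + Y)).norm_image_sub_le_of_norm_hasDerivWithin_le
    (f := fun v => f (v - t) * exp (t * v) - v * (D w * exp (t * w)))
    (f' := fun v => D v * exp (t * v) - D w * exp (t * w)) (C := R * exp (t * w))
    (fun v _ => ((hg v).sub
      (by simpa using (hasDerivAt_id v).mul_const (D w * exp (t * w)))).hasDerivWithinAt)
    (fun v hv => hDd v (abs_le.2 ⟨by linarith [hv.1], by linarith [hv.2]⟩))
    (x := w - T) (y := w)
    ⟨by linarith [(abs_le.1 hTY).2], by linarith [(abs_le.1 hTY).1]⟩ ⟨by linarith, by linarith⟩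
  simp only [norm_eq_abs] at hmv
  have hR0 : 0 ≤ R := by
    have := (bump_pos y ε (w - t)).le
    rw [hR]; positivity
  calc _ = |f (w - t) * exp (t * w) - w * (D w * exp (t * w))
        - (f (w - T - t) * exp (t * (w - T)) - (w - T) * (D w * exp (t * w)))| := by
        congr 1; rw [hD]; ring
    _ ≤ R * exp (t * w) * |w - (w - T)| := hmv
    _ ≤ R * exp (t * w) * Y := by
        rw [sub_sub_cancel]
        exact mul_le_mul_of_nonneg_left hTY (mul_nonneg hR0 (exp_pos _).le)
    _ = _ := by ring

namespace ModerateField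

variable {ρ : ι → ι → ℕ} {m : ℕ} {κ x a b t : ℝ} {X : ι → Ω → ℝ} {μ : Measure Ω}
  [IsProbabilityMeasure μ] [DecidableEq ι]

/-- The second moment of the tilted, recentred sum is bounded. -/
lemma integral_tilt_sq_le (hF : ModerateField ρ m κ x a b t X μ)
    (hE : 3400 * ((1 + t) * steinErr ρ m κ a b t X μ) ≤ 1) :
    ∫ ω, (psum X univ ω - t) ^ 2 ∂tilt t X μ ≤ 50 := by
  have ht := hF.t_nonneg
  have hQ := hF.isProbabilityMeasure_tilt t
  have hW := hF.bddMeas_psum univ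
  have hp := hF.sumMgf_pos
  have hl : ∀ s, |s| ≤ 1 + t → |log (sumMgf X μ s) - s ^ 2 / 2| ≤ 1 := fun s hs => by
    have hE0 : 0 ≤ steinErr ρ m κ a b t X μ := by
      obtain ⟨e1, e2, e3, e4⟩ := hF.errors_nonneg
      have := e3.trans e4
      unfold steinErr; positivity
    refine (hF.abs_log_sumMgf_sub_le hs).trans (le_trans ?_ hE)
    calc _ ≤ 3400 * steinErr ρ m κ a b t X μ * (1 + t) := by gcongr
      _ = _ := by ring
  -- Exponential moments of W - t under the tilt by t are ratios of moment generating functions at t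
  -- + d and t. Taking d = ±1 is the reason for admitting tilts up to 1 + t.
  have hshift : ∀ d : ℝ,
      ∫ ω, exp (d * (psum X univ ω - t)) ∂tilt t X μ = sumMgf X μ (t + d) * exp (-(d * t))
        / sumMgf X μ t := fun d => by
    rw [integral_tilt]
    congr 1
    unfold sumMgf
    rw [← integral_mul_const]
    congr 1; ext ω
    rw [← exp_add, ← exp_add]; congr 1; ring
  have hb : ∀ d : ℝ, d ^ 2 = 1 →
      ∫ ω, exp (d * (psum X univ ω - t)) ∂tilt t X μ ≤ 25 / 2 := fun d hd => by
    have hd1 : |d| ≤ 1 := by rw [← sq_le_one_iff_abs_le_one]; exact hd.le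
    have hd2 := abs_le.1 hd1
    rw [hshift d]
    have k1 := abs_le.1 (hl (t + d) (abs_le.2 ⟨by linarith, by linarith⟩))
    have k2 := abs_le.1 (hl t (by rw [abs_of_nonneg ht]; linarith))
    rw [← exp_log (hp (t + d)), ← exp_log (hp t), ← exp_add, ← exp_sub]
    -- The Gaussian exponent contributes d²/2 = 1/2, and each of the two logarithms an error of at
    -- most 1.
    calc _ ≤ exp (5 / 2) := by
          rw [exp_le_exp]; nlinarith [k1.2, k2.1]
      _ ≤ 25 / 2 := by
          have h1 := exp_one_lt_d9.le
          have e : exp (5 / 2) ^ 2 = exp 1 ^ 5 := by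
            rw [← exp_nat_mul, ← exp_nat_mul]; norm_num
          have h2 : exp (5 / 2) ^ 2 ≤ (25 / 2) ^ 2 := by
            rw [e]
            calc exp 1 ^ 5 ≤ 2.7182818286 ^ 5 := by gcongr
              _ ≤ _ := by norm_num
          exact (abs_le_of_sq_le_sq' h2 (by norm_num)).2
  have i1 := ((hW.sub (BddMeas.const t)).exp_mul 1)
  have i2 := ((hW.sub (BddMeas.const t)).exp_mul (-1))
  calc _ ≤ ∫ ω, 2 * (exp (1 * (psum X univ ω - t)) + exp (-1 * (psum X univ ω - t)))
        ∂tilt t X μ := by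
        refine integral_mono ((hW.sub (BddMeas.const t)).pow 2).integrable
          ((i1.add i2).const_mul 2).integrable fun ω => ?_
        simp only [one_mul, neg_mul]
        generalize psum X univ ω - t = v
        have k := quadratic_le_exp_of_nonneg (abs_nonneg v)
        have k2 : exp |v| + exp (-|v|) = exp v + exp (-v) := by
          rcases abs_choice v with h | h <;> rw [h]
          rw [neg_neg, add_comm]
        have k3 := add_one_le_exp (-|v|)
        rw [sq_abs] at k
        linarith
    _ ≤ _ := by
        rw [integral_const_mul, integral_add i1.integrable i2.integrable]
        linarith [hb 1 (by norm_num), hb (-1) (by norm_num)]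

end ModerateField
end MDepField

/-! ### Berry–Esseen bound under the tilt, and tails of bounded fields -/

namespace MDepField

open Real Finset

set_option linter.unusedSectionVars false

variable {ι Ω : Type*} [MeasurableSpace Ω] [Fintype ι]

namespace ModerateField

variable {ρ : ι → ι → ℕ} {m : ℕ} {κ x a b t : ℝ} {X : ι → Ω → ℝ} {μ : Measure Ω}
  [IsProbabilityMeasure μ] [DecidableEq ι]

/-- The law of the recentred sum under the tilt. -/
noncomputable def tiltLaw (t : ℝ) (X : ι → Ω → ℝ) (μ : Measure Ω) : Measure ℝ :=
  (tilt t X μ).map fun ω => psum X univ ω - t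

lemma measurable_centred (hF : ModerateField ρ m κ x a b t X μ) :
    Measurable fun ω => psum X univ ω - t := (hF.bddMeas_psum univ).1.sub_const t

lemma isProbabilityMeasure_tiltLaw (hF : ModerateField ρ m κ x a b t X μ) :
    IsProbabilityMeasure (tiltLaw t X μ) :=
  have := hF.isProbabilityMeasure_tilt t
  Measure.isProbabilityMeasure_map hF.measurable_centred.aemeasurable

lemma integral_tiltLaw (hF : ModerateField ρ m κ x a b t X μ) {f : ℝ → ℝ} (hf : Measurable f) :
    ∫ v, f v ∂tiltLaw t X μ = ∫ ω, f (psum X univ ω - t) ∂tilt t X μ :=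
  integral_map hF.measurable_centred.aemeasurable hf.aestronglyMeasurable

/-- The cubic local remainders with a polynomial weight at scale `ε`, against a bump. -/
lemma sum_integral_bump_le (hF : ModerateField ρ m κ x a b t X μ) {y ε : ℝ}
    (hε : ε = 480000 * (bulk ι a b / a)) :
    ∑ i, ∫ ω, asum X (ball ρ i m) ω ^ 2 * (asum X (ball ρ i m) ω / ε
        * (2 * (1 + asum X (ball ρ i m) ω / ε) ^ 2) * bump y ε (psum X univ ω - t)) ∂tilt t X μ
      ≤ 1 / 4 * (∫ v, bump y ε v ∂tiltLaw t X μ) + 100 * ((1 + t) * (κ * bulk ι a b / a)) := by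
  have ha := hF.a_pos
  have hb1 := hF.one_le_b
  have ht := hF.t_nonneg
  have hκ := hF.one_le_κ
  have hβ := hF.half_le_bulk
  have hQ := hF.isProbabilityMeasure_tilt t
  have hν := hF.isProbabilityMeasure_tiltLaw
  set B := bulk ι a b with hB
  have hB0 : 0 < B := by linarith
  have hε0 : 0 < ε := by rw [hε]; positivity
  -- Since B ≥ 1/2, the smoothing scale is no finer than 1/a, so local sums measured in units of ε
  -- are controlled by the exponential moment at a.
  have hεa : ε⁻¹ ≤ a := by
    rw [inv_le_comm₀ hε0 ha, hε, inv_eq_one_div, ← mul_div_assoc]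
    gcongr; linarith
  have hts : |t| ≤ 1 + t := by rw [abs_of_nonneg ht]; linarith
  have hY := fun r i => hF.bddMeas_asum (ball ρ i r)
  set F : ι → Ω → ℝ := fun i ω => asum X (ball ρ i m) ω ^ 3 *
    (1 + asum X (ball ρ i m) ω / ε) ^ 2 with hFdef
  have hφ : Continuous fun v : ℝ => v ^ 3 * (1 + v / ε) ^ 2 := by fun_prop
  have hFb : ∀ i, BddMeas (F i) := fun i => (hY m i).comp hφ
  have hFm : ∀ i, Measurable[fieldSigma X (ball ρ i m)] (F i) := fun i =>
    hφ.measurable.comp (measurable_asum (Subset.refl _))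
  have hF0 : ∀ i ω, 0 ≤ F i ω := fun i ω => by
    have := asum_nonneg (X := X) (D := ball ρ i m) ω
    simp only [hFdef]; positivity
  have hF4 : ∀ i ω, F i ω ^ 4 ≤ (60000 / a ^ 3) ^ 4 * exp (a * asum X (ball ρ i (2 * m)) ω) := by
    intro i ω
    set u := asum X (ball ρ i m) ω with hu
    set v := asum X (ball ρ i (2 * m)) ω with hv
    have hu0 : 0 ≤ u := asum_nonneg ω
    have huv : u ≤ v := asum_mono (ball_subset_double i) ω
    have hv0 : 0 ≤ v := hu0.trans huv
    have h1 : F i ω ≤ (1 + a * v) ^ 5 / a ^ 3 := by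
      have k1 : u / ε ≤ a * v := by
        rw [div_eq_mul_inv, mul_comm]
        gcongr
      calc F i ω = u ^ 3 * (1 + u / ε) ^ 2 := rfl
        _ ≤ v ^ 3 * (1 + a * v) ^ 2 := by gcongr
        _ = (a * v) ^ 3 * (1 + a * v) ^ 2 / a ^ 3 := by field_simp
        _ ≤ (1 + a * v) ^ 3 * (1 + a * v) ^ 2 / a ^ 3 := by
            gcongr; linarith
        _ = _ := by ring
    have hav : 0 ≤ a * v := mul_nonneg ha.le hv0
    -- The constant 60000 is chosen so that 20! · e ≤ 60000⁴.
    have h2 := pow_div_factorial_le_exp (x := 1 + a * v) (by linarith) 20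
    rw [show Nat.factorial 20 = 2432902008176640000 from rfl, div_le_iff₀ (by norm_num),
      exp_add] at h2
    push_cast at h2
    have h3 := exp_one_lt_d9
    have h4 := exp_pos (a * v)
    calc F i ω ^ 4 ≤ ((1 + a * v) ^ 5 / a ^ 3) ^ 4 := pow_le_pow_left₀ (hF0 i ω) h1 4
      _ = (1 + a * v) ^ 20 / (a ^ 3) ^ 4 := by rw [div_pow, ← pow_mul]
      _ ≤ (60000 ^ 4 * exp (a * v)) / (a ^ 3) ^ 4 := by
          gcongr
          nlinarith
      _ = _ := by rw [div_pow, div_mul_eq_mul_div]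
  -- The bump depends on the whole sum and cannot be decoupled term by term. Instead the sum of the
  -- local factors is replaced by the constant r, with an L¹ error under the tilt that the bound
  -- bump ≤ 1 carries over.
  have hconc := hF.integral_abs_sum_sub_le hts hFb hFm (by positivity) hF4
  set r := ∑ i, ∫ ω, F i ω ∂μ with hr
  have hrle : r ≤ 60000 * (B / a) := by
    calc r ≤ ∑ _i : ι, 60000 * (b / a ^ 3) := by
          refine sum_le_sum fun i _ => ?_
          have hE := (hY (2 * m) i).exp_mul a
          calc _ ≤ ∫ ω, 60000 / a ^ 3 * exp (a * asum X (ball ρ i (2 * m)) ω) ∂μ := by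
                refine integral_mono (hFb i).integrable (hE.const_mul _).integrable fun ω => ?_
                have h1 : 1 ≤ exp (a * asum X (ball ρ i (2 * m)) ω) :=
                  one_le_exp (mul_nonneg ha.le (asum_nonneg ω))
                refine le_of_pow_le_pow_left₀ (n := 4) (by norm_num) (by positivity) ?_
                refine (hF4 i ω).trans ?_
                rw [mul_pow]
                exact mul_le_mul_of_nonneg_left (le_self_pow₀ h1 (by norm_num)) (by positivity)
            _ ≤ 60000 / a ^ 3 * b := by
                rw [integral_const_mul]
                exact mul_le_mul_of_nonneg_left (hF.exp_le i) (by positivity)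
            _ = _ := by ring
      _ = _ := by rw [sum_const, nsmul_eq_mul, card_univ, hF.bulk_mul]
  have hbump : BddMeas fun ω => bump y ε (psum X univ ω - t) :=
    ((hF.bddMeas_psum univ).sub (BddMeas.const t)).comp (continuous_bump y ε)
  have hb0 := fun ω => (bump_pos y ε (psum X univ ω - t)).le
  have hb1' := fun ω => bump_le_one y ε (psum X univ ω - t)
  have hsumb := BddMeas.sum (s := univ) fun i _ => hFb i
  have hI : ∫ ω, (∑ i, F i ω) * bump y ε (psum X univ ω - t) ∂tilt t X μ
      ≤ r * (∫ v, bump y ε v ∂tiltLaw t X μ)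
        + 200 * (60000 / a ^ 3) * a * (κ * B * (1 + t)) := by
    rw [hF.integral_tiltLaw (continuous_bump y ε).measurable]
    calc _ ≤ ∫ ω, (r * bump y ε (psum X univ ω - t) + |∑ i, F i ω - r|) ∂tilt t X μ := by
          refine integral_mono (hsumb.mul hbump).integrable
            ((hbump.const_mul r).add (hsumb.sub (BddMeas.const r)).abs).integrable fun ω => ?_
          simp only
          have k1 : (∑ i, F i ω - r) * bump y ε (psum X univ ω - t)
              ≤ |∑ i, F i ω - r| * 1 :=
            mul_le_mul (le_abs_self _) (hb1' ω) (hb0 ω) (abs_nonneg _)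
          linarith
      _ ≤ _ := by
          rw [integral_add (hbump.const_mul r).integrable
            (hsumb.sub (BddMeas.const r)).abs.integrable, integral_const_mul]
          exact add_le_add_right hconc _
  have hbν : 0 ≤ ∫ v, bump y ε v ∂tiltLaw t X μ := integral_nonneg fun v => (bump_pos y ε v).le
  calc _ = 2 / ε * ∫ ω, (∑ i, F i ω) * bump y ε (psum X univ ω - t) ∂tilt t X μ := by
        rw [← integral_const_mul, ← integral_finsetSum]
        · congr 1; ext ω
          rw [sum_mul, mul_sum]
          refine sum_congr rfl fun i _ => ?_
          simp only [hFdef]; ring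
        · intro i _
          have hφ2 : Continuous fun v : ℝ => v / ε * (2 * (1 + v / ε) ^ 2) := by fun_prop
          exact (((hY m i).pow 2).mul (((hY m i).comp hφ2).mul hbump)).integrable
    _ ≤ 2 / ε * (60000 * (B / a) * (∫ v, bump y ε v ∂tiltLaw t X μ)
        + 200 * (60000 / a ^ 3) * a * (κ * B * (1 + t))) := by
        refine mul_le_mul_of_nonneg_left (hI.trans ?_) (by positivity)
        gcongr
    -- This fixes ε: 2/ε times 60000 B/a must be the coefficient 1/4 that can later be absorbed.
    _ = 1 / 4 * (∫ v, bump y ε v ∂tiltLaw t X μ) + 50 * ((1 + t) * (κ / a)) := by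
        rw [hε]; field_simp; ring
    _ ≤ _ := by
        have : κ / a ≤ 2 * (κ * B / a) := by
          rw [← mul_div_assoc]; gcongr; nlinarith
        have h2 : (1 + t) * (κ / a) ≤ (1 + t) * (2 * (κ * B / a)) := by gcongr
        linarith

/-- Berry–Esseen bound for the recentred sum under the tilt. -/
lemma kolmogorov_tiltLaw_le (hF : ModerateField ρ m κ x a b t X μ)
    (hE : 3400 * ((1 + t) * steinErr ρ m κ a b t X μ) ≤ 1) (y : ℝ) :
    |(tiltLaw t X μ).real (Set.Iic y) - stdGaussian.real (Set.Iic y)|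
      ≤ 2600000 * steinErr ρ m κ a b t X μ := by
  have ha := hF.a_pos
  have hb1 := hF.one_le_b
  have ht := hF.t_nonneg
  have hβ := hF.half_le_bulk
  have hQ := hF.isProbabilityMeasure_tilt t
  have hν := hF.isProbabilityMeasure_tiltLaw
  have hψ := hF.sumMgf_pos t
  obtain ⟨e1, e2, e3, e4⟩ := hF.errors_nonneg
  set B := bulk ι a b with hB
  have hB0 : 0 < B := by linarith
  set ε := 480000 * (B / a) with hε
  have hε0 : 0 < ε := by rw [hε]; positivity
  have hts : |t| ≤ 1 + t := by rw [abs_of_nonneg ht]; linarith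
  have hW := hF.bddMeas_psum univ
  have hY := fun i => hF.bddMeas_asum (ball ρ i m)
  have hWt := hW.sub (BddMeas.const t)
  have hsq := hF.integral_tilt_sq_le hE
  have hsmooth : ∀ y, |∫ w, ramp y ε w ∂tiltLaw t X μ - ∫ w, ramp y ε w ∂stdGaussian|
      ≤ 50000 * steinErr ρ m κ a b t X μ + 1 / 4 * ∫ w, bump y ε w ∂tiltLaw t X μ := by
    intro y
    set h := ramp y ε with hh
    have hc : Continuous h := continuous_ramp y ε
    have h0 : ∀ v, 0 ≤ h v := ramp_nonneg y ε
    have h1 : ∀ v, h v ≤ 1 := ramp_le_one y ε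
    set c := ∫ v, h v ∂stdGaussian with hcdef
    set f := steinSol h with hf
    have hfc : Continuous f := continuous_steinSol hc h0 h1
    have hbump : BddMeas fun ω => bump y ε (psum X univ ω - t) := hWt.comp (continuous_bump y ε)
    have hφ2 : Continuous fun v : ℝ => v / ε * (2 * (1 + v / ε) ^ 2) := by fun_prop
    -- For this g, with g' including the derivative of the exponential, w g - g' = -(h(w-t) - c)
    -- exp(tw): the term t f recentres the Stein equation at t.
    have hs := hF.stein_identity hts (g := fun w => f (w - t) * exp (t * w))
      (g' := fun w => ((w - t) * f (w - t) + (h (w - t) - c) + t * f (w - t)) * exp (t * w))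
      (by fun_prop) (by fun_prop) (M := 2) (M' := 2 * (1 + t)) (by norm_num) (by positivity)
      (fun w => by
        rw [abs_mul, abs_of_pos (exp_pos _)]
        exact mul_le_mul_of_nonneg_right (abs_steinSol_le_two hc h0 h1 _) (exp_pos _).le)
      (fun w => by
        rw [abs_mul, abs_of_pos (exp_pos _)]
        refine mul_le_mul_of_nonneg_right ((abs_add_le _ _).trans ?_) (exp_pos _).le
        have k1 := abs_steinSol_deriv_le hc h0 h1 (w - t)
        have k2 := mul_le_mul_of_nonneg_left (abs_steinSol_le_two hc h0 h1 (w - t)) ht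
        rw [abs_mul, abs_of_nonneg ht]
        linarith)
      (r := fun i ω => asum X (ball ρ i m) ω * (4 * (1 + t) ^ 2 + 2 * |psum X univ ω - t|)
        + asum X (ball ρ i m) ω / ε * (2 * (1 + asum X (ball ρ i m) ω / ε) ^ 2)
          * bump y ε (psum X univ ω - t))
      (fun i => ((hY i).mul ((BddMeas.const _).add (hWt.abs.const_mul 2))).add
        (((hY i).comp hφ2).mul hbump))
      (fun i ω => abs_tilted_steinSol_taylor_le hε0 ht (abs_psum_le ω) (by
        have := hF.mul_asum_ball_le (hF.abs_mul_le hts) i (r := m) (by omega) ω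
        rwa [abs_of_nonneg ht] at this))
    have hlhs : ∫ ω, psum X univ ω * (f (psum X univ ω - t) * exp (t * psum X univ ω)) ∂μ
        - ∫ ω, ((psum X univ ω - t) * f (psum X univ ω - t) + (h (psum X univ ω - t) - c)
          + t * f (psum X univ ω - t)) * exp (t * psum X univ ω) ∂μ
        = -(sumMgf X μ t * (∫ w, h w ∂tiltLaw t X μ - c)) := by
      have b1 := hW.mul ((hWt.comp hfc).mul (hW.exp_mul t))
      have b2 := (((hWt.mul (hWt.comp hfc)).add ((hWt.comp hc).sub (BddMeas.const c))).add
        ((hWt.comp hfc).const_mul t)).mul (hW.exp_mul t)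
      rw [← integral_sub b1.integrable b2.integrable, hF.integral_tiltLaw hc.measurable]
      have e : ∫ ω, h (psum X univ ω - t) ∂tilt t X μ - c
          = ∫ ω, (h (psum X univ ω - t) - c) ∂tilt t X μ := by
        rw [integral_sub (hWt.comp hc).integrable (integrable_const _)]; simp
      rw [e, ← hF.integral_mul_exp, ← integral_neg]
      congr 1; ext ω; ring
    rw [hlhs, abs_neg, abs_mul, abs_of_pos hψ] at hs
    have hs' := le_of_mul_le_mul_left hs hψ
    refine hs'.trans ?_
    -- The factor |W - t| is not local. AM-GM, 2u³v ≤ a³u⁶ + v²/a³, separates it, and its second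
    -- moment under the tilt is at most 50.
    have hpoly : ∀ i, ∫ ω, asum X (ball ρ i m) ω ^ 2 *
        (asum X (ball ρ i m) ω * (4 * (1 + t) ^ 2 + 2 * |psum X univ ω - t|)) ∂tilt t X μ
        ≤ (1 + t) ^ 2 * (41000 * (b / a ^ 3)) := fun i => by
      have b3 := hF.integral_tilt_asum_pow_le hts i 3
      have b6 := hF.integral_tilt_asum_pow_le hts i 6
      rw [show Nat.factorial 3 = 6 from rfl] at b3
      rw [show Nat.factorial 6 = 720 from rfl] at b6
      push_cast at b3 b6
      calc _ ≤ ∫ ω, (4 * (1 + t) ^ 2 * asum X (ball ρ i m) ω ^ 3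
            + (a ^ 3 * asum X (ball ρ i m) ω ^ 6 + 1 / a ^ 3 * (psum X univ ω - t) ^ 2))
              ∂tilt t X μ := by
            refine integral_mono (((hY i).pow 2).mul ((hY i).mul ((BddMeas.const _).add
              (hWt.abs.const_mul 2)))).integrable ((((hY i).pow 3).const_mul _).add
              ((((hY i).pow 6).const_mul _).add ((hWt.pow 2).const_mul _))).integrable
              fun ω => ?_
            simp only
            rw [← sq_abs (psum X univ ω - t)]
            generalize asum X (ball ρ i m) ω = u
            generalize |psum X univ ω - t| = v
            have k : 0 ≤ 1 / a ^ 3 * (a ^ 3 * u ^ 3 - v) ^ 2 := by positivity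
            have k2 : 1 / a ^ 3 * (a ^ 3 * u ^ 3 - v) ^ 2
                = a ^ 3 * u ^ 6 + 1 / a ^ 3 * v ^ 2 - 2 * u ^ 3 * v := by
              field_simp; ring
            linarith
        _ = 4 * (1 + t) ^ 2 * (∫ ω, asum X (ball ρ i m) ω ^ 3 ∂tilt t X μ)
            + (a ^ 3 * (∫ ω, asum X (ball ρ i m) ω ^ 6 ∂tilt t X μ)
              + 1 / a ^ 3 * ∫ ω, (psum X univ ω - t) ^ 2 ∂tilt t X μ) := by
            rw [integral_add (((hY i).pow 3).const_mul _).integrable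
              ((((hY i).pow 6).const_mul _).add ((hWt.pow 2).const_mul _)).integrable,
              integral_add (((hY i).pow 6).const_mul _).integrable
              ((hWt.pow 2).const_mul _).integrable, integral_const_mul, integral_const_mul,
              integral_const_mul]
        _ ≤ 4 * (1 + t) ^ 2 * (55 * (6 * (b / a ^ 3)))
            + (a ^ 3 * (55 * (720 * (b / a ^ 6))) + 1 / a ^ 3 * 50) := by gcongr
        _ = (1 + t) ^ 2 * (1320 * (b / a ^ 3)) + (39600 * (b / a ^ 3) + 50 * (1 / a ^ 3)) := by
            field_simp; ring
        _ ≤ _ := by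
            have k1 : 1 / a ^ 3 ≤ b / a ^ 3 := by gcongr
            have k2 : 0 ≤ b / a ^ 3 := by positivity
            have k3 : 1 ≤ (1 + t) ^ 2 := by nlinarith
            nlinarith
    have hsum := hF.sum_integral_bump_le (y := y) hε
    have hrem : ∑ i, ∫ ω, asum X (ball ρ i m) ω ^ 2 *
        (asum X (ball ρ i m) ω * (4 * (1 + t) ^ 2 + 2 * |psum X univ ω - t|)
          + asum X (ball ρ i m) ω / ε * (2 * (1 + asum X (ball ρ i m) ω / ε) ^ 2)
          * bump y ε (psum X univ ω - t)) ∂tilt t X μ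
        ≤ (1 + t) ^ 2 * (41000 * (B / a)) + (1 / 4 * (∫ v, bump y ε v ∂tiltLaw t X μ)
          + 100 * ((1 + t) * (κ * B / a))) := by
      simp_rw [mul_add (asum X _ _ ^ 2)]
      rw [sum_congr rfl fun i _ => integral_add
        (((hY i).pow 2).mul ((hY i).mul ((BddMeas.const _).add (hWt.abs.const_mul 2)))).integrable
        (((hY i).pow 2).mul (((hY i).comp hφ2).mul hbump)).integrable, sum_add_distrib]
      refine add_le_add ((sum_le_sum fun i _ => hpoly i).trans (le_of_eq ?_)) hsum
      rw [sum_const, nsmul_eq_mul, card_univ, ← hF.bulk_mul]; ring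
    have k1 : (1 + t) ^ 2 * (41000 * (B / a)) ≤ (1 + t) ^ 2 * (41000 * (κ * B / a)) := by
      gcongr
    have k0 : 0 ≤ κ * B / a := e3.trans e4
    have k2 : (1 + t) * (κ * B / a) ≤ (1 + t) ^ 2 * (κ * B / a) :=
      mul_le_mul_of_nonneg_right (by nlinarith) k0
    have k3 : 0 ≤ (1 + t) * varErr ρ m X μ := by positivity
    have k4 : 0 ≤ (1 + t) ^ 2 * (κ * B / a) := by positivity
    have k5 : steinErr ρ m κ a b t X μ = meanErr X μ + (1 + t) * varErr ρ m X μ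
        + (1 + t) ^ 2 * (κ * B / a) := rfl
    rw [k5]
    have k6 : 2 * (1 + t) * (varErr ρ m X μ + 3000 * ((1 + t) * (κ * B / a)))
        = 2 * ((1 + t) * varErr ρ m X μ) + 6000 * ((1 + t) ^ 2 * (κ * B / a)) := by ring
    linarith
  -- Twice 50000 plus five times 480000 is 2.5 million, using that B/a is at most the Stein error.
  have hfin := kolmogorov_of_ramp hε0 hsmooth y
  have k0 : 0 ≤ κ * B / a := e3.trans e4
  have k1 : B / a ≤ (1 + t) ^ 2 * (κ * B / a) :=
    e4.trans (le_mul_of_one_le_left k0 (one_le_pow₀ (by linarith)))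
  have k2 : B / a ≤ steinErr ρ m κ a b t X μ := by
    have : 0 ≤ (1 + t) * varErr ρ m X μ := by positivity
    have k5 : steinErr ρ m κ a b t X μ = meanErr X μ + (1 + t) * varErr ρ m X μ
        + (1 + t) ^ 2 * (κ * B / a) := rfl
    linarith
  linarith

/-- Moderate deviations for a bounded moderate field. -/
lemma abs_tail_ratio_sub_one_le (hF : ModerateField ρ m κ x a b t X μ)
    (hE : 3400 * ((1 + t) * steinErr ρ m κ a b t X μ) ≤ 1) :
    |μ.real {ω | t < psum X univ ω} / (1 - stdNormalCDF t) - 1|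
      ≤ 300000000 * ((1 + t) * steinErr ρ m κ a b t X μ) := by
  have ht := hF.t_nonneg
  have hQ := hF.isProbabilityMeasure_tilt t
  have hν := hF.isProbabilityMeasure_tiltLaw
  have hψ := hF.sumMgf_pos t
  have hW := hF.bddMeas_psum univ
  set E := steinErr ρ m κ a b t X μ with hEdef
  have hE0 : 0 ≤ E := by
    obtain ⟨e1, e2, e3, e4⟩ := hF.errors_nonneg
    have := e3.trans e4
    rw [hEdef]; unfold steinErr; positivity
  have hcmp := setIntegral_exp_sub_le ht (hF.kolmogorov_tiltLaw_le hE)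
  rw [setIntegral_exp_stdGaussian] at hcmp
  set q := (√(2 * π))⁻¹ * mills t with hq
  set I := ∫ v in Set.Ioi 0, exp (-t * v) ∂tiltLaw t X μ with hI
  have hq0 : 1 / (15 * (1 + t)) ≤ q := one_div_le_mills ht
  have hqpos : 0 < q := lt_of_lt_of_le (by positivity) hq0
  have hP : μ.real {ω | t < psum X univ ω} = sumMgf X μ t * exp (-t ^ 2) * I := by
    have hms : MeasurableSet {ω | t < psum X univ ω} := measurableSet_lt measurable_const hW.1
    have hm1 : Measurable ((Set.Ioi (0 : ℝ)).indicator fun v => exp (-t * v)) :=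
      Measurable.indicator (by fun_prop) measurableSet_Ioi
    rw [hI, ← integral_indicator measurableSet_Ioi, hF.integral_tiltLaw hm1, mul_right_comm,
      ← hF.integral_mul_exp, ← integral_mul_const, ← integral_indicator_one hms]
    congr 1; ext ω
    by_cases h : t < psum X univ ω
    · rw [Set.indicator_of_mem (by exact h), Set.indicator_of_mem (by simpa using h),
        ← exp_add, ← exp_add, Pi.one_apply]
      rw [eq_comm, exp_eq_one_iff]; ring
    · rw [Set.indicator_of_notMem (by exact h), Set.indicator_of_notMem (by simpa using h)]
      simp
  have hlog := hF.abs_log_sumMgf_sub_le (s := t) (by rw [abs_of_nonneg ht]; linarith)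
  set l := log (sumMgf X μ t) - t ^ 2 / 2 with hl
  have hl1 : |l| ≤ 3400 * ((1 + t) * E) := by
    refine hlog.trans ?_
    rw [abs_of_nonneg ht]
    nlinarith
  have hexpl := abs_exp_sub_one_le (hl1.trans hE)
  have hel : exp l ≤ 3 := by
    have := (abs_le.1 (hl1.trans hE)).2
    calc exp l ≤ exp 1 := exp_le_exp.2 this
      _ ≤ 3 := by linarith [exp_one_lt_d9]
  -- The ratio equals exp(l) I/q, so the error splits into that of the moment generating function
  -- and that of the law on the positive half-line.
  have hratio : μ.real {ω | t < psum X univ ω} / (1 - stdNormalCDF t) - 1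
      = (exp l - 1) + exp l * ((I - q) / q) := by
    rw [hP, one_sub_stdNormalCDF, ← hq]
    have e : sumMgf X μ t * exp (-t ^ 2) = exp l * exp (-t ^ 2 / 2) := by
      nth_rw 1 [← exp_log hψ]
      rw [← exp_add, ← exp_add, hl]; congr 1; ring
    rw [e]
    have := (exp_pos (-t ^ 2 / 2)).ne'
    field_simp
    ring
  have hIq : |(I - q) / q| ≤ 15 * (1 + t) * (2 * (2600000 * E)) := by
    rw [abs_div, abs_of_pos hqpos, div_le_iff₀ hqpos]
    refine hcmp.trans ?_
    have : 1 ≤ 15 * (1 + t) * q := by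
      rw [div_le_iff₀ (by positivity)] at hq0; linarith
    nlinarith
  rw [hratio]
  refine (abs_add_le _ _).trans ?_
  rw [abs_mul, abs_of_pos (exp_pos _)]
  have h1 : exp l * |(I - q) / q| ≤ 3 * (15 * (1 + t) * (2 * (2600000 * E))) :=
    mul_le_mul hel hIq (abs_nonneg _) (by norm_num)
  have h2 : 0 ≤ (1 + t) * E := by positivity
  linarith

end ModerateField
end MDepField

namespace MDepField

open Real Finset

set_option linter.unusedSectionVars false

variable {ι Ω : Type*} [MeasurableSpace Ω] [Fintype ι]

/-! ### Truncation -/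

/-- The field with the values exceeding `x` in modulus replaced by `0`. -/
noncomputable def trunc (x : ℝ) (X : ι → Ω → ℝ) (i : ι) (ω : Ω) : ℝ :=
  if |X i ω| ≤ x then X i ω else 0

lemma abs_trunc_le_self (x : ℝ) (X : ι → Ω → ℝ) (i : ι) (ω : Ω) : |trunc x X i ω| ≤ |X i ω| := by
  unfold trunc; split_ifs <;> simp

lemma abs_trunc_le {x : ℝ} (hx : 0 ≤ x) (X : ι → Ω → ℝ) (i : ι) (ω : Ω) :
    |trunc x X i ω| ≤ x := by
  unfold trunc
  split_ifs with h
  · exact h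
  · simpa using hx

lemma trunc_eq {x : ℝ} {X : ι → Ω → ℝ} {i : ι} {ω : Ω} (h : |X i ω| ≤ x) :
    trunc x X i ω = X i ω := if_pos h

lemma asum_trunc_le (x : ℝ) (X : ι → Ω → ℝ) (D : Finset ι) (ω : Ω) :
    asum (trunc x X) D ω ≤ asum X D ω := sum_le_sum fun i _ => abs_trunc_le_self x X i ω

namespace LocalField

variable {ρ : ι → ι → ℕ} {m : ℕ} {κ x : ℝ} {X : ι → Ω → ℝ} {μ : Measure Ω}

/-- Truncation acts on each coordinate separately, so the σ-algebras only shrink and the dependence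
structure persists. No recentring is done; the resulting means are carried as an error. -/
lemma bddField_trunc (hF : LocalField ρ m κ X μ) (hx : 0 ≤ x) :
    BddField ρ m κ x (trunc x X) μ := by
  have hφ : Measurable fun v : ℝ => if |v| ≤ x then v else 0 :=
    Measurable.ite (measurableSet_le continuous_abs.measurable measurable_const) measurable_id
      measurable_const
  have hle : ∀ D : Finset ι, fieldSigma (trunc x X) D ≤ fieldSigma X D := fun D =>
    iSup₂_le fun i hi => (hφ.comp (measurable_fieldSigma hi)).comap_le
  exact
    { self := hF.self
      symm := hF.symm
      tri := hF.tri
      card := hF.card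
      meas := fun i => hφ.comp (hF.meas i)
      indep := fun D E h => indep_of_indep_of_le_left
        (indep_of_indep_of_le_right (hF.indep D E h) (hle E)) (hle D)
      bdd := abs_trunc_le hx X }

end LocalField

/-- A centred local field with normalised sum and local exponential moments. -/
structure NormField (ρ : ι → ι → ℕ) (m : ℕ) (κ a b : ℝ) (X : ι → Ω → ℝ) (μ : Measure Ω) :
    Prop extends LocalField ρ m κ X μ where
  a_pos : 0 < a
  one_le_b : 1 ≤ b
  one_le_κ : 1 ≤ κ
  integrable_exp : ∀ i, Integrable (fun ω => exp (a * asum X (ball ρ i (2 * m)) ω)) μ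
  exp_le : ∀ i, ∫ ω, exp (a * asum X (ball ρ i (2 * m)) ω) ∂μ ≤ b
  mean : ∀ i, ∫ ω, X i ω ∂μ = 0
  var : variance (psum X univ) μ = 1

namespace NormField

variable {ρ : ι → ι → ℕ} {m : ℕ} {κ a b x : ℝ} {X : ι → Ω → ℝ} {μ : Measure Ω}
  [IsProbabilityMeasure μ] [DecidableEq ι]

lemma measurable_psum' (hF : NormField ρ m κ a b X μ) (D : Finset ι) : Measurable (psum X D) :=
  Finset.measurable_fun_sum D fun i _ => hF.meas i

/-- Integrability and a bound for functions dominated by the local exponential. -/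
lemma integrable_of_le_exp (hF : NormField ρ m κ a b X μ) (i : ι) {f : Ω → ℝ}
    (hf : Measurable f) {c : ℝ} (hc : 0 ≤ c)
    (h : ∀ ω, |f ω| ≤ c * exp (a * asum X (ball ρ i (2 * m)) ω)) :
    Integrable f μ ∧ |∫ ω, f ω ∂μ| ≤ c * b := by
  refine ⟨((hF.integrable_exp i).const_mul c).mono' hf.aestronglyMeasurable (ae_of_all _ h), ?_⟩
  refine (abs_integral_le_integral ((hF.integrable_exp i).const_mul c) h).trans ?_
  rw [integral_const_mul]
  exact mul_le_mul_of_nonneg_left (hF.exp_le i) hc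

lemma abs_le_asum_ball (hF : NormField ρ m κ a b X μ) (i : ι) (ω : Ω) :
    |X i ω| ≤ asum X (ball ρ i (2 * m)) ω := abs_le_asum (hF.mem_ball_self i _) ω

lemma pow_le_exp (hF : NormField ρ m κ a b X μ) (i : ι) (k : ℕ) (ω : Ω) :
    asum X (ball ρ i (2 * m)) ω ^ k
      ≤ k.factorial / a ^ k * exp (a * asum X (ball ρ i (2 * m)) ω) := by
  have ha := hF.a_pos
  have h := pow_div_factorial_le_exp (x := a * asum X (ball ρ i (2 * m)) ω)
    (mul_nonneg ha.le (asum_nonneg ω)) k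
  rw [div_le_iff₀ (by positivity), mul_pow] at h
  rw [div_mul_eq_mul_div, le_div_iff₀ (by positivity)]
  linarith

lemma abs_mul_psum_le (hF : NormField ρ m κ a b X μ) (i : ι) (ω : Ω) :
    |X i ω * psum X (ball ρ i m) ω| ≤ asum X (ball ρ i (2 * m)) ω ^ 2 := by
  rw [abs_mul, sq]
  exact mul_le_mul (hF.abs_le_asum_ball i ω)
    ((abs_psum_le ω).trans (asum_mono (ball_mono i (by omega)) ω)) (abs_nonneg _) (asum_nonneg ω)

lemma memLp_two (hF : NormField ρ m κ a b X μ) (i : ι) : MemLp (X i) 2 μ := by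
  rw [memLp_two_iff_integrable_sq (hF.meas i).aestronglyMeasurable]
  refine (hF.integrable_of_le_exp i ((hF.meas i).pow_const 2) (c := Nat.factorial 2 / a ^ 2)
    (by have := hF.a_pos; positivity) fun ω => ?_).1
  refine le_trans ?_ (hF.pow_le_exp i 2 ω)
  rw [abs_pow]
  exact pow_le_pow_left₀ (abs_nonneg _) (hF.abs_le_asum_ball i ω) 2

lemma memLp_psum (hF : NormField ρ m κ a b X μ) (D : Finset ι) : MemLp (psum X D) 2 μ :=
  memLp_finsetSum D fun i _ => hF.memLp_two i

lemma integrable_mul_psum (hF : NormField ρ m κ a b X μ) (i : ι) (D : Finset ι) :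
    Integrable (fun ω => X i ω * psum X D ω) μ :=
  (hF.memLp_two i).integrable_mul (hF.memLp_psum D)

/-- Each X_i is centred and independent of the field outside its m-ball, so only local covariances
contribute to the variance. -/
lemma sum_integral_mul_psum (hF : NormField ρ m κ a b X μ) :
    ∑ i, ∫ ω, X i ω * psum X (ball ρ i m) ω ∂μ = 1 := by
  have hmean : ∫ ω, psum X univ ω ∂μ = 0 := by
    unfold psum
    rw [integral_finsetSum _ fun i _ => (hF.memLp_two i).integrable (by norm_num)]
    simp [hF.mean]
  have hv := hF.var
  rw [variance_eq_integral (hF.measurable_psum' univ).aemeasurable, hmean] at hv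
  rw [← hv]
  have e : ∀ ω, (psum X univ ω - 0) ^ 2 = ∑ i, X i ω * psum X univ ω := fun ω => by
    rw [← sum_mul, sub_zero, sq]; rfl
  simp_rw [e]
  rw [integral_finsetSum _ fun i _ => hF.integrable_mul_psum i univ]
  refine sum_congr rfl fun i _ => ?_
  have h0 : ∫ ω, X i ω * psum X (ball ρ i m)ᶜ ω ∂μ = 0 := by
    rw [hF.integral_mul_indep (D := {i}) (E := (ball ρ i m)ᶜ) ?_
      (measurable_fieldSigma (mem_singleton_self i)) (measurable_psum (Subset.refl _)),
      hF.mean i, zero_mul]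
    intro k hk j hj
    rw [mem_singleton] at hk
    rw [mem_compl, mem_ball] at hj
    rw [hk]; omega
  have e2 : ∀ ω, X i ω * psum X univ ω
      = X i ω * psum X (ball ρ i m) ω + X i ω * psum X (ball ρ i m)ᶜ ω := fun ω => by
    rw [← BddField.psum_add_compl (ball ρ i m)]; ring
  simp_rw [e2]
  rw [integral_add (hF.integrable_mul_psum i _) (hF.integrable_mul_psum i _), h0, add_zero]

lemma card_mul (hF : NormField ρ m κ a b X μ) (k : ℕ) :
    (Fintype.card ι : ℝ) * (b / a ^ (k + 2)) = bulk ι a b / a ^ k := by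
  have := hF.a_pos.ne'
  unfold bulk; field_simp; ring

/-- Each local covariance is at most 2b/a², and they must add up to 1. -/
lemma half_le_bulk (hF : NormField ρ m κ a b X μ) : 1 / 2 ≤ bulk ι a b := by
  have ha := hF.a_pos
  have h : ∑ i, ∫ ω, X i ω * psum X (ball ρ i m) ω ∂μ ≤ ∑ _i : ι, 2 * (b / a ^ 2) := by
    refine sum_le_sum fun i _ => (le_abs_self _).trans ?_
    refine ((hF.integrable_of_le_exp i ((hF.meas i).mul (hF.measurable_psum' _))
      (c := Nat.factorial 2 / a ^ 2) (by positivity) fun ω => ?_).2).trans (le_of_eq ?_)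
    · exact (hF.abs_mul_psum_le i ω).trans (hF.pow_le_exp i 2 ω)
    · rw [show Nat.factorial 2 = 2 from rfl]; push_cast; ring
  rw [hF.sum_integral_mul_psum, sum_const, nsmul_eq_mul, card_univ] at h
  unfold bulk
  rw [mul_div_assoc]
  linarith

/-- Two bounds with different roles: the cubic one leads to the final rate with its factor κ², while
the exponential one shows that the total error is small, where κ² would be too large. -/
lemma abs_trunc_sub_le (hF : NormField ρ m κ a b X μ) (hx : 0 < x) (i : ι) (ω : Ω) :
    |trunc x X i ω - X i ω| ≤ asum X (ball ρ i (2 * m)) ω ^ 3 / x ^ 2 ∧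
      |trunc x X i ω - X i ω|
        ≤ 2 / a * exp (-(a * x) / 2) * exp (a * asum X (ball ρ i (2 * m)) ω) := by
  have ha := hF.a_pos
  have hY := hF.abs_le_asum_ball i ω
  set y := asum X (ball ρ i (2 * m)) ω with hy
  have hy0 : 0 ≤ y := (abs_nonneg _).trans hY
  by_cases h : |X i ω| ≤ x
  · rw [trunc_eq h, sub_self, abs_zero]
    constructor <;> positivity
  · have hxy : x ≤ y := (not_le.1 h).le.trans hY
    have e : |trunc x X i ω - X i ω| = |X i ω| := by
      unfold trunc; rw [if_neg h, zero_sub, abs_neg]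
    rw [e]
    constructor
    · refine hY.trans ?_
      rw [le_div_iff₀ (by positivity)]
      have : x ^ 2 ≤ y ^ 2 := pow_le_pow_left₀ hx.le hxy 2
      nlinarith
    · refine hY.trans ?_
      have h1 : a * y / 2 ≤ exp (a * y / 2) := by linarith [add_one_le_exp (a * y / 2)]
      have h2 : (1 : ℝ) ≤ exp (-(a * x) / 2 + a * y / 2) := by
        apply one_le_exp
        nlinarith
      calc y = 2 / a * (a * y / 2) := by field_simp
        _ ≤ 2 / a * (exp (a * y / 2) * exp (-(a * x) / 2 + a * y / 2)) := by
            gcongr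
            nlinarith [exp_pos (a * y / 2)]
        _ = _ := by
            rw [mul_assoc, ← exp_add, ← exp_add]; congr 2; ring

lemma integral_trunc (hF : NormField ρ m κ a b X μ) (hx : 0 ≤ x) (i : ι) :
    ∫ ω, trunc x X i ω ∂μ = ∫ ω, (trunc x X i ω - X i ω) ∂μ := by
  rw [integral_sub ((hF.bddField_trunc hx).bddMeas i).integrable
    ((hF.memLp_two i).integrable (by norm_num)), hF.mean, sub_zero]

lemma meanErr_trunc_le (hF : NormField ρ m κ a b X μ) (hx : 0 < x) :
    meanErr (trunc x X) μ ≤ 6 * (bulk ι a b / a) / x ^ 2 ∧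
      meanErr (trunc x X) μ ≤ 2 * bulk ι a b * a * exp (-(a * x) / 2) := by
  have ha := hF.a_pos
  have hm : ∀ i, Measurable fun ω => trunc x X i ω - X i ω := fun i =>
    ((hF.bddField_trunc hx.le).meas i).sub (hF.meas i)
  have he : ∀ i, ∫ ω, trunc x X i ω ∂μ = ∫ ω, (trunc x X i ω - X i ω) ∂μ := hF.integral_trunc hx.le
  unfold meanErr
  simp_rw [he]
  constructor
  · calc _ ≤ ∑ _i : ι, 6 / x ^ 2 * (b / a ^ 3) := by
          refine sum_le_sum fun i _ => ?_
          refine ((hF.integrable_of_le_exp i (hm i) (c := Nat.factorial 3 / a ^ 3 / x ^ 2)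
            (by positivity) fun ω => ?_).2).trans (le_of_eq ?_)
          · refine (hF.abs_trunc_sub_le hx i ω).1.trans ?_
            rw [div_mul_eq_mul_div]
            gcongr
            exact hF.pow_le_exp i 3 ω
          · rw [show Nat.factorial 3 = 6 from rfl]; push_cast; ring
      _ = _ := by
          rw [sum_const, nsmul_eq_mul, card_univ, mul_left_comm, hF.card_mul 1]; ring
  · calc _ ≤ ∑ _i : ι, 2 / a * exp (-(a * x) / 2) * b :=
          sum_le_sum fun i _ => (hF.integrable_of_le_exp i (hm i) (by positivity) fun ω =>
            (hF.abs_trunc_sub_le hx i ω).2).2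
      _ = _ := by
          rw [sum_const, nsmul_eq_mul, card_univ]; unfold bulk; field_simp

/-- If the local absolute sum Y is at most x, nothing in the ball is truncated. Otherwise both
products are at most Y², which is at most Y³/x. -/
lemma varErr_trunc_le (hF : NormField ρ m κ a b X μ) (hx : 0 < x) :
    varErr ρ m (trunc x X) μ ≤ 12 * (bulk ι a b / a) / x := by
  have ha := hF.a_pos
  have hT := hF.bddField_trunc hx.le
  have hb : ∀ i, BddMeas fun ω => trunc x X i ω * psum (trunc x X) (ball ρ i m) ω := fun i =>
    (hT.bddMeas i).mul (hT.bddMeas_psum _)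
  unfold varErr
  rw [← hF.sum_integral_mul_psum, ← sum_sub_distrib]
  refine (abs_sum_le_sum_abs _ _).trans ?_
  calc _ ≤ ∑ _i : ι, 12 / x * (b / a ^ 3) := by
        refine sum_le_sum fun i _ => ?_
        rw [← integral_sub (hb i).integrable (hF.integrable_mul_psum i _)]
        refine ((hF.integrable_of_le_exp i
          ((hb i).1.sub ((hF.meas i).mul (hF.measurable_psum' _)))
          (c := 2 * (Nat.factorial 3 / a ^ 3) / x) (by positivity) fun ω => ?_).2).trans
          (le_of_eq ?_)
        · refine le_trans ?_ (show 2 * asum X (ball ρ i (2 * m)) ω ^ 3 / x ≤ _ from ?_)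
          · have k1 := hF.abs_mul_psum_le i ω
            have k2 : |trunc x X i ω * psum (trunc x X) (ball ρ i m) ω|
                ≤ asum X (ball ρ i (2 * m)) ω ^ 2 := by
              rw [abs_mul, sq]
              exact mul_le_mul ((abs_trunc_le_self x X i ω).trans (hF.abs_le_asum_ball i ω))
                ((abs_psum_le ω).trans ((asum_trunc_le x X _ ω).trans
                  (asum_mono (ball_mono i (by omega)) ω))) (abs_nonneg _) (asum_nonneg ω)
            have hmem : ∀ j ∈ ball ρ i m, |X j ω| ≤ asum X (ball ρ i (2 * m)) ω := fun j hj =>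
              abs_le_asum (ball_mono i (by omega) hj) ω
            have hself := hF.abs_le_asum_ball i ω
            have hy0 : 0 ≤ asum X (ball ρ i (2 * m)) ω := asum_nonneg ω
            simp only [Pi.sub_apply, Pi.mul_apply]
            by_cases hyx : asum X (ball ρ i (2 * m)) ω ≤ x
            · have e1 : trunc x X i ω = X i ω := trunc_eq (hself.trans hyx)
              have e2 : psum (trunc x X) (ball ρ i m) ω = psum X (ball ρ i m) ω :=
                sum_congr rfl fun j hj => trunc_eq ((hmem j hj).trans hyx)
              rw [e1, e2, sub_self, abs_zero]
              positivity
            · refine (abs_sub _ _).trans ((add_le_add k2 k1).trans ?_)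
              rw [le_div_iff₀ hx]
              nlinarith [sq_nonneg (asum X (ball ρ i (2 * m)) ω)]
          · have := hF.pow_le_exp i 3 ω
            rw [div_mul_eq_mul_div, mul_assoc]
            gcongr
        · rw [show Nat.factorial 3 = 6 from rfl]; push_cast; ring
    _ = _ := by
        rw [sum_const, nsmul_eq_mul, card_univ, mul_left_comm, hF.card_mul 1]; ring

/-- The truncated field is moderate. -/
lemma moderateField_trunc (hF : NormField ρ m κ a b X μ) {t : ℝ} (ht : 0 ≤ t) (hx : 0 ≤ x)
    (hxt : (1 + t) * (κ * x) ≤ 1) : ModerateField ρ m κ x a b t (trunc x X) μ :=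
  have hT := hF.bddField_trunc hx
  { hT with
    a_pos := hF.a_pos
    one_le_b := hF.one_le_b
    one_le_κ := hF.one_le_κ
    t_nonneg := ht
    tilt_le := hxt
    exp_le := fun i => by
      refine (integral_mono ((hT.bddMeas_asum _).exp_mul a).integrable (hF.integrable_exp i)
        fun ω => ?_).trans (hF.exp_le i)
      exact exp_le_exp.2 (mul_le_mul_of_nonneg_left (asum_trunc_le x X _ ω) hF.a_pos.le)
    half_le_bulk := hF.half_le_bulk }

/-- Truncation changes tail probabilities by an exponentially small amount. -/
lemma abs_tail_sub_trunc_le (hF : NormField ρ m κ a b X μ) (x z : ℝ) :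
    |μ.real {ω | z < psum X univ ω} - μ.real {ω | z < psum (trunc x X) univ ω}|
      ≤ √(bulk ι a b) * a * exp (-(a * x) / 2) := by
  have ha := hF.a_pos
  have hB : 0 ≤ bulk ι a b := by linarith [hF.half_le_bulk]
  set S : Set Ω := ⋃ i : ι, {ω | x < |X i ω|} with hS
  have hSm : ∀ i, MeasurableSet {ω | x < |X i ω|} := fun i =>
    measurableSet_lt measurable_const (continuous_abs.measurable.comp (hF.meas i))
  have heq : ∀ ω ∉ S, psum (trunc x X) univ ω = psum X univ ω := fun ω hω => by
    refine sum_congr rfl fun i _ => trunc_eq ?_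
    by_contra h
    exact hω (Set.mem_iUnion.2 ⟨i, not_le.1 h⟩)
  have hle : |μ.real {ω | z < psum X univ ω} - μ.real {ω | z < psum (trunc x X) univ ω}|
      ≤ μ.real S := by
    have h1 : μ.real {ω | z < psum X univ ω}
        ≤ μ.real {ω | z < psum (trunc x X) univ ω} + μ.real S := by
      refine (measureReal_mono fun ω hω => ?_).trans (measureReal_union_le _ _)
      by_cases h : ω ∈ S
      · exact Or.inr h
      · left
        show z < psum (trunc x X) univ ω
        rw [heq ω h]; exact hω
    have h2 : μ.real {ω | z < psum (trunc x X) univ ω}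
        ≤ μ.real {ω | z < psum X univ ω} + μ.real S := by
      refine (measureReal_mono fun ω hω => ?_).trans (measureReal_union_le _ _)
      by_cases h : ω ∈ S
      · exact Or.inr h
      · left
        show z < psum X univ ω
        rw [← heq ω h]; exact hω
    rw [abs_le]; constructor <;> linarith
  have hSb : μ.real S ≤ bulk ι a b * a ^ 2 * exp (-(a * x)) := by
    calc μ.real S ≤ ∑ i, μ.real {ω | x < |X i ω|} := measureReal_iUnion_fintype_le _
      _ ≤ ∑ _i : ι, exp (-(a * x)) * b := by
          refine sum_le_sum fun i _ => ?_
          rw [← integral_indicator_one (hSm i)]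
          refine (integral_mono ((integrable_const (1 : ℝ)).indicator (hSm i))
            ((hF.integrable_exp i).const_mul (exp (-(a * x)))) fun ω => ?_).trans ?_
          · by_cases h : x < |X i ω|
            · simp only [Set.indicator_of_mem (show ω ∈ {ω | x < |X i ω|} from h)]
              rw [← exp_add]
              apply one_le_exp
              have := hF.abs_le_asum_ball i ω
              nlinarith
            · simp only [Set.indicator_of_notMem (show ω ∉ {ω | x < |X i ω|} from h)]
              positivity
          · rw [integral_const_mul]
            exact mul_le_mul_of_nonneg_left (hF.exp_le i) (exp_pos _).le
      _ = _ := by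
          rw [sum_const, nsmul_eq_mul, card_univ]; unfold bulk; field_simp
  refine hle.trans ?_
  have h0 : 0 ≤ μ.real S := measureReal_nonneg
  have h1 : μ.real S ≤ 1 := measureReal_le_one
  -- A probability dominates its square, so the union bound yields its own square root as a bound,
  -- with a in place of a².
  have hsq : μ.real S ^ 2 ≤ (√(bulk ι a b) * a * exp (-(a * x) / 2)) ^ 2 := by
    rw [mul_pow, mul_pow, sq_sqrt hB, ← exp_nat_mul]
    calc _ ≤ μ.real S := by nlinarith
      _ ≤ _ := hSb
      _ = _ := by congr 2; push_cast; ring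
  exact (abs_le_of_sq_le_sq' hsq (by positivity)).2

end NormField
end MDepField

/-! ### Choice of the truncation level and reduction to the stated range -/

namespace MDepField

open Real Finset

set_option linter.unusedSectionVars false

variable {ι Ω : Type*} [MeasurableSpace Ω] [Fintype ι]

lemma exp_neg_div_le_one_sub_stdNormalCDF {z : ℝ} (hz : 0 ≤ z) :
    exp (-z ^ 2 / 2) / (15 * (1 + z)) ≤ 1 - stdNormalCDF z := by
  rw [one_sub_stdNormalCDF, div_eq_mul_one_div]
  exact mul_le_mul_of_nonneg_left (one_div_le_mills hz) (exp_pos _).le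

namespace NormField

variable {ρ : ι → ι → ℕ} {m : ℕ} {κ a b x : ℝ} {X : ι → Ω → ℝ} {μ : Measure Ω}
  [IsProbabilityMeasure μ] [DecidableEq ι]

/-- Moderate deviations in the regime where the truncation level is admissible. -/
lemma abs_tail_ratio_sub_one_le (hF : NormField ρ m κ a b X μ) {z : ℝ} (hz : 0 ≤ z)
    (h1 : κ * bulk ι a b * (1 + z) ^ 3 ≤ 1 / 10 ^ 7 * a)
    (h2 : κ ^ 2 * (1 + z) ^ 2 ≤ a * exp (z ^ 2 / 2)) :
    |μ.real {ω | z < psum X univ ω} / (1 - stdNormalCDF z) - 1|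
      ≤ 10 ^ 10 * (κ ^ 2 / a * (bulk ι a b + √(bulk ι a b)) * (1 + z) ^ 3) := by
  have ha := hF.a_pos
  have hκ := hF.one_le_κ
  have hβ := hF.half_le_bulk
  set B := bulk ι a b with hB
  have hB0 : 0 < B := by linarith
  set τ := 1 + z with hτ
  have hτ1 : 1 ≤ τ := by linarith
  -- The largest level compatible with tilting by parameters up to 1 + z.
  set x := 1 / (κ * τ) with hx
  have hκτ : 0 < κ * τ := by positivity
  have hx0 : 0 < x := by positivity
  have hM := hF.moderateField_trunc (t := z) hz hx0.le
    (by rw [hx, ← hτ]; field_simp; exact le_rfl)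
  set q := a * x with hq
  have hq0 : 0 < q := by positivity
  have hqκ : q * (κ * τ) = a := by rw [hq, hx]; field_simp
  have hBq : B * τ ^ 2 ≤ 1 / 10 ^ 7 * q := by
    have : B * τ ^ 2 * (κ * τ) ≤ 1 / 10 ^ 7 * q * (κ * τ) := by
      rw [mul_assoc (1 / 10 ^ 7), hqκ]; linarith
    exact le_of_mul_le_mul_right this hκτ
  have hzq : z ^ 2 / 2 ≤ q / 4 := by
    have : z ^ 2 ≤ τ ^ 2 := pow_le_pow_left₀ hz (by linarith) 2
    nlinarith
  -- The second hypothesis in terms of q = ax. Powers of q are then paid by exp(q/4) and the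
  -- Gaussian factor by another exp(q/4), both out of the truncation gain exp(-q/2).
  have haq : a ≤ exp (z ^ 2 / 2) * q ^ 2 := by
    have : a * (κ * τ) ^ 2 ≤ exp (z ^ 2 / 2) * q ^ 2 * (κ * τ) ^ 2 := by
      rw [mul_assoc (exp _), ← mul_pow, hqκ]
      nlinarith
    exact le_of_mul_le_mul_right this (by positivity)
  have hq3 : q ^ 3 ≤ 384 * exp (q / 4) := by
    have := pow_div_factorial_le_exp (x := q / 4) (by positivity) 3
    rw [show Nat.factorial 3 = 6 from rfl, div_le_iff₀ (by norm_num)] at this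
    push_cast at this
    nlinarith
  have hq2 : q ^ 2 ≤ 32 * exp (q / 4) := by
    have := pow_div_factorial_le_exp (x := q / 4) (by positivity) 2
    rw [show Nat.factorial 2 = 2 from rfl, div_le_iff₀ (by norm_num)] at this
    push_cast at this
    nlinarith
  have hexp : exp (z ^ 2 / 2) * exp (-q / 2) * exp (q / 4) ≤ 1 := by
    rw [← exp_add, ← exp_add, exp_le_one_iff]; linarith
  obtain ⟨m1, m2⟩ := hF.meanErr_trunc_le hx0
  have v1 := hF.varErr_trunc_le hx0
  rw [← hB] at m1 m2 v1
  rw [← hq] at m2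
  have hx1 : 1 / x = κ * τ := by rw [hx]; field_simp
  have hx2 : 1 / x ^ 2 = (κ * τ) ^ 2 := by rw [← hx1]; field_simp
  have m1' : meanErr (trunc x X) μ ≤ 6 * (B / a) * (κ * τ) ^ 2 := by
    rw [← hx2]; exact m1.trans (le_of_eq (by ring))
  have v1' : varErr ρ m (trunc x X) μ ≤ 12 * (B / a) * (κ * τ) := by
    rw [← hx1]; exact v1.trans (le_of_eq (by ring))
  have h1' : κ * B * τ ^ 3 / a ≤ 1 / 10 ^ 7 := by rwa [div_le_iff₀ ha]
  have hE : 3400 * ((1 + z) * steinErr ρ m κ a b z (trunc x X) μ) ≤ 1 := by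
    have hBτ : B * τ ≤ 1 / 10 ^ 7 * q := by 
      have : B * τ * 1 ≤ B * τ * τ := by gcongr
      linarith
    -- The exponential bound is needed here: the polynomial one is of order κ²Bτ³/a, whereas the
    -- first hypothesis controls only κBτ³/a.
    have k1 : τ * meanErr (trunc x X) μ ≤ 2 * 384 / 10 ^ 7 := by
      calc _ ≤ τ * (2 * B * a * exp (-q / 2)) := by gcongr
        _ ≤ τ * (2 * B * (exp (z ^ 2 / 2) * q ^ 2) * exp (-q / 2)) := by gcongr
        _ = 2 * (B * τ) * q ^ 2 * (exp (z ^ 2 / 2) * exp (-q / 2)) := by ring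
        _ ≤ 2 * (1 / 10 ^ 7 * q) * q ^ 2 * (exp (z ^ 2 / 2) * exp (-q / 2)) := by
            exact mul_le_mul_of_nonneg_right (mul_le_mul_of_nonneg_right
              (mul_le_mul_of_nonneg_left hBτ (by norm_num)) (by positivity)) (by positivity)
        _ = 2 / 10 ^ 7 * (exp (z ^ 2 / 2) * exp (-q / 2)) * q ^ 3 := by ring
        _ ≤ 2 / 10 ^ 7 * (exp (z ^ 2 / 2) * exp (-q / 2)) * (384 * exp (q / 4)) := by gcongr
        _ = 2 * 384 / 10 ^ 7 * (exp (z ^ 2 / 2) * exp (-q / 2) * exp (q / 4)) := by ring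
        _ ≤ 2 * 384 / 10 ^ 7 * 1 := by gcongr
        _ = _ := by norm_num
    have k2 : τ * (τ * varErr ρ m (trunc x X) μ) ≤ 12 * (κ * B * τ ^ 3 / a) := by
      calc _ ≤ τ * (τ * (12 * (B / a) * (κ * τ))) := by gcongr
        _ = _ := by ring
    have k3 : τ * (τ ^ 2 * (κ * B / a)) = κ * B * τ ^ 3 / a := by ring
    unfold steinErr
    rw [← hB, ← hτ]
    have k4 : τ * (meanErr (trunc x X) μ + τ * varErr ρ m (trunc x X) μ + τ ^ 2 * (κ * B / a))
        = τ * meanErr (trunc x X) μ + τ * (τ * varErr ρ m (trunc x X) μ)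
          + τ * (τ ^ 2 * (κ * B / a)) := by ring
    rw [k4, k3]
    linarith
  have hT := hM.abs_tail_ratio_sub_one_le hE
  have hE2 : (1 + z) * steinErr ρ m κ a b z (trunc x X) μ ≤ 19 * (κ ^ 2 / a * B * τ ^ 3) := by
    have hκ2 : κ ≤ κ ^ 2 := by nlinarith
    have k0 : B / a * κ * τ ^ 2 ≤ B / a * κ ^ 2 * τ ^ 2 := by gcongr
    have k1 : steinErr ρ m κ a b z (trunc x X) μ ≤ 19 * (B / a * κ ^ 2 * τ ^ 2) := by
      unfold steinErr
      rw [← hB, ← hτ]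
      calc _ ≤ 6 * (B / a) * (κ * τ) ^ 2 + τ * (12 * (B / a) * (κ * τ)) + τ ^ 2 * (κ * B / a) := by
            gcongr
        _ = 6 * (B / a * κ ^ 2 * τ ^ 2) + 13 * (B / a * κ * τ ^ 2) := by ring
        _ ≤ _ := by linarith
    calc _ ≤ τ * (19 * (B / a * κ ^ 2 * τ ^ 2)) := by gcongr
      _ = _ := by ring
  have hG := exp_neg_div_le_one_sub_stdNormalCDF hz
  rw [← hτ] at hG
  have hG0 : 0 < 1 - stdNormalCDF z := lt_of_lt_of_le (by positivity) hG
  have hbad : |μ.real {ω | z < psum X univ ω} - μ.real {ω | z < psum (trunc x X) univ ω}|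
      ≤ 480 * (κ ^ 2 / a * √B * τ ^ 3) * (1 - stdNormalCDF z) := by
    refine (hF.abs_tail_sub_trunc_le x z).trans (le_trans ?_
      (mul_le_mul_of_nonneg_left hG (by positivity)))
    rw [← hB, ← hq]
    -- Rewriting a in this way exhibits the factor κ²/a of the target rate.
    have e : a = κ ^ 2 * τ ^ 2 / a * q ^ 2 := by
      rw [hq, hx]; field_simp
    have e1 : exp (-z ^ 2 / 2) * exp (z ^ 2 / 2) = 1 := by
      rw [← exp_add, show -z ^ 2 / 2 + z ^ 2 / 2 = 0 by ring, exp_zero]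
    calc √B * a * exp (-q / 2) = √B * (κ ^ 2 * τ ^ 2 / a * q ^ 2) * exp (-q / 2) := by rw [← e]
      _ ≤ √B * (κ ^ 2 * τ ^ 2 / a * (32 * exp (q / 4))) * exp (-q / 2) := by gcongr
      _ = 32 * √B * (κ ^ 2 * τ ^ 2 / a) * exp (-z ^ 2 / 2)
          * (exp (z ^ 2 / 2) * exp (-q / 2) * exp (q / 4)) := by
          linear_combination (-(32 * √B * (κ ^ 2 * τ ^ 2 / a) * exp (-q / 2) * exp (q / 4))) * e1
      _ ≤ 32 * √B * (κ ^ 2 * τ ^ 2 / a) * exp (-z ^ 2 / 2) * 1 := by gcongr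
      _ = _ := by field_simp; norm_num
  have hsplit : μ.real {ω | z < psum X univ ω} / (1 - stdNormalCDF z) - 1
      = (μ.real {ω | z < psum (trunc x X) univ ω} / (1 - stdNormalCDF z) - 1)
        + (μ.real {ω | z < psum X univ ω} - μ.real {ω | z < psum (trunc x X) univ ω})
          / (1 - stdNormalCDF z) := by ring
  rw [hsplit]
  refine (abs_add_le _ _).trans ?_
  rw [abs_div _ (1 - stdNormalCDF z), abs_of_pos hG0]
  have hb' := (div_le_iff₀ hG0).2 hbad
  have p1 : 0 ≤ κ ^ 2 / a * B * τ ^ 3 := by positivity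
  have p2 : 0 ≤ κ ^ 2 / a * √B * τ ^ 3 := by positivity
  have e : κ ^ 2 / a * (B + √B) * τ ^ 3 = κ ^ 2 / a * B * τ ^ 3 + κ ^ 2 / a * √B * τ ^ 3 := by ring
  rw [e]
  linarith

/-- Moderate deviations, with the trivial regime included. -/
lemma abs_tail_ratio_sub_one_le_of_range (hF : NormField ρ m κ a b X μ) {z : ℝ} (hz : 0 ≤ z)
    (hrange : κ * bulk ι a b * z ^ 3 ≤ 1 / 10 ^ 9 * a) :
    |μ.real {ω | z < psum X univ ω} / (1 - stdNormalCDF z) - 1|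
      ≤ 10 ^ 11 * (κ ^ 2 / a * (1 + bulk ι a b ^ 3)) * (1 + z ^ 3) := by
  have ha := hF.a_pos
  have hκ := hF.one_le_κ
  have hβ := hF.half_le_bulk
  set B := bulk ι a b with hB
  have hB0 : 0 < B := by linarith
  have hG := exp_neg_div_le_one_sub_stdNormalCDF hz
  have hG0 : 0 < 1 - stdNormalCDF z := lt_of_lt_of_le (by positivity) hG
  have hτ3 : (1 + z) ^ 3 ≤ 4 * (1 + z ^ 3) := by
    nlinarith [mul_nonneg hz (sq_nonneg (z - 1)), sq_nonneg (z - 1)]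
  set δ := κ ^ 2 / a * (1 + B ^ 3) with hδ
  have hδ0 : 0 < δ := by positivity
  have hz3 : 0 ≤ z ^ 3 := by positivity
  -- In this case the claimed bound is at least 1/(1 - Φ(z)), which dominates both the ratio and 1.
  -- In the other case the Gaussian tail is small relative to 1/δ, and this yields the remaining
  -- hypotheses on the truncation level.
  by_cases htriv : 1 ≤ 10 ^ 11 * δ * (1 + z ^ 3) * (1 - stdNormalCDF z)
  · have hG1 : 1 - stdNormalCDF z ≤ 1 := by
      have : 0 ≤ stdNormalCDF z := cdf_nonneg _ _
      linarith
    have hR : 1 / (1 - stdNormalCDF z) ≤ 10 ^ 11 * δ * (1 + z ^ 3) := by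
      rwa [div_le_iff₀ hG0]
    have hP0 : 0 ≤ μ.real {ω | z < psum X univ ω} / (1 - stdNormalCDF z) :=
      div_nonneg measureReal_nonneg hG0.le
    have hP1 : μ.real {ω | z < psum X univ ω} / (1 - stdNormalCDF z)
        ≤ 1 / (1 - stdNormalCDF z) := by
      gcongr
      exact measureReal_le_one
    have hone : 1 ≤ 1 / (1 - stdNormalCDF z) := by rwa [le_div_iff₀ hG0, one_mul]
    rw [abs_le]; constructor <;> linarith
  · rw [not_le] at htriv
    have hsmall : 10 ^ 9 * δ * (1 + z) ^ 2 ≤ exp (z ^ 2 / 2) := by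
      have k1 : 10 ^ 11 * δ * ((1 + z) ^ 3 / 4) * (exp (-z ^ 2 / 2) / (15 * (1 + z))) ≤ 1 := by
        refine le_trans ?_ htriv.le
        gcongr
        linarith
      have k2 : 10 ^ 11 * δ * ((1 + z) ^ 3 / 4) * (exp (-z ^ 2 / 2) / (15 * (1 + z)))
          = 10 ^ 11 / 60 * δ * (1 + z) ^ 2 * exp (-z ^ 2 / 2) := by field_simp; norm_num
      rw [k2, show -z ^ 2 / 2 = -(z ^ 2 / 2) by ring, exp_neg, ← div_eq_mul_inv,
        div_le_one (exp_pos _)] at k1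
      refine le_trans ?_ k1
      have : 0 ≤ δ * (1 + z) ^ 2 := by positivity
      nlinarith
    have hκδ : κ ^ 2 / a ≤ δ := by
      rw [hδ]; exact le_mul_of_one_le_right (by positivity) (by linarith [pow_pos hB0 3])
    have hB3 : B ≤ 1 + B ^ 3 := by
      nlinarith [mul_nonneg hB0.le (sq_nonneg (B - 1)), sq_nonneg (B - 1)]
    have hsq : √B ≤ 1 + B ^ 3 := by
      have : √B ≤ (1 + B) / 2 := by
        rw [sqrt_le_left (by linarith)]; nlinarith [sq_nonneg (B - 1)]
      linarith [pow_pos hB0 3]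
    have h2 : κ ^ 2 * (1 + z) ^ 2 ≤ a * exp (z ^ 2 / 2) := by
      have k : κ ^ 2 / a * (1 + z) ^ 2 ≤ exp (z ^ 2 / 2) := by
        refine le_trans ?_ hsmall
        have : κ ^ 2 / a * (1 + z) ^ 2 ≤ δ * (1 + z) ^ 2 := by gcongr
        have : 0 ≤ δ * (1 + z) ^ 2 := by positivity
        linarith
      rw [div_mul_eq_mul_div, div_le_iff₀ ha] at k
      linarith
    have h1 : κ * B * (1 + z) ^ 3 ≤ 1 / 10 ^ 7 * a := by
      -- For z ≥ 1 the range condition suffices, as 1 + z ≤ 2z. For z ≤ 1 it says little, but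
      -- exp(z²/2) ≤ 3 then forces δ itself to be tiny.
      rcases le_total 1 z with hz1 | hz1
      · have : (1 + z) ^ 3 ≤ (2 * z) ^ 3 := by gcongr; linarith
        calc κ * B * (1 + z) ^ 3 ≤ κ * B * (2 * z) ^ 3 := by gcongr
          _ = 8 * (κ * B * z ^ 3) := by ring
          _ ≤ _ := by linarith
      · have he : exp (z ^ 2 / 2) ≤ 3 := by
          calc exp (z ^ 2 / 2) ≤ exp 1 := exp_le_exp.2 (by nlinarith)
            _ ≤ 3 := by linarith [exp_one_lt_d9]
        have k1 : κ * B / a ≤ δ := by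
          rw [hδ, div_mul_eq_mul_div]
          have : κ ≤ κ ^ 2 := by nlinarith
          gcongr
        have k2 : δ ≤ δ * (1 + z) ^ 2 :=
          le_mul_of_one_le_right hδ0.le (one_le_pow₀ (by linarith))
        have k3 : κ * B / a ≤ 3 / 10 ^ 9 := by linarith
        rw [div_le_iff₀ ha] at k3
        have k4 : (1 + z) ^ 3 ≤ 8 := by
          calc (1 + z) ^ 3 ≤ (1 + 1) ^ 3 := by gcongr
            _ = 8 := by norm_num
        calc κ * B * (1 + z) ^ 3 ≤ κ * B * 8 := by gcongr
          _ ≤ _ := by linarith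
    refine (hF.abs_tail_ratio_sub_one_le hz h1 h2).trans ?_
    rw [← hB]
    calc _ ≤ 10 ^ 10 * (κ ^ 2 / a * ((1 + B ^ 3) + (1 + B ^ 3)) * (4 * (1 + z ^ 3))) := by gcongr
      _ = 8 * 10 ^ 10 * δ * (1 + z ^ 3) := by rw [hδ]; ring
      _ ≤ _ := by gcongr; norm_num

end NormField

/-! ### Fields on the lattice -/

section Lattice

variable {d : ℕ}

lemma latticeDist_le_iff {i j : Fin d → ℤ} {r : ℕ} :
    latticeDist i j ≤ r ↔ ∀ k, (i k - j k).natAbs ≤ r := by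
  simp [latticeDist, Finset.sup_le_iff]

lemma latticeDist_self (i : Fin d → ℤ) : latticeDist i i = 0 :=
  Nat.le_zero.1 (latticeDist_le_iff.2 fun k => by simp)

lemma latticeDist_comm (i j : Fin d → ℤ) : latticeDist i j = latticeDist j i := by
  unfold latticeDist
  congr 1; ext k
  rw [← Int.natAbs_neg, neg_sub]

lemma latticeDist_triangle (i j k : Fin d → ℤ) :
    latticeDist i k ≤ latticeDist i j + latticeDist j k := by
  refine latticeDist_le_iff.2 fun l => ?_
  have h1 := latticeDist_le_iff.1 (le_refl (latticeDist i j)) l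
  have h2 := latticeDist_le_iff.1 (le_refl (latticeDist j k)) l
  omega

variable {J : Finset (Fin d → ℤ)}

lemma card_ball_lattice_le (m : ℕ) (i : J) :
    ((ball (fun i j : J => latticeDist (i : Fin d → ℤ) j) i (4 * m)).card : ℝ)
      ≤ (8 * (m : ℝ) + 1) ^ d := by
  classical
  set S := Fintype.piFinset fun k : Fin d =>
    Finset.Icc ((i : Fin d → ℤ) k - 4 * m) ((i : Fin d → ℤ) k + 4 * m) with hS
  have hle : (ball (fun i j : J => latticeDist (i : Fin d → ℤ) j) i (4 * m)).card ≤ S.card := by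
    refine Finset.card_le_card_of_injOn (fun j : J => (j : Fin d → ℤ)) ?_
      Subtype.val_injective.injOn
    intro j hj
    have hj' := latticeDist_le_iff.1
      ((mem_ball (ρ := fun i j : J => latticeDist (i : Fin d → ℤ) j)).1 (Finset.mem_coe.1 hj))
    simp only [hS, Finset.mem_coe, Fintype.mem_piFinset, Finset.mem_Icc]
    intro k
    have := hj' k
    omega
  have hcard : S.card = (8 * m + 1) ^ d := by
    rw [hS, Fintype.card_piFinset]
    simp only [Int.card_Icc]
    have : ∀ k : Fin d, ((i : Fin d → ℤ) k + 4 * m + 1 - ((i : Fin d → ℤ) k - 4 * m)).toNat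
        = 8 * m + 1 := fun k => by omega
    simp [this]
  rw [hcard] at hle
  exact_mod_cast hle

lemma localField_of_isMDependent {m : ℕ} {X : J → Ω → ℝ} {μ : Measure Ω}
    (hX : ∀ i, Measurable (X i)) (h : IsMDependent m X μ) :
    LocalField (fun i j : J => latticeDist (i : Fin d → ℤ) j) m ((8 * (m : ℝ) + 1) ^ d) X μ where
  self i := latticeDist_self _
  symm i j := latticeDist_comm _ _
  tri i j k := latticeDist_triangle _ _ _
  card := card_ball_lattice_le m
  meas := hX
  indep D E hDE := by
    have hdist : (m : ℕ∞) < setDist ((fun i : J => (i : Fin d → ℤ)) '' (D : Set J))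
        ((fun i : J => (i : Fin d → ℤ)) '' (E : Set J)) := by
      -- Distances are integers, so the pointwise strict inequality becomes ≥ m + 1, a form that
      -- passes to the infimum; empty sets are covered since their infimum is ⊤.
      have h1 : ((m + 1 : ℕ) : ℕ∞) ≤ setDist ((fun i : J => (i : Fin d → ℤ)) '' (D : Set J))
          ((fun i : J => (i : Fin d → ℤ)) '' (E : Set J)) := by
        unfold setDist
        refine le_iInf₂ fun i hi => le_iInf₂ fun j hj => ?_
        obtain ⟨i', hi', rfl⟩ := hi
        obtain ⟨j', hj', rfl⟩ := hj
        exact_mod_cast hDE i' hi' j' hj'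
      exact lt_of_lt_of_le (by exact_mod_cast Nat.lt_succ_self m) h1
    have hi := h D E hdist
    rw [IndepFun_iff_Indep] at hi
    have hle : ∀ D : Finset J, fieldSigma X D
        ≤ MeasurableSpace.comap (fun ω (i : ↥(D : Set J)) => X i ω) inferInstance := fun D =>
      iSup₂_le fun i hiD => by
        have : X i = (fun v : ↥(D : Set J) → ℝ => v ⟨i, hiD⟩) ∘
            fun ω (i : ↥(D : Set J)) => X i ω := rfl
        rw [this, ← MeasurableSpace.comap_comp]
        exact MeasurableSpace.comap_mono (measurable_pi_apply _).comap_le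
    exact indep_of_indep_of_le_left (indep_of_indep_of_le_right hi (hle E)) (hle D)

end Lattice

end MDepField

/-! ### The theorem for lattice fields -/

theorem corollary2p1 :
    ∃ C c : ℝ, 0 < C ∧ 0 < c ∧
      ∀ (d : ℕ) (_ : 1 ≤ d) (m : ℕ) (J : Finset (Fin d → ℤ))
        (Ω : Type*) (_ : MeasurableSpace Ω) (μ : Measure Ω) (_ : IsProbabilityMeasure μ)
        (X : J → Ω → ℝ) (_ : ∀ i, Measurable (X i))
        (_ : MDepField.IsMDependent m X μ)
        (_ : ∀ i, ∫ ω, X i ω ∂μ = 0)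
        (_ : variance (fun ω => ∑ i, X i ω) μ = 1)
        (a b : ℝ) (_ : 1 ≤ a) (_ : 1 ≤ b)
        (_ : ∀ i, Integrable (fun ω => Real.exp (a * ∑ j ∈ MDepField.nbhd m i, |X j ω|)) μ ∧
          ∫ ω, Real.exp (a * ∑ j ∈ MDepField.nbhd m i, |X j ω|) ∂μ ≤ b)
        (κ : ℝ) (_ : κ = (8 * (m : ℝ) + 1) ^ d)
        (z : ℝ) (_ : 0 ≤ z)
        (_ : z ≤ c * a ^ (1 / 3 : ℝ) *
          min 1 (κ ^ (-(1 / 3) : ℝ) * (1 + MDepField.theta J.card a b) ^ (-(2 / 3) : ℝ))),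
        |μ.real {ω | z < ∑ i, X i ω} / (1 - MDepField.stdNormalCDF z) - 1| ≤
          C * MDepField.delta κ J.card a b * (1 + z ^ 3) := by
  -- The range constant is the cube root of the 10⁻⁹ in the range condition on z³.
  refine ⟨10 ^ 11, 1 / 10 ^ 3, by norm_num, by norm_num, ?_⟩
  intro d _ m J Ω _ μ _ X hX hdep hmean hvar a b ha hb hexp κ hκ z hz hrange
  subst hκ
  set κ := (8 * (m : ℝ) + 1) ^ d with hκ
  have hκ1 : 1 ≤ κ := one_le_pow₀ (by linarith [(Nat.cast_nonneg m : (0 : ℝ) ≤ m)])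
  have ha0 : 0 < a := by linarith
  have hF : MDepField.NormField (fun i j : J => MDepField.latticeDist (i : Fin d → ℤ) j) m κ a b
      X μ :=
    { MDepField.localField_of_isMDependent hX hdep with
      a_pos := ha0
      one_le_b := hb
      one_le_κ := hκ1
      integrable_exp := fun i => (hexp i).1
      exp_le := fun i => (hexp i).2
      mean := hmean
      var := hvar }
  set θ := MDepField.theta J.card a b with hθ
  have hθ0 : 0 ≤ θ := by rw [hθ]; unfold MDepField.theta; positivity
  -- This identity turns the cube of the bulk into θ⁶ in δ.
  have hbulk : MDepField.bulk J a b = θ ^ 2 := by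
    rw [hθ]; unfold MDepField.theta MDepField.bulk
    rw [div_pow, mul_pow, Real.sq_sqrt (by linarith), Real.sq_sqrt (Nat.cast_nonneg _),
      Fintype.card_coe, mul_comm]
  have hz3 : z ^ 3 ≤ 1 / 10 ^ 9 * (a * (κ⁻¹ * ((1 + θ) ^ 2)⁻¹)) := by
    have h1 : z ≤ 1 / 10 ^ 3 * a ^ (1 / 3 : ℝ) *
        (κ ^ (-(1 / 3) : ℝ) * (1 + θ) ^ (-(2 / 3) : ℝ)) :=
      hrange.trans (mul_le_mul_of_nonneg_left (min_le_right _ _) (by positivity))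
    have hpow : ∀ u : ℝ, 0 ≤ u → ∀ e : ℝ, (u ^ e) ^ 3 = u ^ (e * 3) := fun u hu e => by
      rw [← Real.rpow_natCast, ← Real.rpow_mul hu]; norm_num
    calc z ^ 3 ≤ (1 / 10 ^ 3 * a ^ (1 / 3 : ℝ) *
        (κ ^ (-(1 / 3) : ℝ) * (1 + θ) ^ (-(2 / 3) : ℝ))) ^ 3 := pow_le_pow_left₀ hz h1 3
      _ = 1 / 10 ^ 9 * (a * (κ⁻¹ * ((1 + θ) ^ 2)⁻¹)) := by
        rw [mul_pow, mul_pow, mul_pow, hpow a ha0.le, hpow κ (by linarith),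
          hpow (1 + θ) (by linarith)]
        norm_num
        rw [Real.rpow_neg_one, mul_assoc]
  have hrange' : κ * MDepField.bulk J a b * z ^ 3 ≤ 1 / 10 ^ 9 * a := by
    rw [hbulk]
    have hκ0 : 0 < κ := by linarith
    have hθ2 : θ ^ 2 ≤ (1 + θ) ^ 2 := by gcongr; linarith
    calc κ * θ ^ 2 * z ^ 3 ≤ κ * (1 + θ) ^ 2 * (1 / 10 ^ 9 * (a * (κ⁻¹ * ((1 + θ) ^ 2)⁻¹))) := by
          gcongr
      _ = _ := by field_simp
  have hmain := hF.abs_tail_ratio_sub_one_le_of_range hz hrange'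
  rw [hbulk, show (θ ^ 2) ^ 3 = θ ^ 6 by ring] at hmain
  exact hmain
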